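/- Let $\Omega\subset\mathbb R^d$ be a bounded, open, connected $C^1$ domain with boundary $\Gamma=\partial\Omega$ and surface measure $ds$. Let $\Gamma_D,\Gamma_N\subset\Gamma$ be disjoint and open relative to $\Gamma$, with $\Gamma=\overline{\Gamma}_D\cup\overline{\Gamma}_N$, with $\overline{\Gamma}_D\cap\overline{\Gamma}_N$ of surface measure zero, and with $\Gamma_D$ of positive surface measure. Let $\alpha,\beta>1$ and $\gamma=\alpha\beta$, and assume the following. (G) $G\in C^1(\mathbb R)$ is convex, non-decreasing and coercive ($G(z)/z\to+\infty$ as $z\to+\infty$), and there is $C>0$ such that for all sufficiently large $z$: $\frac{|z|^\alpha}{C}-C\le G(z)\le C(|z|^\alpha+1)$, $|G'(z)|\le C(|z|^{\alpha-1}+1)$ and $G'(z)z\ge -C$. (H) $H\in C^2(\overline\Omega\times\mathbb R^d)$ is real-valued and bounded from below; for every $x\in\Omega$ the map $p\mapsto H(x,p)$ is strictly convex (in particular, uniformly convex is allowed); and there is $C>0$ such that for all $(x,p)\in\Omega\times\mathbb R^d$: $\frac{|p|^\beta}{C}-C\le H(x,p)\le C(|p|^\beta+1)$, $|D_xH(x,p)|\le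 C(|p|^\beta+1)$, $|D_pH(x,p)|\le C(|p|^{\beta-1}+1)$ and $-H(x,p)+D_pH(x,p)\cdot p\ge\frac{|p|^\beta}{C}-C$. (j) $j\in L^{\beta'}(\Gamma_N)$ with $\frac1\beta+\frac1{\beta'}=1$, and $j\ge0$. ($\psi$) $\psi\in W^{1,\gamma}(\Omega)$; moreover, in the case where $j=0$ almost everywhere on $\Gamma_N$, $\psi$ is continuous on $\overline\Omega$. Let $\mathcal D=\{w\in W^{1,\gamma}(\Omega): w\le\psi \text{ a.e. on }\Gamma_D\text{ in the sense of traces}\}$ and $$\mathcal I[w]=\int_\Omega G(H(x,Dw))\,dx-\int_{\Gamma_N}j\,w\,ds ,$$ where $Dw$ is the weak gradient and $w$ in the boundary integral is the trace of $w$, i.e. the $L^\gamma(\Gamma)$-limit of the boundary values of smooth functions converging to $w$ in $W^{1,\gamma}(\Omega)$. Then every $w\in W^{1,\gamma}(\Omega)$ has a trace and both integrals in $\mathcal I[w]$ converge absolutely, and there exists $u\in\mathcal D$ such that $$\mathcal I[u]=\inf_{w\in\mathcal D}\mathcal I[w].$$ -/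

import Mathlib

open Set Filter Topology MeasureTheory
open scoped ENNReal ContDiff Gradient

noncomputable section

/-- The Euclidean space `ℝ^d`. -/
abbrev Euc (d : ℕ) : Type := EuclideanSpace ℝ (Fin d)

/-- The surface measure `ds` on a subset `S` of a hypersurface in `ℝ^d`: the `(d-1)`-dimensional
Hausdorff measure, normalized to agree with Lebesgue measure on `(d-1)`-dimensional Euclidean
spaces. -/
def surfaceMeasure {d : ℕ} (S : Set (Euc d)) : Measure (Euc d) :=
  (Measure.euclideanHausdorffMeasure (d - 1)).restrict S

/-- A bounded, open and connected `C¹` domain: near each boundary point, `Ω` is the set of points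
that lie strictly above the graph of a `C¹` function, in the direction of some unit vector `e`.
The vector `y - ⟪e, y⟫ e` is the orthogonal projection of `y` to the hyperplane `e^⊥`. -/
structure IsC1Domain {d : ℕ} (Ω : Set (Euc d)) : Prop where
  isOpen : IsOpen Ω
  isConnected : IsConnected Ω
  isBounded : Bornology.IsBounded Ω
  boundary_graph : ∀ x ∈ frontier Ω, ∃ r > (0 : ℝ), ∃ e : Euc d, ‖e‖ = 1 ∧
    ∃ f : Euc d → ℝ, ContDiff ℝ 1 f ∧
      ∀ y ∈ Metric.ball x r, y ∈ Ω ↔ f (y - inner ℝ e y • e) < inner ℝ e y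

/-- The splitting of the boundary `Γ = ∂Ω` into a Dirichlet part `ΓD`, of positive surface measure,
and a Neumann part `ΓN`. -/
structure IsBoundaryPartition {d : ℕ} (Ω ΓD ΓN : Set (Euc d)) : Prop where
  relOpen_dirichlet : ∃ U : Set (Euc d), IsOpen U ∧ ΓD = frontier Ω ∩ U
  relOpen_neumann : ∃ U : Set (Euc d), IsOpen U ∧ ΓN = frontier Ω ∩ U
  disjoint : Disjoint ΓD ΓN
  cover : frontier Ω = closure ΓD ∪ closure ΓN
  interface_null : surfaceMeasure (frontier Ω) (closure ΓD ∩ closure ΓN) = 0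
  dirichlet_pos : 0 < surfaceMeasure (frontier Ω) ΓD

/-- `v` is a weak gradient of `w` in the open set `Ω`. -/
structure HasWeakGradient {d : ℕ} (Ω : Set (Euc d)) (w : Euc d → ℝ) (v : Euc d → Euc d) :
    Prop where
  locallyIntegrable_fun : LocallyIntegrableOn w Ω volume
  locallyIntegrable_grad : LocallyIntegrableOn v Ω volume
  integral_eq : ∀ φ : Euc d → ℝ, ContDiff ℝ ∞ φ → HasCompactSupport φ → tsupport φ ⊆ Ω →
    ∀ e : Euc d, ∫ x in Ω, w x * fderiv ℝ φ x e = - ∫ x in Ω, inner ℝ (v x) e * φ x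

/-- `w ∈ W^{1,p}(Ω)`, for a representative `w` (only its values in `Ω` matter). -/
def MemW1 {d : ℕ} (Ω : Set (Euc d)) (p : ℝ≥0∞) (w : Euc d → ℝ) : Prop :=
  MemLp w p (volume.restrict Ω) ∧
    ∃ v : Euc d → Euc d, MemLp v p (volume.restrict Ω) ∧ HasWeakGradient Ω w v

open Classical in
/-- The weak gradient `Dw` of `w` in `Ω` (unique almost everywhere in `Ω`); it is `0` by convention
if there is none. -/
def weakGrad {d : ℕ} (Ω : Set (Euc d)) (w : Euc d → ℝ) : Euc d → Euc d :=
  if h : ∃ v, HasWeakGradient Ω w v then Classical.choose h else 0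

/-- `t` is the trace of `w ∈ W^{1,p}(Ω)` on `∂Ω`: the limit in `L^p(∂Ω)` of the boundary values of
functions that are smooth up to the boundary and converge to `w` in `W^{1,p}(Ω)`. -/
def IsTrace {d : ℕ} (Ω : Set (Euc d)) (p : ℝ≥0∞) (w t : Euc d → ℝ) : Prop :=
  MemLp t p (surfaceMeasure (frontier Ω)) ∧
    ∃ φ : ℕ → Euc d → ℝ, (∀ n, ContDiff ℝ ∞ (φ n)) ∧
      Tendsto (fun n => eLpNorm (fun x => φ n x - w x) p (volume.restrict Ω)) atTop (𝓝 0) ∧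
      Tendsto (fun n => eLpNorm (fun x => ∇ (φ n) x - weakGrad Ω w x) p (volume.restrict Ω))
        atTop (𝓝 0) ∧
      Tendsto (fun n => eLpNorm (fun x => φ n x - t x) p (surfaceMeasure (frontier Ω)))
        atTop (𝓝 0)

open Classical in
/-- The boundary trace of `w` (unique almost everywhere on `∂Ω`); it is `0` by convention if there
is none. -/
def boundaryTrace {d : ℕ} (Ω : Set (Euc d)) (p : ℝ≥0∞) (w : Euc d → ℝ) : Euc d → ℝ :=
  if h : ∃ t, IsTrace Ω p w t then Classical.choose h else 0

/-- The assumptions on the energy `G`, with growth exponent `α`. -/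
structure EnergyAssumption (α : ℝ) (G : ℝ → ℝ) : Prop where
  one_lt : 1 < α
  contDiff : ContDiff ℝ 1 G
  coercive : Tendsto (fun z => G z / z) atTop atTop
  convex : ConvexOn ℝ univ G
  monotone : Monotone G
  growth : ∃ C > (0 : ℝ), ∀ᶠ z : ℝ in atTop,
    |z| ^ α / C - C ≤ G z ∧ G z ≤ C * (|z| ^ α + 1) ∧ |deriv G z| ≤ C * (|z| ^ (α - 1) + 1)
  deriv_mul_bound : ∃ C > (0 : ℝ), ∀ᶠ z : ℝ in atTop, -C ≤ deriv G z * z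

/-- The assumptions on the Hamiltonian `H`, with growth exponent `β`. -/
structure HamiltonianAssumption {d : ℕ} (Ω : Set (Euc d)) (β : ℝ) (H : Euc d → Euc d → ℝ) :
    Prop where
  one_lt : 1 < β
  contDiffOn : ContDiffOn ℝ 2 (fun z : Euc d × Euc d => H z.1 z.2) (closure Ω ×ˢ univ)
  bddBelow : ∃ c : ℝ, ∀ x ∈ closure Ω, ∀ p, c ≤ H x p
  strictConvex : ∀ x ∈ Ω, StrictConvexOn ℝ univ (H x)
  growth : ∃ C > (0 : ℝ), ∀ x ∈ Ω, ∀ p : Euc d,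
    ‖p‖ ^ β / C - C ≤ H x p ∧ H x p ≤ C * (‖p‖ ^ β + 1) ∧
    ‖fderiv ℝ (fun y => H y p) x‖ ≤ C * (‖p‖ ^ β + 1) ∧
    ‖fderiv ℝ (H x) p‖ ≤ C * (‖p‖ ^ (β - 1) + 1) ∧
    ‖p‖ ^ β / C - C ≤ - H x p + fderiv ℝ (H x) p p

/-- The admissible set: functions `w ∈ W^{1,γ}(Ω)` with `w ≤ ψ` on `ΓD` in the sense of traces. -/
def admissibleSet {d : ℕ} (Ω ΓD : Set (Euc d)) (γ : ℝ≥0∞) (ψ : Euc d → ℝ) :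
    Set (Euc d → ℝ) :=
  {w | MemW1 Ω γ w ∧ ∀ᵐ s ∂(surfaceMeasure ΓD), boundaryTrace Ω γ w s ≤ boundaryTrace Ω γ ψ s}

/-- The functional `I[w] = ∫_Ω G(H(x, Dw)) dx - ∫_{ΓN} j w ds`. -/
def costFunctional {d : ℕ} (Ω ΓN : Set (Euc d)) (γ : ℝ≥0∞) (G : ℝ → ℝ)
    (H : Euc d → Euc d → ℝ) (j : Euc d → ℝ) (w : Euc d → ℝ) : ℝ :=
  (∫ x in Ω, G (H x (weakGrad Ω w x))) - ∫ s, j s * boundaryTrace Ω γ w s ∂(surfaceMeasure ΓN)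

end

/-! ### Weak gradients -/

section WeakGradient

variable {d : ℕ} {Ω : Set (Euc d)}

/-! Put p = αβ and F(x, q) = G(H(x, q)). Since G is convex and non-decreasing and H is convex in q,
F is convex in q, and the growth bounds give a|q|^p - b ≤ F ≤ C(|q|^p + 1)
(`HamiltonianAssumption.isConvexIntegrand`). The proof is the direct method; the difficulty is that
F does not see additive constants, so these have to be controlled from the boundary. Write w = c +
z, with z controlled by Dw through Poincaré's inequality.

Case ∫ j > 0 (`IsConvexIntegrand.exists_obstacle_minimizer`). By the trace inequality, the
constraint w ≤ ψ on Γ_D, a set of positive measure, bounds c above by a multiple of ‖Dw‖ + 1. The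
boundary term is -c ∫ j up to another multiple of ‖Dw‖ + 1, hence penalizes c → -∞. As p > 1, the
term a‖Dw‖^p dominates everything linear, so sublevel sets are bounded in W^{1,p}.

Case j = 0. The functional is invariant under constants, so it is first minimized over all of
W^{1,p}, normalized by mean zero (`IsConvexIntegrand.exists_free_minimizer`). A free minimizer v is
essentially bounded above (`IsConvexIntegrand.exists_ae_le_of_free_minimizer`), while ψ is bounded
below on the compact closure. Hence v plus a suitable constant lies below ψ: it is admissible and
has the free minimum as its value. For the bound on v, compare v with T(v), T' = 1 - τ, 0 ≤ τ ≤ 1: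
convexity between Dv and 0 gives ∫ τ(v)|Dv| ≤ C ∫ τ(v). A De Giorgi iteration over the level sets
then concludes; in place of Sobolev's inequality it uses that a function supported on a set of
measure at most κℓ^d has L¹ norm at most Cℓ times that of its gradient.

The abstract minimization (`exists_minimizer`) avoids weak convergence. Almost norm-minimal elements
are chosen in shrinking, midpoint-convex sublevel sets; uniform convexity of L^p makes them a Cauchy
sequence together with their gradients. Fatou's lemma gives lower semicontinuity under this strong
convergence, and continuity of the trace preserves the constraint.

The analysis on the domain is built from local graph charts: density of functions smooth up to the
boundary (mollifiers shifted into the domain), the trace inequality (integration along the chart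
direction), and Poincaré's inequality (star-shaped pieces glued by connectedness). -/

theorem integrable_smul_of_locallyIntegrableOn {E : Type*} [NormedAddCommGroup E]
    [NormedSpace ℝ E] {v : Euc d → E} (hv : LocallyIntegrableOn v Ω volume) {φ : Euc d → ℝ}
    (hφ : Continuous φ) (hc : HasCompactSupport φ) (hs : tsupport φ ⊆ Ω) :
    Integrable (fun x => φ x • v x) volume := by
  have h1 : IntegrableOn v (tsupport φ) volume := hv.integrableOn_compact_subset hs hc
  have h2 : IntegrableOn (fun x => φ x • v x) (tsupport φ) volume :=
    h1.continuousOn_smul hφ.continuousOn hc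
  refine (integrableOn_iff_integrable_of_support_subset ?_).1 h2
  intro x hx
  apply subset_tsupport φ
  intro h
  simp [h] at hx

theorem setIntegral_eq_integral_of_tsupport_subset {E : Type*} [NormedAddCommGroup E]
    [NormedSpace ℝ E] {g : Euc d → E} {φ : Euc d → ℝ}
    (hs : tsupport φ ⊆ Ω) (hg : ∀ x, φ x = 0 → g x = 0) :
    ∫ x in Ω, g x = ∫ x, g x := by
  refine setIntegral_eq_integral_of_forall_compl_eq_zero fun x hx => hg x ?_
  exact image_eq_zero_of_notMem_tsupport fun h => hx (hs h)

theorem inner_gradient_eq_fderiv (f : Euc d → ℝ) (x e : Euc d) :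
    inner ℝ (∇ f x) e = fderiv ℝ f x e := by
  simp [gradient]

theorem continuous_gradient {f : Euc d → ℝ} (hf : ContDiff ℝ 1 f) : Continuous (∇ f) :=
  (InnerProductSpace.toDual ℝ (Euc d)).symm.continuous.comp (hf.continuous_fderiv one_ne_zero)

theorem fderiv_apply_eq_zero_of_notMem_tsupport {φ : Euc d → ℝ} {x : Euc d}
    (h : x ∉ tsupport φ) (e : Euc d) : fderiv ℝ φ x e = 0 := by
  have : fderiv ℝ φ x = 0 := by
    have h1 : x ∉ tsupport (fderiv ℝ φ) := fun h' => h (tsupport_fderiv_subset ℝ h')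
    exact image_eq_zero_of_notMem_tsupport h1
  simp [this]

theorem continuous_fderiv_apply_const {φ : Euc d → ℝ} (hφ : ContDiff ℝ 1 φ) (e : Euc d) :
    Continuous fun x => fderiv ℝ φ x e :=
  (hφ.continuous_fderiv one_ne_zero).clm_apply continuous_const

theorem integrable_mul_fderiv {w : Euc d → ℝ} (hw : LocallyIntegrableOn w Ω volume)
    {φ : Euc d → ℝ} (hφ : ContDiff ℝ ∞ φ) (hc : HasCompactSupport φ) (hs : tsupport φ ⊆ Ω)
    (e : Euc d) : Integrable (fun x => w x * fderiv ℝ φ x e) volume := by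
  have h1 : HasCompactSupport (fun x => fderiv ℝ φ x e) := hc.fderiv_apply ℝ e
  have := integrable_smul_of_locallyIntegrableOn hw
    (continuous_fderiv_apply_const (hφ.of_le (by simp)) e) h1
    ((tsupport_fderiv_apply_subset ℝ e).trans hs)
  simpa [mul_comm] using this

theorem integrable_inner_mul {v : Euc d → Euc d} (hv : LocallyIntegrableOn v Ω volume)
    {φ : Euc d → ℝ} (hφ : Continuous φ) (hc : HasCompactSupport φ) (hs : tsupport φ ⊆ Ω)
    (e : Euc d) : Integrable (fun x => inner ℝ (v x) e * φ x) volume := by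
  have := (integrable_smul_of_locallyIntegrableOn hv hφ hc hs).inner_const (𝕜 := ℝ) e
  refine this.congr (Eventually.of_forall fun x => ?_)
  simp [inner_smul_left, mul_comm]

namespace HasWeakGradient

variable {w w' : Euc d → ℝ} {v v' : Euc d → Euc d}

/-- The fundamental lemma of the calculus of variations for v - v', whose vector-valued integrals
against test functions vanish because every component does. -/
theorem ae_unique (hΩ : IsOpen Ω) (h : HasWeakGradient Ω w v) (h' : HasWeakGradient Ω w v') :
    v =ᵐ[volume.restrict Ω] v' := by
  have key : ∀ᵐ x ∂volume, x ∈ Ω → v x - v' x = 0 := by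
    refine hΩ.ae_eq_zero_of_integral_contDiff_smul_eq_zero
      (h.locallyIntegrable_grad.sub h'.locallyIntegrable_grad) fun g hg hc hs => ?_
    have i1 := integrable_smul_of_locallyIntegrableOn h.locallyIntegrable_grad hg.continuous hc hs
    have i2 := integrable_smul_of_locallyIntegrableOn h'.locallyIntegrable_grad hg.continuous hc hs
    refine ext_inner_right ℝ fun e => ?_
    have h1 := h.integral_eq g hg hc hs e
    rw [h'.integral_eq g hg hc hs e] at h1
    rw [setIntegral_eq_integral_of_tsupport_subset hs (by intro x hx; simp [hx]),
      setIntegral_eq_integral_of_tsupport_subset hs (by intro x hx; simp [hx])] at h1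
    simp only [smul_sub]
    rw [integral_sub i1 i2, inner_sub_left, inner_zero_left, real_inner_comm, ← integral_inner i1,
      real_inner_comm, ← integral_inner i2]
    have e1 : ∀ u : Euc d → Euc d, (fun x => inner ℝ e (g x • u x)) =
        fun x => inner ℝ (u x) e * g x := by
      intro u; ext x; rw [inner_smul_right, real_inner_comm, mul_comm]
    rw [e1, e1]
    linarith
  rw [Filter.EventuallyEq, ae_restrict_iff' hΩ.measurableSet]
  filter_upwards [key] with x hx hxΩ using sub_eq_zero.1 (hx hxΩ)

theorem add (h : HasWeakGradient Ω w v) (h' : HasWeakGradient Ω w' v') :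
    HasWeakGradient Ω (w + w') (v + v') where
  locallyIntegrable_fun := h.locallyIntegrable_fun.add h'.locallyIntegrable_fun
  locallyIntegrable_grad := h.locallyIntegrable_grad.add h'.locallyIntegrable_grad
  integral_eq := by
    intro φ hφ hc hs e
    simp only [Pi.add_apply, add_mul, inner_add_left]
    rw [integral_add (integrable_mul_fderiv h.locallyIntegrable_fun hφ hc hs e).integrableOn
      (integrable_mul_fderiv h'.locallyIntegrable_fun hφ hc hs e).integrableOn,
      integral_add (integrable_inner_mul h.locallyIntegrable_grad hφ.continuous hc hs e).integrableOn
      (integrable_inner_mul h'.locallyIntegrable_grad hφ.continuous hc hs e).integrableOn,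
      h.integral_eq φ hφ hc hs e, h'.integral_eq φ hφ hc hs e]
    ring

theorem const_smul (c : ℝ) (h : HasWeakGradient Ω w v) : HasWeakGradient Ω (c • w) (c • v) where
  locallyIntegrable_fun := h.locallyIntegrable_fun.smul c
  locallyIntegrable_grad := h.locallyIntegrable_grad.smul c
  integral_eq := by
    intro φ hφ hc hs e
    have := h.integral_eq φ hφ hc hs e
    simp only [Pi.smul_apply, smul_eq_mul, mul_assoc, inner_smul_left, integral_const_mul, this]
    simp

theorem of_contDiff {f : Euc d → ℝ} (hf : ContDiff ℝ 1 f) :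
    HasWeakGradient Ω f (∇ f) where
  locallyIntegrable_fun := hf.continuous.locallyIntegrable.locallyIntegrableOn Ω
  locallyIntegrable_grad := (continuous_gradient hf).locallyIntegrable.locallyIntegrableOn Ω
  integral_eq := by
    intro φ hφ hc hs e
    have hlf := hf.continuous.locallyIntegrable.locallyIntegrableOn (μ := volume) Ω
    have hlg := (continuous_gradient hf).locallyIntegrable.locallyIntegrableOn (μ := volume) Ω
    rw [setIntegral_eq_integral_of_forall_compl_eq_zero (fun x hx => by
        rw [fderiv_apply_eq_zero_of_notMem_tsupport (fun h => hx (hs h)), mul_zero]),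
      setIntegral_eq_integral_of_tsupport_subset hs (by intro x hx; simp [hx])]
    simp only [inner_gradient_eq_fderiv]
    refine integral_mul_fderiv_eq_neg_fderiv_mul_of_integrable ?_ ?_ ?_ ?_ ?_
    · simpa [inner_gradient_eq_fderiv] using integrable_inner_mul hlg hφ.continuous hc hs e
    · exact integrable_mul_fderiv hlf hφ hc hs e
    · simpa [mul_comm] using integrable_smul_of_locallyIntegrableOn hlf hφ.continuous hc hs
    · exact fun x _ => hf.differentiable one_ne_zero x
    · exact fun x _ => hφ.differentiable (by simp) x

/-- If φ is a test function, so is χφ; testing w with it yields the product rule. -/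
theorem mul (hΩ : IsOpen Ω) (h : HasWeakGradient Ω w v) {χ : Euc d → ℝ} (hχ : ContDiff ℝ ∞ χ) :
    HasWeakGradient Ω (fun x => χ x * w x) (fun x => χ x • v x + w x • ∇ χ x) where
  locallyIntegrable_fun := by
    simpa [smul_eq_mul] using h.locallyIntegrable_fun.continuousOn_smul hΩ.isLocallyClosed
      hχ.continuous.continuousOn
  locallyIntegrable_grad := by
    refine (h.locallyIntegrable_grad.continuousOn_smul hΩ.isLocallyClosed
      hχ.continuous.continuousOn).add ?_
    exact h.locallyIntegrable_fun.smul_continuousOn hΩ.isLocallyClosed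
      (continuous_gradient (hχ.of_le (by simp))).continuousOn
  integral_eq := by
    intro φ hφ hc hs e
    have hφχ : ContDiff ℝ ∞ (fun x => χ x * φ x) := hχ.mul hφ
    have hcχ : HasCompactSupport (fun x => χ x * φ x) := hc.mul_left
    have hsχ : tsupport (fun x => χ x * φ x) ⊆ Ω := tsupport_mul_subset_right.trans hs
    have h1 := h.integral_eq _ hφχ hcχ hsχ e
    have hd : ∀ x, fderiv ℝ (fun x => χ x * φ x) x e =
        χ x * fderiv ℝ φ x e + φ x * fderiv ℝ χ x e := by
      intro x
      rw [fderiv_fun_mul (hχ.differentiable (by simp) x) (hφ.differentiable (by simp) x)]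
      simp
    have i1 : IntegrableOn (fun x => w x * (χ x * fderiv ℝ φ x e)) Ω := by
      have hcf : HasCompactSupport (fun x => χ x * fderiv ℝ φ x e) :=
        (hc.fderiv_apply ℝ e).mul_left
      have := integrable_smul_of_locallyIntegrableOn h.locallyIntegrable_fun
        (hχ.continuous.mul (continuous_fderiv_apply_const (hφ.of_le (by simp)) e)) hcf
        (tsupport_mul_subset_right.trans ((tsupport_fderiv_apply_subset ℝ e).trans hs))
      exact (this.congr (Eventually.of_forall fun x => by simp [mul_comm])).integrableOn
    have i2 : IntegrableOn (fun x => w x * (φ x * fderiv ℝ χ x e)) Ω := by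
      have hcf : HasCompactSupport (fun x => φ x * fderiv ℝ χ x e) := hc.mul_right
      have := integrable_smul_of_locallyIntegrableOn h.locallyIntegrable_fun
        (hφ.continuous.mul (continuous_fderiv_apply_const (hχ.of_le (by simp)) e)) hcf
        (tsupport_mul_subset_left.trans hs)
      exact (this.congr (Eventually.of_forall fun x => by simp [mul_comm])).integrableOn
    have i3 : IntegrableOn (fun x => inner ℝ (v x) e * (χ x * φ x)) Ω :=
      (integrable_inner_mul h.locallyIntegrable_grad hφχ.continuous hcχ hsχ e).integrableOn
    simp only [hd, mul_add] at h1
    rw [integral_add i1 i2] at h1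
    have e1 : ∫ x in Ω, χ x * w x * fderiv ℝ φ x e = ∫ x in Ω, w x * (χ x * fderiv ℝ φ x e) := by
      congr 1; ext x; ring
    have e2 : ∫ x in Ω, inner ℝ (χ x • v x + w x • ∇ χ x) e * φ x =
        (∫ x in Ω, inner ℝ (v x) e * (χ x * φ x)) + ∫ x in Ω, w x * (φ x * fderiv ℝ χ x e) := by
      rw [← integral_add i3 i2]
      congr 1; ext x
      rw [inner_add_left, inner_smul_left, inner_smul_left, inner_gradient_eq_fderiv]
      simp; ring
    rw [e1, e2]; linarith

end HasWeakGradient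

theorem tendsto_integral_mul_of_tendsto_eLpNorm_one {α : Type*} [MeasurableSpace α]
    {μ : Measure α} {f : ℕ → α → ℝ} {g : α → ℝ} (hf : ∀ n, Integrable (f n) μ)
    (hg : Integrable g μ) (h : Tendsto (fun n => eLpNorm (f n - g) 1 μ) atTop (𝓝 0))
    {ψ : α → ℝ} (hψ : AEStronglyMeasurable ψ μ) {C : ℝ} (hC : ∀ x, ‖ψ x‖ ≤ C) :
    Tendsto (fun n => ∫ x, f n x * ψ x ∂μ) atTop (𝓝 (∫ x, g x * ψ x ∂μ)) := by
  refine tendsto_integral_of_L1' _ (hg.mul_bdd hψ (Eventually.of_forall hC)).aestronglyMeasurable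
    (Eventually.of_forall fun n => (hf n).mul_bdd hψ (Eventually.of_forall hC)) ?_
  have h0 : Tendsto (fun n => ENNReal.ofReal C * eLpNorm (f n - g) 1 μ) atTop (𝓝 0) := by
    simpa using ENNReal.Tendsto.const_mul h (Or.inr ENNReal.ofReal_ne_top)
  refine tendsto_of_tendsto_of_tendsto_of_le_of_le tendsto_const_nhds h0 (fun _ => zero_le) ?_
  intro n
  refine eLpNorm_le_mul_eLpNorm_of_ae_le_mul (Eventually.of_forall fun x => ?_) 1
  simp only [Pi.sub_apply]
  rw [← sub_mul, norm_mul, mul_comm]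
  exact mul_le_mul_of_nonneg_right (hC x) (norm_nonneg _)

/-- The weak gradient is a closed operator: both sides of the defining identity are continuous in
L¹, test functions and their derivatives being bounded. -/
theorem HasWeakGradient.of_tendsto {w : ℕ → Euc d → ℝ} {v : ℕ → Euc d → Euc d}
    {w₀ : Euc d → ℝ} {v₀ : Euc d → Euc d} (h : ∀ n, HasWeakGradient Ω (w n) (v n))
    (hw : ∀ n, IntegrableOn (w n) Ω) (hv : ∀ n, IntegrableOn (v n) Ω)
    (hw₀ : IntegrableOn w₀ Ω) (hv₀ : IntegrableOn v₀ Ω)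
    (hwt : Tendsto (fun n => eLpNorm (w n - w₀) 1 (volume.restrict Ω)) atTop (𝓝 0))
    (hvt : Tendsto (fun n => eLpNorm (v n - v₀) 1 (volume.restrict Ω)) atTop (𝓝 0)) :
    HasWeakGradient Ω w₀ v₀ where
  locallyIntegrable_fun := hw₀.locallyIntegrableOn
  locallyIntegrable_grad := hv₀.locallyIntegrableOn
  integral_eq := by
    intro φ hφ hc hs e
    have hφ' := continuous_fderiv_apply_const (hφ.of_le (by simp) : ContDiff ℝ 1 φ) e
    obtain ⟨C, hC⟩ := hc.exists_bound_of_continuous hφ.continuous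
    obtain ⟨C', hC'⟩ := (hc.fderiv_apply ℝ e).exists_bound_of_continuous hφ'
    have t1 := tendsto_integral_mul_of_tendsto_eLpNorm_one hw hw₀ hwt
      hφ'.aestronglyMeasurable hC'
    have t2 := tendsto_integral_mul_of_tendsto_eLpNorm_one (μ := volume.restrict Ω)
      (f := fun n x => inner ℝ (v n x) e) (g := fun x => inner ℝ (v₀ x) e)
      (fun n => (hv n).inner_const e) (hv₀.inner_const e) ?_
      hφ.continuous.aestronglyMeasurable hC
    · simp only [fun n => (h n).integral_eq φ hφ hc hs e] at t1
      exact tendsto_nhds_unique t1 t2.neg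
    · have h0 : Tendsto (fun n => ENNReal.ofReal ‖e‖ * eLpNorm (v n - v₀) 1 (volume.restrict Ω))
          atTop (𝓝 0) := by
        have := ENNReal.Tendsto.const_mul (a := ENNReal.ofReal ‖e‖) hvt
          (Or.inr ENNReal.ofReal_ne_top)
        rwa [mul_zero] at this
      refine tendsto_of_tendsto_of_tendsto_of_le_of_le tendsto_const_nhds h0 (fun _ => zero_le) ?_
      intro n
      refine eLpNorm_le_mul_eLpNorm_of_ae_le_mul (Eventually.of_forall fun x => ?_) 1
      simp only [Pi.sub_apply]
      rw [← inner_sub_left, mul_comm]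
      exact norm_inner_le_norm _ _

theorem HasWeakGradient.weakGrad_ae_eq (hΩ : IsOpen Ω) {w : Euc d → ℝ} {v : Euc d → Euc d}
    (h : HasWeakGradient Ω w v) : weakGrad Ω w =ᵐ[volume.restrict Ω] v := by
  have hex : ∃ v, HasWeakGradient Ω w v := ⟨v, h⟩
  have : weakGrad Ω w = Classical.choose hex := by simp only [weakGrad, dif_pos hex]
  rw [this]
  exact (Classical.choose_spec hex).ae_unique hΩ h

theorem HasWeakGradient.memW1 {p : ℝ≥0∞} {w : Euc d → ℝ} {v : Euc d → Euc d}
    (h : HasWeakGradient Ω w v) (hw : MemLp w p (volume.restrict Ω))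
    (hv : MemLp v p (volume.restrict Ω)) : MemW1 Ω p w := ⟨hw, v, hv, h⟩

theorem tendsto_eLpNorm_one {α E : Type*} [MeasurableSpace α] [NormedAddCommGroup E]
    {μ : Measure α} [IsFiniteMeasure μ] {p : ℝ≥0∞} (hp : 1 ≤ p) {f : ℕ → α → E}
    (hf : ∀ n, AEStronglyMeasurable (f n) μ)
    (h : Tendsto (fun n => eLpNorm (f n) p μ) atTop (𝓝 0)) :
    Tendsto (fun n => eLpNorm (f n) 1 μ) atTop (𝓝 0) := by
  have hC : μ univ ^ (1 / (1 : ℝ≥0∞).toReal - 1 / p.toReal) ≠ ⊤ := by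
    refine ENNReal.rpow_ne_top_of_nonneg ?_ (measure_ne_top _ _)
    rcases eq_or_ne p ⊤ with rfl | hp'
    · simp
    · have : 1 ≤ p.toReal := by
        simpa using ENNReal.toReal_mono hp' hp
      have : 1 / p.toReal ≤ 1 := by
        rw [div_le_one (by linarith)]; exact this
      simpa using this
  have h0 := ENNReal.Tendsto.mul_const h (Or.inr hC)
  rw [zero_mul] at h0
  exact tendsto_of_tendsto_of_tendsto_of_le_of_le tendsto_const_nhds h0 (fun _ => zero_le)
    fun n => eLpNorm_le_eLpNorm_mul_rpow_measure_univ hp (hf n)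

namespace MemW1

variable {p : ℝ≥0∞} {w w' : Euc d → ℝ}

theorem hasWeakGradient (h : MemW1 Ω p w) : HasWeakGradient Ω w (weakGrad Ω w) := by
  obtain ⟨-, v, -, hv⟩ := h
  have hex : ∃ v, HasWeakGradient Ω w v := ⟨v, hv⟩
  have : weakGrad Ω w = Classical.choose hex := by simp only [weakGrad, dif_pos hex]
  rw [this]
  exact Classical.choose_spec hex

theorem memLp_weakGrad (hΩ : IsOpen Ω) (h : MemW1 Ω p w) :
    MemLp (weakGrad Ω w) p (volume.restrict Ω) := by
  obtain ⟨-, v, hv, hg⟩ := h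
  exact hv.ae_eq (hg.weakGrad_ae_eq hΩ).symm

theorem add (h : MemW1 Ω p w) (h' : MemW1 Ω p w') : MemW1 Ω p (w + w') := by
  obtain ⟨h1, v, hv, hg⟩ := h
  obtain ⟨h1', v', hv', hg'⟩ := h'
  exact ⟨h1.add h1', v + v', hv.add hv', hg.add hg'⟩

theorem const_smul (c : ℝ) (h : MemW1 Ω p w) : MemW1 Ω p (c • w) := by
  obtain ⟨h1, v, hv, hg⟩ := h
  exact ⟨h1.const_smul c, c • v, hv.const_smul c, hg.const_smul c⟩

theorem sub (h : MemW1 Ω p w) (h' : MemW1 Ω p w') : MemW1 Ω p (w - w') := by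
  simpa [sub_eq_add_neg] using h.add (h'.const_smul (-1))

theorem of_contDiff (hb : Bornology.IsBounded Ω) {f : Euc d → ℝ}
    (hf : ContDiff ℝ 1 f) : MemW1 Ω p f := by
  have key : ∀ {E : Type} [NormedAddCommGroup E] {g : Euc d → E}, Continuous g →
      AEStronglyMeasurable g volume → MemLp g p (volume.restrict Ω) := by
    intro E _ g hg hm
    have hK : IsCompact (closure Ω) := hb.isCompact_closure
    obtain ⟨C, hC⟩ := hK.exists_bound_of_continuousOn hg.continuousOn
    have : IsFiniteMeasure (volume.restrict (closure Ω)) := ⟨by simpa using hK.measure_lt_top⟩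
    have : MemLp g p (volume.restrict (closure Ω)) := MemLp.of_bound hm.restrict C
      (ae_restrict_of_forall_mem isClosed_closure.measurableSet hC)
    exact this.mono_measure (Measure.restrict_mono subset_closure le_rfl)
  exact ⟨key hf.continuous hf.continuous.aestronglyMeasurable, ∇ f,
    key (continuous_gradient hf) (continuous_gradient hf).aestronglyMeasurable,
    .of_contDiff hf⟩

theorem const (hb : Bornology.IsBounded Ω) (c : ℝ) : MemW1 Ω p (fun _ => c) :=
  of_contDiff hb contDiff_const

end MemW1

theorem weakGrad_of_contDiff (hΩ : IsOpen Ω) {f : Euc d → ℝ} (hf : ContDiff ℝ 1 f) :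
    weakGrad Ω f =ᵐ[volume.restrict Ω] ∇ f := (HasWeakGradient.of_contDiff hf).weakGrad_ae_eq hΩ

theorem weakGrad_add_const (hΩ : IsOpen Ω) {p : ℝ≥0∞} {w : Euc d → ℝ} (h : MemW1 Ω p w) (c : ℝ) :
    weakGrad Ω (fun x => w x + c) =ᵐ[volume.restrict Ω] weakGrad Ω w := by
  have h1 := h.hasWeakGradient.add (HasWeakGradient.of_contDiff (Ω := Ω)
    (contDiff_const (c := c) : ContDiff ℝ 1 fun _ : Euc d => c))
  have h2 := h1.weakGrad_ae_eq hΩ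
  have h3 : weakGrad Ω w + ∇ (fun _ : Euc d => c) = weakGrad Ω w := by
    ext1 x
    simp
  rw [h3] at h2
  exact h2

end WeakGradient

/-! ### Uniform convexity of the `L^p` norms -/

section UniformConvexity

variable {E : Type*} [NormedAddCommGroup E] [InnerProductSpace ℝ E]

theorem convexOn_norm_rpow {p : ℝ} (hp : 1 ≤ p) : ConvexOn ℝ univ (fun a : E => ‖a‖ ^ p) := by
  refine ⟨convex_univ, fun a _ b _ s t hs ht hst => ?_⟩
  have h1 : ‖s • a + t • b‖ ≤ s * ‖a‖ + t * ‖b‖ := by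
    refine (norm_add_le _ _).trans (le_of_eq ?_)
    rw [norm_smul, norm_smul, Real.norm_of_nonneg hs, Real.norm_of_nonneg ht]
  have h2 := (convexOn_rpow hp).2 (norm_nonneg a) (norm_nonneg b) hs ht hst
  simp only [smul_eq_mul] at h2 ⊢
  exact (Real.rpow_le_rpow (norm_nonneg _) h1 (by linarith)).trans h2

theorem norm_half_smul_add_rpow_le {p : ℝ} (hp : 1 ≤ p) (a b : E) :
    ‖(1 / 2 : ℝ) • (a + b)‖ ^ p ≤ (‖a‖ ^ p + ‖b‖ ^ p) / 2 := by
  have := (convexOn_norm_rpow hp).2 (mem_univ a) (mem_univ b) (by norm_num : (0 : ℝ) ≤ 1 / 2)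
    (by norm_num : (0 : ℝ) ≤ 1 / 2) (by norm_num)
  simp only [smul_eq_mul, ← smul_add] at this
  linarith

theorem norm_half_smul_add_rpow_lt {p : ℝ} (hp : 1 < p) {a b : E} (hab : a ≠ b) :
    ‖(1 / 2 : ℝ) • (a + b)‖ ^ p < (‖a‖ ^ p + ‖b‖ ^ p) / 2 := by
  have h0 : ‖(1 / 2 : ℝ) • (a + b)‖ = ‖a + b‖ / 2 := by rw [norm_smul]; norm_num; ring
  by_cases h : ‖a‖ = ‖b‖
  · have h1 : ‖a + b‖ / 2 < ‖a‖ := by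
      have h2 : ‖a + b‖ < ‖a‖ + ‖b‖ := by
        refine lt_of_le_of_ne (norm_add_le _ _) fun h' => hab ?_
        exact (sameRay_iff_norm_add.2 h').eq_of_norm_eq h
      rw [← h] at h2; linarith
    rw [h0, ← h]
    have := Real.rpow_lt_rpow (by positivity) h1 (by linarith : 0 < p)
    linarith
  · have h1 := (strictConvexOn_rpow hp).2 (norm_nonneg a) (norm_nonneg b) h
      (by norm_num : (0 : ℝ) < 1 / 2) (by norm_num : (0 : ℝ) < 1 / 2) (by norm_num)
    simp only [smul_eq_mul] at h1
    rw [h0]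
    have h2 : ‖a + b‖ / 2 ≤ 1 / 2 * ‖a‖ + 1 / 2 * ‖b‖ := by linarith [norm_add_le a b]
    have := Real.rpow_le_rpow (by positivity) h2 (by linarith : 0 ≤ p)
    linarith

/-- A pointwise, quantitative form of uniform convexity. By homogeneity it is enough to treat |a|^p
+ |b|^p = 1, where strict convexity and compactness bound the midpoint defect away from zero unless
|a - b|^p < ε. -/
theorem norm_sub_rpow_le_defect [FiniteDimensional ℝ E] {p : ℝ} (hp : 1 < p) {ε : ℝ}
    (hε : 0 < ε) : ∃ C : ℝ, 0 ≤ C ∧ ∀ a b : E, ‖a - b‖ ^ p ≤ ε * (‖a‖ ^ p + ‖b‖ ^ p) +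
      C * ((‖a‖ ^ p + ‖b‖ ^ p) / 2 - ‖(1 / 2 : ℝ) • (a + b)‖ ^ p) := by
  have hp0 : 0 < p := by linarith
  have hc : Continuous fun x : E => ‖x‖ ^ p :=
    continuous_norm.rpow_const fun _ => Or.inr hp0.le
  let D : E × E → ℝ := fun z => (‖z.1‖ ^ p + ‖z.2‖ ^ p) / 2 - ‖(1 / 2 : ℝ) • (z.1 + z.2)‖ ^ p
  have hD : Continuous D := by
    refine Continuous.sub (((hc.comp continuous_fst).add (hc.comp continuous_snd)).div_const _) ?_
    exact hc.comp (by fun_prop : Continuous fun z : E × E => (1 / 2 : ℝ) • (z.1 + z.2))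
  have hD0 : ∀ z, 0 ≤ D z := fun z => sub_nonneg.2 (norm_half_smul_add_rpow_le hp.le _ _)
  let S : Set (E × E) := {z | ‖z.1‖ ^ p + ‖z.2‖ ^ p = 1 ∧ ε ≤ ‖z.1 - z.2‖ ^ p}
  have hS1 : ∀ z : E × E, ‖z.1‖ ^ p + ‖z.2‖ ^ p = 1 → ‖z.1‖ ≤ 1 ∧ ‖z.2‖ ≤ 1 := by
    intro z hz
    have h1 := Real.rpow_nonneg (norm_nonneg z.1) p
    have h2 := Real.rpow_nonneg (norm_nonneg z.2) p
    constructor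
    · exact le_of_not_gt fun h => by linarith [Real.one_lt_rpow h hp0]
    · exact le_of_not_gt fun h => by linarith [Real.one_lt_rpow h hp0]
  have hS : IsCompact S := by
    refine Metric.isCompact_of_isClosed_isBounded ?_ ?_
    · refine IsClosed.inter (isClosed_eq ((hc.comp continuous_fst).add (hc.comp continuous_snd))
        continuous_const) (isClosed_le continuous_const (hc.comp (by fun_prop)))
    · refine (Metric.isBounded_closedBall (x := (0 : E × E)) (r := 1)).subset fun z hz => ?_
      rw [mem_closedBall_zero_iff]
      exact max_le (hS1 z hz.1).1 (hS1 z hz.1).2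
  obtain ⟨δ, hδ, hδS⟩ : ∃ δ > 0, ∀ z ∈ S, δ ≤ D z := by
    rcases S.eq_empty_or_nonempty with h | h
    · exact ⟨1, one_pos, by simp [h]⟩
    · obtain ⟨z, hz, hmin⟩ := hS.exists_isMinOn h hD.continuousOn
      refine ⟨D z, ?_, fun y hy => hmin hy⟩
      refine sub_pos.2 (norm_half_smul_add_rpow_lt hp fun h => ?_)
      have := hz.2
      rw [h, sub_self, norm_zero, Real.zero_rpow hp0.ne'] at this
      linarith
  have key : ∀ a b : E, ‖a‖ ^ p + ‖b‖ ^ p = 1 → ‖a - b‖ ^ p ≤ ε + 2 ^ p / δ * D (a, b) := by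
    intro a b hab
    by_cases h : ε ≤ ‖a - b‖ ^ p
    · have h1 : δ ≤ D (a, b) := hδS (a, b) ⟨hab, h⟩
      obtain ⟨ha, hb⟩ := hS1 (a, b) hab
      have h2 : ‖a - b‖ ^ p ≤ 2 ^ p :=
        Real.rpow_le_rpow (norm_nonneg _) (by linarith [norm_sub_le a b]) hp0.le
      have h3 : (2 : ℝ) ^ p ≤ 2 ^ p / δ * D (a, b) := by
        rw [div_mul_eq_mul_div, le_div_iff₀ hδ]
        exact mul_le_mul_of_nonneg_left h1 (by positivity)
      linarith
    · have := mul_nonneg (by positivity : (0 : ℝ) ≤ 2 ^ p / δ) (hD0 (a, b))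
      linarith
  refine ⟨2 ^ p / δ, by positivity, fun a b => ?_⟩
  rcases (add_nonneg (Real.rpow_nonneg (norm_nonneg a) p)
    (Real.rpow_nonneg (norm_nonneg b) p)).eq_or_lt with h | h
  · have h1 := Real.rpow_nonneg (norm_nonneg a) p
    have h2 := Real.rpow_nonneg (norm_nonneg b) p
    have ha : a = 0 := by
      have : ‖a‖ ^ p = 0 := by linarith
      rwa [Real.rpow_eq_zero (norm_nonneg _) hp0.ne', norm_eq_zero] at this
    have hb : b = 0 := by
      have : ‖b‖ ^ p = 0 := by linarith
      rwa [Real.rpow_eq_zero (norm_nonneg _) hp0.ne', norm_eq_zero] at this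
    simp [ha, hb, Real.zero_rpow hp0.ne']
  · set s := ‖a‖ ^ p + ‖b‖ ^ p with hs
    -- The scaling that normalizes |ta|^p + |tb|^p to 1.
    let t : ℝ := s ^ (-p⁻¹)
    have ht : 0 < t := Real.rpow_pos_of_pos h _
    have htp : t ^ p = s⁻¹ := by
      rw [← Real.rpow_mul h.le, neg_mul, inv_mul_cancel₀ hp0.ne', Real.rpow_neg_one]
    have hsc : ∀ c : E, ‖t • c‖ ^ p = s⁻¹ * ‖c‖ ^ p := by
      intro c
      rw [norm_smul, Real.norm_of_nonneg ht.le, Real.mul_rpow ht.le (norm_nonneg _), htp]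
    have := key (t • a) (t • b) (by rw [hsc, hsc, ← mul_add, ← hs, inv_mul_cancel₀ h.ne'])
    simp only [D] at this
    rw [← smul_sub, ← smul_add, smul_comm (1 / 2 : ℝ) t, hsc, hsc, hsc, hsc, ← mul_add, ← hs,
      inv_mul_cancel₀ h.ne', inv_mul_le_iff₀ h] at this
    refine this.trans (le_of_eq ?_)
    field_simp

/-- A bounded sequence in `L^p` whose midpoints are asymptotically no smaller converges. -/
theorem exists_tendsto_of_midpoint_defect [FiniteDimensional ℝ E] {α : Type*} [MeasurableSpace α]
    {μ : Measure α} {p : ℝ} (hp : 1 < p) {f : ℕ → α → E}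
    (hf : ∀ n, MemLp (f n) (ENNReal.ofReal p) μ) {R : ℝ} (hR : ∀ n, ∫ x, ‖f n x‖ ^ p ∂μ ≤ R)
    (hd : ∀ δ > (0 : ℝ), ∃ N, ∀ n ≥ N, ∀ m ≥ N,
      (∫ x, ‖f n x‖ ^ p ∂μ + ∫ x, ‖f m x‖ ^ p ∂μ) / 2
        - ∫ x, ‖(1 / 2 : ℝ) • (f n x + f m x)‖ ^ p ∂μ ≤ δ) :
    ∃ g, MemLp g (ENNReal.ofReal p) μ ∧
      Tendsto (fun n => eLpNorm (f n - g) (ENNReal.ofReal p) μ) atTop (𝓝 0) := by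
  have hp0 : 0 < p := by linarith
  have hP1 : 1 ≤ ENNReal.ofReal p := by simpa using hp.le
  have hPt : (ENNReal.ofReal p).toReal = p := ENNReal.toReal_ofReal hp0.le
  have hP0 : ENNReal.ofReal p ≠ 0 := (zero_lt_one.trans_le hP1).ne'
  have : Fact (1 ≤ ENNReal.ofReal p) := ⟨hP1⟩
  have hint : ∀ g : α → E, MemLp g (ENNReal.ofReal p) μ → Integrable (fun x => ‖g x‖ ^ p) μ := by
    intro g hg
    simpa [hPt] using hg.integrable_norm_rpow hP0 ENNReal.ofReal_ne_top
  have hsub : ∀ δ > (0 : ℝ), ∃ N, ∀ n ≥ N, ∀ m ≥ N, ∫ x, ‖f n x - f m x‖ ^ p ∂μ ≤ δ := by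
    intro δ hδ
    have hR0 : 0 ≤ R := (integral_nonneg fun x => by positivity).trans (hR 0)
    -- The sum of the two p-th power integrals is at most 2R, so this ε contributes at most δ/2; the
    -- defect contributes the other half.
    obtain ⟨C, hC, hCf⟩ := norm_sub_rpow_le_defect (E := E) hp
      (ε := δ / 2 / (2 * R + 1)) (by positivity)
    obtain ⟨N, hN⟩ := hd (δ / 2 / (C + 1)) (by positivity)
    refine ⟨N, fun n hn m hm => ?_⟩
    have i1 := hint _ (hf n)
    have i2 := hint _ (hf m)
    have i3 := hint _ (((hf n).add (hf m)).const_smul (1 / 2 : ℝ))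
    have i4 := hint _ ((hf n).sub (hf m))
    have h1 : ∫ x, ‖f n x - f m x‖ ^ p ∂μ ≤ ∫ x, (δ / 2 / (2 * R + 1) *
        (‖f n x‖ ^ p + ‖f m x‖ ^ p) + C * ((‖f n x‖ ^ p + ‖f m x‖ ^ p) / 2
          - ‖(1 / 2 : ℝ) • (f n x + f m x)‖ ^ p)) ∂μ := by
      refine integral_mono i4 ?_ fun x => hCf _ _
      exact ((i1.add i2).const_mul _).add ((((i1.add i2).div_const 2).sub i3).const_mul _)
    have h2 : ∫ x, (δ / 2 / (2 * R + 1) *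
        (‖f n x‖ ^ p + ‖f m x‖ ^ p) + C * ((‖f n x‖ ^ p + ‖f m x‖ ^ p) / 2
          - ‖(1 / 2 : ℝ) • (f n x + f m x)‖ ^ p)) ∂μ = δ / 2 / (2 * R + 1) *
        (∫ x, ‖f n x‖ ^ p ∂μ + ∫ x, ‖f m x‖ ^ p ∂μ) + C * ((∫ x, ‖f n x‖ ^ p ∂μ +
        ∫ x, ‖f m x‖ ^ p ∂μ) / 2 - ∫ x, ‖(1 / 2 : ℝ) • (f n x + f m x)‖ ^ p ∂μ) := by
      rw [integral_add, integral_const_mul, integral_const_mul, integral_sub, integral_div,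
        integral_add i1 i2]
      · exact (i1.add i2).div_const 2
      · exact i3
      · exact (i1.add i2).const_mul _
      · exact (((i1.add i2).div_const 2).sub i3).const_mul _
    have h3 : δ / 2 / (2 * R + 1) * (∫ x, ‖f n x‖ ^ p ∂μ + ∫ x, ‖f m x‖ ^ p ∂μ) ≤ δ / 2 := by
      rw [div_mul_eq_mul_div, div_le_iff₀ (by positivity)]
      refine mul_le_mul_of_nonneg_left ?_ (by positivity)
      linarith [hR n, hR m]
    have h4 : C * ((∫ x, ‖f n x‖ ^ p ∂μ + ∫ x, ‖f m x‖ ^ p ∂μ) / 2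
        - ∫ x, ‖(1 / 2 : ℝ) • (f n x + f m x)‖ ^ p ∂μ) ≤ δ / 2 := by
      refine (mul_le_mul_of_nonneg_left (hN n hn m hm) hC).trans ?_
      rw [mul_div_assoc', div_le_iff₀ (by positivity)]
      nlinarith
    linarith
  have hcau : CauchySeq fun n => (hf n).toLp (f n) := by
    refine Metric.cauchySeq_iff.2 fun ε hε => ?_
    obtain ⟨N, hN⟩ := hsub ((ε / 2) ^ p) (by positivity)
    refine ⟨N, fun n hn m hm => ?_⟩
    rw [dist_eq_norm, ← MemLp.toLp_sub, Lp.norm_toLp,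
      ((hf n).sub (hf m)).eLpNorm_eq_integral_rpow_norm hP0 ENNReal.ofReal_ne_top, hPt,
      ENNReal.toReal_ofReal (by positivity)]
    calc _ ≤ ((ε / 2) ^ p) ^ p⁻¹ :=
          Real.rpow_le_rpow (integral_nonneg fun x => by positivity) (hN n hn m hm)
            (inv_nonneg.2 hp0.le)
      _ = ε / 2 := Real.rpow_rpow_inv (by positivity) hp0.ne'
      _ < ε := by linarith
  obtain ⟨g, hg⟩ := cauchySeq_tendsto_of_complete hcau
  refine ⟨g, Lp.memLp g, ?_⟩
  rw [Lp.tendsto_Lp_iff_tendsto_eLpNorm'] at hg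
  refine hg.congr fun n => eLpNorm_congr_ae ?_
  filter_upwards [(hf n).coeFn_toLp] with x hx
  simp [hx]

end UniformConvexity

/-! ### Local geometry of a `C¹` domain -/

section Geometry

variable {d : ℕ} {Ω : Set (Euc d)}

/-- Near `x`, the set `Ω` is the positivity set of a Lipschitz function `g` that grows with unit
speed in the direction of the unit vector `e`. -/
structure IsGraphChart (Ω : Set (Euc d)) (x : Euc d) (r : ℝ) (e : Euc d) (g : Euc d → ℝ)
    (M : NNReal) : Prop where
  radius_pos : 0 < r
  norm_direction : ‖e‖ = 1
  lipschitz : LipschitzWith M g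
  add_smul : ∀ y t, g (y + t • e) = g y + t
  mem_iff : ∀ y ∈ Metric.ball x r, y ∈ Ω ↔ 0 < g y

theorem norm_sub_inner_smul_le {e : Euc d} (he : ‖e‖ = 1) (y : Euc d) :
    ‖y - inner ℝ e y • e‖ ≤ ‖y‖ := by
  refine le_of_sq_le_sq ?_ (norm_nonneg _)
  rw [norm_sub_sq_real, norm_smul, he, inner_smul_right, real_inner_comm, mul_one,
    Real.norm_eq_abs, sq_abs]
  nlinarith [sq_nonneg (inner ℝ e y)]

/-- The function g is the height over the graph, measured along e. After this point only the
Lipschitz regularity of the boundary is used. -/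
theorem IsC1Domain.exists_isGraphChart (hΩ : IsC1Domain Ω) {x : Euc d} (hx : x ∈ frontier Ω) :
    ∃ r e g M, IsGraphChart Ω x r e g M := by
  obtain ⟨r, hr, e, he, f, hf, hmem⟩ := hΩ.boundary_graph x hx
  let P : Euc d → Euc d := fun y => y - inner ℝ e y • e
  have hP : ∀ y z, ‖P y - P z‖ ≤ ‖y - z‖ := by
    intro y z
    have : P y - P z = (y - z) - inner ℝ e (y - z) • e := by
      simp only [P, inner_sub_right, sub_smul]; abel
    rw [this]; exact norm_sub_inner_smul_le he _
  obtain ⟨K, t, ht, hK⟩ := (hf.contDiffAt (x := P x)).exists_lipschitzOnWith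
  obtain ⟨r₁, hr₁, hball⟩ := Metric.mem_nhds_iff.1 ht
  -- A C¹ function is Lipschitz only locally; the extension makes g globally Lipschitz at the price
  -- of a smaller ball.
  obtain ⟨f', hf', heq⟩ := hK.extend_real
  refine ⟨min r r₁, e, fun y => inner ℝ e y - f' (P y), 1 + K, lt_min hr hr₁, he, ?_, ?_, ?_⟩
  · refine LipschitzWith.of_dist_le_mul fun y z => ?_
    have h1 : ‖f' (P y) - f' (P z)‖ ≤ K * ‖y - z‖ := by
      have := hf'.dist_le_mul (P y) (P z)
      rw [dist_eq_norm, dist_eq_norm] at this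
      exact this.trans (mul_le_mul_of_nonneg_left (hP y z) K.2)
    have h2 : ‖inner ℝ e (y - z)‖ ≤ 1 * ‖y - z‖ := he ▸ norm_inner_le_norm _ _
    rw [dist_eq_norm, dist_eq_norm]
    have : inner ℝ e y - f' (P y) - (inner ℝ e z - f' (P z)) =
        inner ℝ e (y - z) - (f' (P y) - f' (P z)) := by rw [inner_sub_right]; ring
    rw [this]
    refine (norm_sub_le _ _).trans ?_
    push_cast; linarith
  · intro y t
    have : P (y + t • e) = P y := by
      simp only [P, inner_add_right, inner_smul_right, real_inner_self_eq_norm_sq, he]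
      simp only [one_pow, mul_one, _root_.add_smul]; abel
    simp only [this, inner_add_right, inner_smul_right, real_inner_self_eq_norm_sq, he]
    ring
  · intro y hy
    have hy1 : P y ∈ t := hball (by
      rw [Metric.mem_ball, dist_eq_norm]
      refine (hP y x).trans_lt ?_
      rw [← dist_eq_norm]
      exact (Metric.mem_ball.1 hy).trans_le (min_le_right _ _))
    rw [hmem y (Metric.ball_subset_ball (min_le_left _ _) hy), sub_pos, ← heq hy1]

namespace IsGraphChart

variable {x e : Euc d} {r : ℝ} {g : Euc d → ℝ} {M : NNReal}

theorem abs_sub_le (h : IsGraphChart Ω x r e g M) (y z : Euc d) : |g y - g z| ≤ M * ‖y - z‖ := by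
  have := h.lipschitz.dist_le_mul y z
  rwa [dist_eq_norm, dist_eq_norm, Real.norm_eq_abs] at this

theorem one_le (h : IsGraphChart Ω x r e g M) : (1 : ℝ) ≤ M := by
  have h1 := h.abs_sub_le (0 + (1 : ℝ) • e) 0
  rw [h.add_smul] at h1
  simpa [h.norm_direction] using h1

theorem add_smul_add_ge (h : IsGraphChart Ω x r e g M) (y z : Euc d) (t : ℝ) :
    g y + t - M * ‖z‖ ≤ g (y + t • e + z) := by
  have h1 := h.abs_sub_le (y + t • e + z) (y + t • e)
  rw [add_sub_cancel_left] at h1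
  have h2 := neg_abs_le (g (y + t • e + z) - g (y + t • e))
  rw [h.add_smul] at h1 h2
  linarith

/-- A boundary point lies outside the open set Ω, so g ≤ 0 there; as a limit of points of Ω it also
satisfies g ≥ 0. -/
theorem eq_zero_of_mem_frontier (hΩ : IsOpen Ω) (h : IsGraphChart Ω x r e g M) {y : Euc d}
    (hy : y ∈ Metric.ball x r) (hf : y ∈ frontier Ω) : g y = 0 := by
  rw [hΩ.frontier_eq] at hf
  refine le_antisymm (not_lt.1 fun h' => hf.2 ((h.mem_iff y hy).2 h')) ?_
  have hcl : y ∈ closure {z | 0 ≤ g z} := by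
    have h1 : y ∈ closure (Metric.ball x r ∩ Ω) :=
      Metric.isOpen_ball.inter_closure ⟨hy, hf.1⟩
    exact closure_mono (fun z hz => ((h.mem_iff z hz.1).1 hz.2).le) h1
  rwa [(isClosed_le continuous_const h.lipschitz.continuous).closure_eq] at hcl

/-- A small cylinder, cut at the boundary, is star-shaped with respect to a ball. -/
theorem exists_starShaped (h : IsGraphChart Ω x r e g M) (hx : 0 ≤ g x) :
    ∃ N : Set (Euc d), IsOpen N ∧ x ∈ N ∧ ∃ b : Euc d, ∃ ρ > 0, Metric.ball b ρ ⊆ N ∩ Ω ∧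
      ∀ y ∈ N ∩ Ω, ∀ z ∈ Metric.ball b ρ, ∀ t ∈ Icc (0 : ℝ) 1, y + t • (z - y) ∈ N ∩ Ω := by
  have hM := h.one_le
  have hr := h.radius_pos
  have he := h.norm_direction
  -- The cylinder N below has radius ρ and half-height 7Mρ; as M ≥ 1, the factor 8 puts it inside
  -- the chart ball.
  obtain ⟨ρ, hρ, hρr⟩ : ∃ ρ > 0, 8 * M * ρ < r := ⟨r / (16 * M), by positivity, by
    field_simp; norm_num⟩
  let T : Euc d → ℝ := fun y => inner ℝ e y
  let P : Euc d → Euc d := fun y => y - T y • e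
  have hdec : ∀ y, y = P y + T y • e := fun y => by simp [P]
  have hTl : ∀ (y z : Euc d) (t : ℝ), T (y + t • z) = T y + t * T z := fun y z t => by
    simp [T, inner_add_right, inner_smul_right]
  have hPl : ∀ (y z : Euc d) (t : ℝ), P (y + t • z) = P y + t • P z := fun y z t => by
    simp only [P, hTl]; module
  have hTc : Continuous T := by fun_prop
  have hPc : Continuous P := by fun_prop
  have hPn : ∀ y, ‖P y‖ ≤ ‖y‖ := fun y => norm_sub_inner_smul_le he y
  have hTn : ∀ y, |T y| ≤ ‖y‖ := fun y => by
    simpa [he] using abs_real_inner_le_norm e y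
  have hTs : ∀ y z, T (y - z) = T y - T z := fun y z => inner_sub_right _ _ _
  let N : Set (Euc d) := {y | ‖P (y - x)‖ < ρ ∧ |T (y - x)| < 7 * M * ρ}
  have hNball : N ⊆ Metric.ball x r := by
    rintro y ⟨h1, h2⟩
    rw [Metric.mem_ball, dist_eq_norm, hdec (y - x)]
    refine (norm_add_le _ _).trans_lt ?_
    rw [norm_smul, he, mul_one, Real.norm_eq_abs]
    nlinarith
  have hNo : IsOpen N := by
    change IsOpen ({y | ‖P (y - x)‖ < ρ} ∩ {y | |T (y - x)| < 7 * M * ρ})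
    refine IsOpen.inter (isOpen_lt ?_ continuous_const) (isOpen_lt ?_ continuous_const)
    · exact (hPc.comp (continuous_id.sub continuous_const)).norm
    · exact (hTc.comp (continuous_id.sub continuous_const)).abs
  have hxN : x ∈ N := by
    constructor
    · simpa [P, T] using hρ
    · simp only [sub_self, T, inner_zero_right, abs_zero]; positivity
  have hge : ∀ y : Euc d, g x + T (y - x) - M * ‖P (y - x)‖ ≤ g y := by
    intro y
    have := h.add_smul_add_ge x (P (y - x)) (T (y - x))
    have e1 : x + T (y - x) • e + P (y - x) = y := by
      conv_rhs => rw [← add_sub_cancel x y, hdec (y - x)]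
      abel
    rwa [e1] at this
  -- At height 5Mρ the whole ball of radius ρ has heights between 4Mρ and 6Mρ, hence lies above the
  -- graph, which rises by at most Mρ over the cylinder.
  let b : Euc d := x + (5 * M * ρ) • e
  have hb : ∀ z ∈ Metric.ball b ρ, ‖P (z - x)‖ < ρ ∧ 4 * M * ρ < T (z - x) ∧
      T (z - x) < 6 * M * ρ := by
    intro z hz
    rw [Metric.mem_ball, dist_eq_norm] at hz
    have e1 : z - x = (z - b) + (5 * M * ρ) • e := by simp only [b]; abel
    have e2 : P e = 0 := by simp [P, T, he]
    have e3 : T e = 1 := by simp [T, he]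
    rw [e1, hPl, hTl, e2, e3, smul_zero, add_zero]
    have h3 := abs_le.1 (hTn (z - b))
    refine ⟨(hPn _).trans_lt hz, ?_, ?_⟩ <;> nlinarith [h3.1, h3.2]
  have hNconv : ∀ y ∈ N, ∀ z ∈ N, ∀ t ∈ Icc (0 : ℝ) 1, y + t • (z - y) ∈ N := by
    intro y hy z hz t ht
    have e1 : y + t • (z - y) - x = (1 - t) • (y - x) + t • (z - x) := by module
    have e2 : P ((1 - t) • (y - x) + t • (z - x)) = (1 - t) • P (y - x) + t • P (z - x) := by
      have := hPl 0 (y - x) (1 - t)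
      have h0 : P 0 = 0 := by simp [P, T]
      rw [hPl]; rw [zero_add, h0, zero_add] at this; rw [this]
    have e3 : T ((1 - t) • (y - x) + t • (z - x)) = (1 - t) * T (y - x) + t * T (z - x) := by
      rw [hTl]; simp [T, inner_smul_right]
    have ht0 : 0 ≤ 1 - t := sub_nonneg.2 ht.2
    refine ⟨?_, ?_⟩
    · rw [e1, e2]
      have := (convex_ball (0 : Euc d) ρ) (mem_ball_zero_iff.2 hy.1) (mem_ball_zero_iff.2 hz.1)
        ht0 ht.1 (by ring)
      exact mem_ball_zero_iff.1 this
    · rw [e1, e3]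
      have := (convex_ball (0 : ℝ) (7 * M * ρ)) (mem_ball_zero_iff.2 hy.2)
        (mem_ball_zero_iff.2 hz.2) ht0 ht.1 (by ring)
      exact mem_ball_zero_iff.1 this
  have hbN : Metric.ball b ρ ⊆ N := fun z hz => by
    obtain ⟨h1, h2, h3⟩ := hb z hz
    refine ⟨h1, abs_lt.2 ⟨?_, ?_⟩⟩ <;> nlinarith
  have hbΩ : Metric.ball b ρ ⊆ Ω := fun z hz => by
    obtain ⟨h1, h2, h3⟩ := hb z hz
    rw [h.mem_iff z (hNball (hbN hz))]
    have := hge z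
    nlinarith
  refine ⟨N, hNo, hxN, b, ρ, hρ, subset_inter hbN hbΩ, ?_⟩
  rintro y ⟨hyN, hyΩ⟩ z hz t ht
  have hmem := hNconv y hyN z (hbN hz) t ht
  refine ⟨hmem, (h.mem_iff _ (hNball hmem)).2 ?_⟩
  have hgy := (h.mem_iff y (hNball hyN)).1 hyΩ
  obtain ⟨h1, h2, h3⟩ := hb z hz
  -- If z is higher than y by at least 2Mρ, the segment rises at least M times as fast as it moves
  -- sideways (at most 2ρ), so g does not decrease along it. Otherwise y itself has height above
  -- 2Mρ, so does the segment, and g is positive there.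
  by_cases hs : 2 * M * ρ ≤ T (z - y)
  · have h4 := h.add_smul_add_ge y (t • P (z - y)) (t * T (z - y))
    have e1 : y + (t * T (z - y)) • e + t • P (z - y) = y + t • (z - y) := by
      conv_rhs => rw [hdec (z - y)]
      module
    rw [e1, norm_smul, Real.norm_of_nonneg ht.1] at h4
    have h5 : ‖P (z - y)‖ ≤ 2 * ρ := by
      have e2 : P (z - y) = P (z - x) - P (y - x) := by
        have := hPl (z - x) (y - x) (-1)
        rw [neg_one_smul, neg_one_smul, ← sub_eq_add_neg, ← sub_eq_add_neg,
          sub_sub_sub_cancel_right] at this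
        exact this
      rw [e2]; linarith [norm_sub_le (P (z - x)) (P (y - x)), hyN.1]
    have h6 : M * ‖P (z - y)‖ ≤ T (z - y) := by nlinarith
    nlinarith [mul_le_mul_of_nonneg_left h6 ht.1]
  · have h4 := hge (y + t • (z - y))
    have h5 : T (y + t • (z - y) - x) = T (y - x) + t * T (z - y) := by
      rw [← hTl]; congr 1; abel
    have h6 : T (z - y) = T (z - x) - T (y - x) := by rw [hTs, hTs, hTs]; ring
    have h7 := hmem.1
    rw [h5] at h4
    have h8 : 2 * M * ρ ≤ T (y - x) + t * T (z - y) := by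
      rcases le_total 0 (T (z - y)) with h9 | h9
      · nlinarith [mul_nonneg ht.1 h9]
      · nlinarith [ht.2]
    nlinarith

end IsGraphChart

theorem IsC1Domain.exists_starShaped (hΩ : IsC1Domain Ω) {x : Euc d} (hx : x ∈ closure Ω) :
    ∃ N : Set (Euc d), IsOpen N ∧ x ∈ N ∧ ∃ b : Euc d, ∃ ρ > 0, Metric.ball b ρ ⊆ N ∩ Ω ∧
      ∀ y ∈ N ∩ Ω, ∀ z ∈ Metric.ball b ρ, ∀ t ∈ Icc (0 : ℝ) 1, y + t • (z - y) ∈ N ∩ Ω := by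
  by_cases hxΩ : x ∈ Ω
  · obtain ⟨ρ, hρ, hb⟩ := Metric.isOpen_iff.1 hΩ.isOpen x hxΩ
    refine ⟨Metric.ball x ρ, Metric.isOpen_ball, Metric.mem_ball_self hρ, x, ρ, hρ,
      subset_inter le_rfl hb, fun y hy z hz t ht => ?_⟩
    have : y + t • (z - y) ∈ Metric.ball x ρ :=
      (convex_ball x ρ).add_smul_sub_mem hy.1 hz ht
    exact ⟨this, hb this⟩
  · have hf : x ∈ frontier Ω := by rw [hΩ.isOpen.frontier_eq]; exact ⟨hx, hxΩ⟩
    obtain ⟨r, e, g, M, h⟩ := hΩ.exists_isGraphChart hf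
    exact h.exists_starShaped
      (h.eq_zero_of_mem_frontier hΩ.isOpen (Metric.mem_ball_self h.radius_pos) hf).ge

/-- The interior cone condition. -/
theorem IsC1Domain.exists_cone (hΩ : IsC1Domain Ω) {x : Euc d} (hx : x ∈ closure Ω) :
    ∃ r > 0, ∃ e : Euc d, ‖e‖ ≤ 1 ∧ ∃ c > 0, c ≤ 1 ∧ ∀ y ∈ Metric.ball x r ∩ Ω,
      ∀ t ∈ Ioo 0 r, Metric.ball (y + t • e) (c * t) ⊆ Ω := by
  by_cases hxΩ : x ∈ Ω
  · obtain ⟨ρ, hρ, hb⟩ := Metric.isOpen_iff.1 hΩ.isOpen x hxΩ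
    refine ⟨ρ / 2, by positivity, 0, by simp, 1, one_pos, le_rfl, fun y hy t ht => ?_⟩
    refine (Metric.ball_subset_ball' ?_).trans hb
    have := Metric.mem_ball.1 hy.1
    simp only [smul_zero, add_zero]
    linarith [ht.2]
  · have hf : x ∈ frontier Ω := by rw [hΩ.isOpen.frontier_eq]; exact ⟨hx, hxΩ⟩
    obtain ⟨r, e, g, M, h⟩ := hΩ.exists_isGraphChart hf
    have hM := h.one_le
    have hr := h.radius_pos
    -- Moving by t along e raises g by t, and a further displacement shorter than t/M cannot undo
    -- this. The radius r/3 leaves room for y, te and the displacement.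
    refine ⟨r / 3, by positivity, e, h.norm_direction.le, (M : ℝ)⁻¹, by positivity,
      inv_le_one_of_one_le₀ hM, fun y hy t ht z hz => ?_⟩
    rw [Metric.mem_ball, dist_eq_norm] at hz
    have hz' : ‖z - (y + t • e)‖ < t := hz.trans_le (by
      have := inv_le_one_of_one_le₀ hM
      nlinarith [ht.1])
    have hzr : z ∈ Metric.ball x r := by
      have h1 := Metric.mem_ball.1 hy.1
      rw [dist_eq_norm] at h1
      rw [Metric.mem_ball, dist_eq_norm]
      have e1 : z - x = (z - (y + t • e)) + t • e + (y - x) := by abel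
      rw [e1]
      refine (norm_add₃_le).trans_lt ?_
      rw [norm_smul, h.norm_direction, Real.norm_of_nonneg ht.1.le]
      linarith [ht.2]
    rw [h.mem_iff z hzr]
    have h1 := h.add_smul_add_ge y (z - (y + t • e)) t
    rw [add_sub_cancel] at h1
    have h2 := (h.mem_iff y (Metric.ball_subset_ball (by linarith) hy.1)).1 hy.2
    have h3 : M * ‖z - (y + t • e)‖ < t := by
      rw [inv_mul_eq_div, lt_div_iff₀ (by positivity)] at hz; linarith
    linarith

/-- A property of open sets that passes to unions of overlapping sets holds for a connected set
that is covered by finitely many open sets having it. -/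
theorem IsConnected.induction_finite_cover {X ι : Type*} [TopologicalSpace X] {S : Set X}
    (hS : IsConnected S) (t : Finset ι) {U : ι → Set X} (hUo : ∀ i ∈ t, IsOpen (U i))
    (hUne : ∀ i ∈ t, (U i).Nonempty) (hUS : ∀ i ∈ t, U i ⊆ S) (hcov : S ⊆ ⋃ i ∈ t, U i)
    {Q : Set X → Prop} (hQ : ∀ i ∈ t, Q (U i))
    (hunion : ∀ A B, IsOpen A → IsOpen B → (A ∩ B).Nonempty → Q A → Q B → Q (A ∪ B)) : Q S := by
  classical
  let F : Finset (Finset ι) := t.powerset.filter fun s => s.Nonempty ∧ Q (⋃ i ∈ s, U i)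
  have hF : F.Nonempty := by
    obtain ⟨x, hx⟩ := hS.nonempty
    obtain ⟨i, hi, -⟩ := mem_iUnion₂.1 (hcov hx)
    refine ⟨{i}, Finset.mem_filter.2 ⟨Finset.mem_powerset.2 (by simpa using hi), by simp, ?_⟩⟩
    simpa using hQ i hi
  -- A subfamily of maximal size whose union has the property. If it did not cover S, connectedness
  -- would give an overlap with a remaining set, and adding that set would contradict maximality.
  obtain ⟨s, hs, hmax⟩ := F.exists_max_image Finset.card hF
  obtain ⟨hst, hsne, hsQ⟩ := Finset.mem_filter.1 hs
  rw [Finset.mem_powerset] at hst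
  have hso : IsOpen (⋃ i ∈ s, U i) := isOpen_biUnion fun i hi => hUo i (hst hi)
  have heq : (⋃ i ∈ s, U i) = S := by
    refine Subset.antisymm (iUnion₂_subset fun i hi => hUS i (hst hi)) ?_
    by_contra hnot
    obtain ⟨x, hxS, hxs⟩ := not_subset.1 hnot
    obtain ⟨j, hj⟩ := hsne
    obtain ⟨y, hy⟩ := hUne j (hst hj)
    have hrest : IsOpen (⋃ i ∈ t \ s, U i) :=
      isOpen_biUnion fun i hi => hUo i (Finset.sdiff_subset hi)
    obtain ⟨z, -, hz1, hz2⟩ := hS.isPreconnected _ _ hso hrest (by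
        intro z hz
        obtain ⟨i, hi, hzi⟩ := mem_iUnion₂.1 (hcov hz)
        by_cases his : i ∈ s
        · exact Or.inl (mem_iUnion₂.2 ⟨i, his, hzi⟩)
        · exact Or.inr (mem_iUnion₂.2 ⟨i, Finset.mem_sdiff.2 ⟨hi, his⟩, hzi⟩))
      ⟨y, hUS j (hst hj) hy, mem_iUnion₂.2 ⟨j, hj, hy⟩⟩
      (by
        obtain ⟨i, hi, hxi⟩ := mem_iUnion₂.1 (hcov hxS)
        refine ⟨x, hxS, mem_iUnion₂.2 ⟨i, Finset.mem_sdiff.2 ⟨hi, fun his => hxs ?_⟩, hxi⟩⟩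
        exact mem_iUnion₂.2 ⟨i, his, hxi⟩)
    obtain ⟨i, hi, hzi⟩ := mem_iUnion₂.1 hz2
    obtain ⟨hit, his⟩ := Finset.mem_sdiff.1 hi
    have hnew : insert i s ∈ F := by
      refine Finset.mem_filter.2 ⟨Finset.mem_powerset.2
        (Finset.insert_subset hit hst), by simp, ?_⟩
      rw [Finset.set_biUnion_insert]
      exact hunion _ _ (hUo i hit) hso ⟨z, hzi, hz1⟩ (hQ i hit) hsQ
    have := hmax _ hnew
    rw [Finset.card_insert_of_notMem his] at this
    omega
  rwa [heq] at hsQ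

end Geometry

/-! ### Approximation by smooth functions -/

section Mollification

/-- Hölder's inequality against the constant 1. -/
theorem lintegral_rpow_le_rpow_mul_lintegral {α : Type*} [MeasurableSpace α] {ν : Measure α}
    {p : ℝ} (hp : 1 ≤ p) {f : α → ℝ≥0∞} (hf : AEMeasurable f ν) :
    (∫⁻ x, f x ∂ν) ^ p ≤ ν univ ^ (p - 1) * ∫⁻ x, f x ^ p ∂ν := by
  rcases hp.eq_or_lt with rfl | hp
  · simp
  have hpq := Real.HolderConjugate.conjExponent hp
  have h1 := ENNReal.lintegral_mul_le_Lp_mul_Lq ν hpq hf (aemeasurable_const (b := 1))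
  simp only [Pi.mul_apply, mul_one, ENNReal.one_rpow, lintegral_const, one_mul] at h1
  have h2 := ENNReal.rpow_le_rpow h1 (by linarith : 0 ≤ p)
  rw [ENNReal.mul_rpow_of_nonneg _ _ (by linarith), ← ENNReal.rpow_mul, ← ENNReal.rpow_mul,
    one_div_mul_cancel (by linarith), ENNReal.rpow_one] at h2
  have h3 : 1 / p.conjExponent * p = p - 1 := by
    have : p - 1 ≠ 0 := by linarith
    have : p ≠ 0 := by linarith
    simp only [Real.conjExponent]; field_simp
  rw [h3, mul_comm] at h2
  exact h2

variable {d : ℕ}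

theorem tendsto_eLpNorm_translate {E : Type*} [NormedAddCommGroup E]
    {p : ℝ≥0∞} (hp : 1 ≤ p) (hpt : p ≠ ⊤) {G : Euc d → E} (hG : MemLp G p volume) :
    Tendsto (fun s : Euc d => eLpNorm (fun x => G (x - s) - G x) p volume) (𝓝 0) (𝓝 0) := by
  have : Fact (1 ≤ p) := ⟨hp⟩
  let F : C(Euc d × Euc d, Euc d) := ⟨fun q => q.2 - q.1, by fun_prop⟩
  have hm : ∀ s, MeasurePreserving (F.curry s) (volume : Measure (Euc d)) volume := fun s =>
    measurePreserving_sub_right volume s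
  have h1 : Tendsto (fun s => F.curry s) (𝓝 0) (𝓝 (F.curry 0)) := F.curry.continuous.tendsto 0
  have h2 := Filter.Tendsto.compMeasurePreservingLp
    (tendsto_const_nhds (x := hG.toLp G) (f := 𝓝 (0 : Euc d))) h1 hm (hm 0) hpt
  rw [Lp.tendsto_Lp_iff_tendsto_eLpNorm'] at h2
  refine h2.congr fun s => eLpNorm_congr_ae ?_
  have h3 : ∀ s, (Lp.compMeasurePreserving (F.curry s) (hm s) (hG.toLp G) : Euc d → E) =ᵐ[volume]
      fun x => G (x - s) := by
    intro s
    refine (Lp.coeFn_compMeasurePreserving _ (hm s)).trans ?_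
    exact (hm s).quasiMeasurePreserving.ae_eq_comp hG.coeFn_toLp
  filter_upwards [h3 s, h3 0] with x hx hx0
  simp only [Pi.sub_apply]
  rw [hx, hx0, sub_zero]

/-- The error is an average of the differences G(· - s) - G with the probability density η; Jensen's
inequality and Tonelli bound it by the largest translation error over the support of η. -/
theorem eLpNorm_mollify_sub_le {E : Type*} [NormedAddCommGroup E] [NormedSpace ℝ E]
    [CompleteSpace E] {p : ℝ≥0∞} (hp : 1 ≤ p) (hpt : p ≠ ⊤) {G : Euc d → E}
    (hG : MemLp G p volume) {η : Euc d → ℝ} (hη : Continuous η) (hc : HasCompactSupport η)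
    (h0 : ∀ x, 0 ≤ η x) (h1 : ∫ x, η x = 1) {ε : ℝ≥0∞}
    (hε : ∀ s, η s ≠ 0 → eLpNorm (fun x => G (x - s) - G x) p volume ≤ ε) :
    eLpNorm (fun x => (∫ t, η (x - t) • G t) - G x) p volume ≤ ε := by
  obtain ⟨G', hG'm, hGG'⟩ := hG.1
  have hG'L : MemLp G' p volume := hG.ae_eq hGG'
  have hp1 : 1 ≤ p.toReal := by simpa using ENNReal.toReal_mono hpt hp
  have hp0 : p ≠ 0 := (zero_lt_one.trans_le hp).ne'
  let ν : Measure (Euc d) := volume.withDensity fun s => ENNReal.ofReal (η s)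
  have hηm : Measurable fun s => ENNReal.ofReal (η s) := hη.measurable.ennreal_ofReal
  have hη1 : ∫⁻ s, ENNReal.ofReal (η s) = 1 := by
    rw [← ofReal_integral_eq_lintegral_ofReal (hη.integrable_of_hasCompactSupport hc)
      (Eventually.of_forall h0), h1, ENNReal.ofReal_one]
  have hν : ν univ = 1 := by simp [ν, hη1]
  have : IsFiniteMeasure ν := ⟨by simp [hν]⟩
  have hloc : LocallyIntegrableOn G' univ (volume : Measure (Euc d)) :=
    (hG'L.locallyIntegrable hp).locallyIntegrableOn univ
  have hcs : ∀ x, HasCompactSupport fun t => η (x - t) := fun x =>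
    hc.comp_homeomorph (Homeomorph.subLeft x)
  have hi1 : ∀ x, Integrable (fun t => η (x - t) • G' t) volume := fun x =>
    integrable_smul_of_locallyIntegrableOn hloc (by fun_prop) (hcs x) (subset_univ _)
  have hrepr : ∀ x, (∫ t, η (x - t) • G' t) - G' x = ∫ s, η s • (G' (x - s) - G' x) := by
    intro x
    have e1 : ∫ t, η (x - t) • G' t = ∫ s, η s • G' (x - s) := by
      rw [← integral_sub_left_eq_self (fun t => η (x - t) • G' t) volume x]
      simp
    have i1 : Integrable (fun s => η s • G' (x - s)) volume := by
      have := (hi1 x).comp_sub_left x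
      simpa using this
    have i2 : Integrable (fun s => η s • G' x) volume :=
      (hη.integrable_of_hasCompactSupport hc).smul_const _
    simp only [smul_sub]
    rw [integral_sub i1 i2, integral_smul_const, h1, one_smul, e1]
  have hbound : ∀ x, ‖(∫ t, η (x - t) • G' t) - G' x‖ₑ ^ p.toReal ≤
      ∫⁻ s, ‖G' (x - s) - G' x‖ₑ ^ p.toReal ∂ν := by
    intro x
    have hm : Measurable fun s => ‖G' (x - s) - G' x‖ₑ :=
      ((hG'm.comp_measurable (measurable_const.sub measurable_id)).sub
        stronglyMeasurable_const).enorm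
    rw [hrepr]
    have h2 : ‖∫ s, η s • (G' (x - s) - G' x)‖ₑ ≤ ∫⁻ s, ‖G' (x - s) - G' x‖ₑ ∂ν := by
      refine (enorm_integral_le_lintegral_enorm _).trans (le_of_eq ?_)
      rw [lintegral_withDensity_eq_lintegral_mul _ hηm hm]
      refine lintegral_congr fun s => ?_
      rw [enorm_smul, Pi.mul_apply, Real.enorm_eq_ofReal (h0 s)]
    have h3 := lintegral_rpow_le_rpow_mul_lintegral (ν := ν) hp1 hm.aemeasurable
    rw [hν, ENNReal.one_rpow, one_mul] at h3
    exact (ENNReal.rpow_le_rpow h2 (by linarith)).trans h3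
  have hcongr : eLpNorm (fun x => (∫ t, η (x - t) • G t) - G x) p volume =
      eLpNorm (fun x => (∫ t, η (x - t) • G' t) - G' x) p volume := by
    refine eLpNorm_congr_ae ?_
    filter_upwards [hGG'] with x hx
    rw [hx]
    congr 1
    exact integral_congr_ae (by filter_upwards [hGG'] with t ht; rw [ht])
  rw [hcongr, eLpNorm_eq_lintegral_rpow_enorm_toReal hp0 hpt]
  have hεp : ∀ s, η s ≠ 0 → ∫⁻ x, ‖G' (x - s) - G' x‖ₑ ^ p.toReal ≤ ε ^ p.toReal := by
    intro s hs
    have h2 : eLpNorm (fun x => G' (x - s) - G' x) p volume ≤ ε := by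
      refine le_of_eq_of_le (eLpNorm_congr_ae ?_) (hε s hs)
      have := (measurePreserving_sub_right volume s).quasiMeasurePreserving.ae_eq_comp hGG'
      filter_upwards [hGG', this] with x hx hx'
      simp only [Function.comp_apply] at hx'
      rw [hx, hx']
    rw [eLpNorm_eq_lintegral_rpow_enorm_toReal hp0 hpt] at h2
    have := ENNReal.rpow_le_rpow h2 (by linarith : 0 ≤ p.toReal)
    rwa [← ENNReal.rpow_mul, one_div_mul_cancel (by linarith), ENNReal.rpow_one] at this
  have hmain : ∫⁻ x, ‖(∫ t, η (x - t) • G' t) - G' x‖ₑ ^ p.toReal ≤ ε ^ p.toReal := by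
    calc _ ≤ ∫⁻ x, ∫⁻ s, ‖G' (x - s) - G' x‖ₑ ^ p.toReal ∂ν := lintegral_mono hbound
      _ = ∫⁻ s, (∫⁻ x, ‖G' (x - s) - G' x‖ₑ ^ p.toReal) ∂ν := by
          refine lintegral_lintegral_swap (Measurable.aemeasurable ?_)
          have h4 : StronglyMeasurable fun z : Euc d × Euc d => G' (z.1 - z.2) - G' z.1 :=
            (hG'm.comp_measurable (measurable_fst.sub measurable_snd)).sub
              (hG'm.comp_measurable measurable_fst)
          exact h4.enorm.pow_const _
      _ ≤ ∫⁻ s, ε ^ p.toReal ∂ν := by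
          refine lintegral_mono_ae ?_
          rw [ae_withDensity_iff hηm]
          refine Eventually.of_forall fun s hs => hεp s fun h => hs ?_
          simp [h]
      _ = ε ^ p.toReal := by rw [lintegral_const, hν, mul_one]
  refine (ENNReal.rpow_le_rpow hmain (by positivity)).trans (le_of_eq ?_)
  rw [← ENNReal.rpow_mul, mul_one_div_cancel (by linarith), ENNReal.rpow_one]

theorem tendsto_eLpNorm_mollify {E : Type*} [NormedAddCommGroup E] [NormedSpace ℝ E]
    [CompleteSpace E] {p : ℝ≥0∞} (hp : 1 ≤ p) (hpt : p ≠ ⊤) {G : Euc d → E}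
    (hG : MemLp G p volume) {η : ℕ → Euc d → ℝ} (hη : ∀ n, Continuous (η n))
    (hc : ∀ n, HasCompactSupport (η n)) (h0 : ∀ n x, 0 ≤ η n x) (h1 : ∀ n, ∫ x, η n x = 1)
    {δ : ℕ → ℝ} (hδ : Tendsto δ atTop (𝓝 0)) (hs : ∀ n x, η n x ≠ 0 → ‖x‖ ≤ δ n) :
    Tendsto (fun n => eLpNorm (fun x => (∫ t, η n (x - t) • G t) - G x) p volume) atTop (𝓝 0) := by
  rw [ENNReal.tendsto_nhds_zero]
  intro ε hε
  have h2 := ENNReal.tendsto_nhds_zero.1 (tendsto_eLpNorm_translate hp hpt hG) ε hε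
  obtain ⟨r, hr, hb⟩ := Metric.eventually_nhds_iff_ball.1 h2
  filter_upwards [hδ.eventually_lt_const hr] with n hn
  refine eLpNorm_mollify_sub_le hp hpt hG (hη n) (hc n) (h0 n) (h1 n) fun s hs' => hb s ?_
  rw [mem_ball_zero_iff]
  exact (hs n s hs').trans_lt hn

end Mollification

/-! ### Density of functions smooth up to the boundary. -/

section SmoothApproximation

variable {d : ℕ} {Ω : Set (Euc d)}

theorem memLp_indicator_cutoff (hΩ : IsOpen Ω) {p : ℝ≥0∞} {w : Euc d → ℝ} {v : Euc d → Euc d}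
    (hw : MemLp w p (volume.restrict Ω)) (hv : MemLp v p (volume.restrict Ω)) {χ : Euc d → ℝ}
    (hχ : ContDiff ℝ ∞ χ) (hχc : HasCompactSupport χ) :
    MemLp (Ω.indicator fun x => χ x * w x) p volume ∧
      MemLp (Ω.indicator fun x => χ x • v x + w x • ∇ χ x) p volume := by
  have hg : Continuous (∇ χ) := continuous_gradient (hχ.of_le (by simp))
  obtain ⟨C, hC⟩ := hχc.exists_bound_of_continuous hχ.continuous
  have hgc : HasCompactSupport (∇ χ) := by
    have h1 : HasCompactSupport (fderiv ℝ χ) := hχc.fderiv ℝ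
    exact h1.comp_left (g := (InnerProductSpace.toDual ℝ (Euc d)).symm) (map_zero _)
  obtain ⟨C', hC'⟩ := hgc.exists_bound_of_continuous hg
  rw [memLp_indicator_iff_restrict hΩ.measurableSet, memLp_indicator_iff_restrict hΩ.measurableSet]
  refine ⟨?_, MemLp.add ?_ ?_⟩
  · refine hw.of_le_mul (c := C) (hχ.continuous.aestronglyMeasurable.mul hw.1)
      (Eventually.of_forall fun x => ?_)
    rw [norm_mul]
    exact mul_le_mul_of_nonneg_right (hC x) (norm_nonneg _)
  · refine hv.of_le_mul (c := C) (hχ.continuous.aestronglyMeasurable.smul hv.1)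
      (Eventually.of_forall fun x => ?_)
    rw [norm_smul]
    exact mul_le_mul_of_nonneg_right (hC x) (norm_nonneg _)
  · refine hw.of_le_mul (c := C') (hw.1.smul hg.aestronglyMeasurable)
      (Eventually.of_forall fun x => ?_)
    rw [norm_smul, mul_comm]
    exact mul_le_mul_of_nonneg_right (hC' x) (norm_nonneg _)

theorem mollify_eq_convolution (f η : Euc d → ℝ) : (fun x => ∫ t, η (x - t) * f t) =
    convolution f η (ContinuousLinearMap.mul ℝ ℝ) volume := by
  ext x
  simp only [convolution_def, ContinuousLinearMap.mul_apply']
  exact integral_congr_ae (Eventually.of_forall fun t => mul_comm _ _)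

/-- Mollification commutes with the weak gradient where the kernel only sees `Ω`. -/
theorem gradient_mollify (hΩ : IsOpen Ω) {f : Euc d → ℝ} {g : Euc d → Euc d}
    (hfg : HasWeakGradient Ω f g) (hf : LocallyIntegrable (Ω.indicator f) volume)
    {η : Euc d → ℝ} (hη : ContDiff ℝ ∞ η) (hc : HasCompactSupport η) {x : Euc d}
    (hx : tsupport (fun t => η (x - t)) ⊆ Ω ∨
      ∀ t ∈ Ω, t ∈ tsupport (fun t => η (x - t)) → f t = 0 ∧ g t = 0) :
    ∇ (fun x => ∫ t, η (x - t) * Ω.indicator f t) x = ∫ t, η (x - t) • Ω.indicator g t := by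
  have hη1 : ContDiff ℝ 1 η := hη.of_le (by simp)
  have hcη : HasCompactSupport fun t => η (x - t) := hc.comp_homeomorph (Homeomorph.subLeft x)
  have hsη : ContDiff ℝ ∞ fun t => η (x - t) := hη.comp (by fun_prop)
  have hder : ∀ e t, fderiv ℝ (fun t => η (x - t)) t e = - fderiv ℝ η (x - t) e := by
    intro e t
    have h1 : HasFDerivAt (fun t => x - t) (-ContinuousLinearMap.id ℝ (Euc d)) t :=
      (hasFDerivAt_id t).const_sub x
    have h2 := ((hη1.differentiable one_ne_zero) (x - t)).hasFDerivAt.comp t h1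
    rw [show (fun t => η (x - t)) = η ∘ fun t => x - t from rfl, h2.fderiv]
    simp
  refine ext_inner_right ℝ fun e => ?_
  rw [inner_gradient_eq_fderiv, mollify_eq_convolution, (hc.hasFDerivAt_convolution_right
    (ContinuousLinearMap.mul ℝ ℝ) hf hη1 x).fderiv,
    convolution_precompR_apply _ hf (hc.fderiv ℝ) (hη1.continuous_fderiv one_ne_zero)]
  simp only [convolution_def, ContinuousLinearMap.mul_apply']
  -- In the first case t ↦ η(x - t) is a legitimate test function in Ω; in the second both sides
  -- vanish.
  rcases hx with hx | hx
  · have h1 := hfg.integral_eq _ hsη hcη hx e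
    simp only [hder, mul_neg, integral_neg, neg_inj] at h1
    have e1 : ∫ t, Ω.indicator f t * fderiv ℝ η (x - t) e =
        ∫ t in Ω, f t * fderiv ℝ η (x - t) e := by
      rw [← integral_indicator hΩ.measurableSet]
      congr 1; ext t
      by_cases ht : t ∈ Ω <;> simp [ht]
    rw [e1, h1]
    have i1 := integrable_smul_of_locallyIntegrableOn hfg.locallyIntegrable_grad hsη.continuous
      hcη hx
    have e2 : (fun t => η (x - t) • Ω.indicator g t) = fun t => η (x - t) • g t := by
      ext1 t
      by_cases ht : t ∈ Ω
      · simp [ht]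
      · have : η (x - t) = 0 :=
          image_eq_zero_of_notMem_tsupport (f := fun t => η (x - t)) fun h => ht (hx h)
        simp [this]
    rw [e2, real_inner_comm, ← integral_inner i1,
      setIntegral_eq_integral_of_tsupport_subset hx (by intro t ht; simp [ht])]
    congr 1; ext t
    rw [inner_smul_right, real_inner_comm, mul_comm]
  · have e1 : ∀ t, Ω.indicator f t * fderiv ℝ η (x - t) e = 0 := by
      intro t
      by_cases ht : t ∈ Ω
      · by_cases hs : t ∈ tsupport fun t => η (x - t)
        · simp [(hx t ht hs).1]
        · have := fderiv_apply_eq_zero_of_notMem_tsupport hs e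
          rw [hder, neg_eq_zero] at this
          simp [this]
      · simp [ht]
    have e2 : ∀ t, η (x - t) • Ω.indicator g t = 0 := by
      intro t
      by_cases ht : t ∈ Ω
      · by_cases hs : t ∈ tsupport fun t => η (x - t)
        · simp [(hx t ht hs).2]
        · have : η (x - t) = 0 := image_eq_zero_of_notMem_tsupport (f := fun t => η (x - t)) hs
          simp [this]
      · simp [ht]
    simp [e1, e2]

set_option maxHeartbeats 800000 in
-- Mollify the zero extension of χw with a kernel shifted along the interior cone. At points of Ω
-- near the boundary the average then uses only values inside Ω, so the jump of the zero extension
-- is never seen. The kernel is non-negative, whence the sign statement.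
theorem exists_local_smooth_approx (hΩ : IsOpen Ω) {p : ℝ≥0∞} (hp : 1 ≤ p) (hpt : p ≠ ⊤)
    {w : Euc d → ℝ} {v : Euc d → Euc d} (hwv : HasWeakGradient Ω w v)
    (hw : MemLp w p (volume.restrict Ω)) (hv : MemLp v p (volume.restrict Ω))
    {x₀ e : Euc d} {r c : ℝ} (hr : 0 < r) (he : ‖e‖ ≤ 1) (hc : 0 < c) (hc1 : c ≤ 1)
    (hcone : ∀ y ∈ Metric.ball x₀ r ∩ Ω, ∀ t ∈ Ioo 0 r, Metric.ball (y + t • e) (c * t) ⊆ Ω)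
    {χ : Euc d → ℝ} (hχ : ContDiff ℝ ∞ χ) (hχc : HasCompactSupport χ)
    (hχs : tsupport χ ⊆ Metric.ball x₀ r) :
    ∃ φ : ℕ → Euc d → ℝ, (∀ n, ContDiff ℝ ∞ (φ n)) ∧
      Tendsto (fun n => eLpNorm (fun x => φ n x - χ x * w x) p (volume.restrict Ω)) atTop (𝓝 0) ∧
      Tendsto (fun n => eLpNorm (fun x => ∇ (φ n) x - (χ x • v x + w x • ∇ χ x)) p
        (volume.restrict Ω)) atTop (𝓝 0) ∧
      ((∀ x, 0 ≤ χ x) → (∀ᵐ x ∂(volume.restrict Ω), w x ≤ 0) → ∀ n x, φ n x ≤ 0) := by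
  obtain ⟨hf, hg⟩ := memLp_indicator_cutoff hΩ hw hv hχ hχc
  have hfg := hwv.mul hΩ hχ
  set f : Euc d → ℝ := fun x => χ x * w x with hfdef
  set g : Euc d → Euc d := fun x => χ x • v x + w x • ∇ χ x with hgdef
  have hfloc := hf.locallyIntegrable hp
  obtain ⟨δ, hδ, hthick⟩ := hχc.isCompact.exists_thickening_subset_open Metric.isOpen_ball hχs
  -- The shift must be shorter than the cone height r, and 2t < δ keeps the kernel away from the
  -- support of χ when x lies outside the ball.
  let t : ℕ → ℝ := fun n => (min r (δ / 2) / 2) * (1 / ((n : ℝ) + 1))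
  have hm0 : 0 < min r (δ / 2) := lt_min hr (by positivity)
  have ht0 : ∀ n, 0 < t n := fun n => by positivity
  have htle : ∀ n, t n ≤ min r (δ / 2) / 2 := fun n => by
    have : 1 / ((n : ℝ) + 1) ≤ 1 := by
      rw [div_le_one (by positivity)]; linarith [n.cast_nonneg (α := ℝ)]
    exact mul_le_of_le_one_right (by positivity) this
  have htr : ∀ n, t n < r := fun n => by linarith [htle n, min_le_left r (δ / 2)]
  have htδ : ∀ n, 2 * t n < δ := fun n => by linarith [htle n, min_le_right r (δ / 2)]
  have htlim : Tendsto (fun n => 2 * t n) atTop (𝓝 0) := by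
    have := (tendsto_one_div_add_atTop_nhds_zero_nat (𝕜 := ℝ)).const_mul (min r (δ / 2) / 2)
    simpa [t] using this.const_mul 2
  -- Centred at -te: convolving at x averages over the ball of radius ct/2 about x + te, which the
  -- cone condition puts inside Ω.
  let B : ∀ n, ContDiffBump (-(t n) • e) := fun n =>
    ⟨c * t n / 4, c * t n / 2, by have := ht0 n; positivity, by
      have := mul_pos hc (ht0 n); linarith⟩
  let η : ℕ → Euc d → ℝ := fun n => (B n).normed volume
  have hηd : ∀ n, ContDiff ℝ ∞ (η n) := fun n => (B n).contDiff_normed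
  have hηc : ∀ n, HasCompactSupport (η n) := fun n => (B n).hasCompactSupport_normed
  have hηts : ∀ n, tsupport (η n) = Metric.closedBall (-(t n) • e) (c * t n / 2) := fun n =>
    (B n).tsupport_normed_eq
  have hηn : ∀ n s, s ∈ tsupport (η n) → ‖s‖ ≤ 2 * t n := by
    intro n s hs
    rw [hηts, Metric.mem_closedBall, dist_eq_norm] at hs
    have h1 : ‖s‖ ≤ ‖s - -(t n) • e‖ + ‖-(t n) • e‖ := by
      simpa using norm_add_le (s - -(t n) • e) (-(t n) • e)
    have h2 : ‖-(t n) • e‖ ≤ t n := by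
      rw [norm_smul, norm_neg, Real.norm_of_nonneg (ht0 n).le]
      exact mul_le_of_le_one_right (ht0 n).le he
    have := ht0 n
    nlinarith
  have hts : ∀ n x s, s ∈ tsupport (fun s => η n (x - s)) → x - s ∈ tsupport (η n) := by
    intro n x s hs
    exact tsupport_comp_subset_preimage (η n) (f := fun s => x - s) (by fun_prop) hs
  have hgrad : ∀ n, ∀ x ∈ Ω, ∇ (fun x => ∫ s, η n (x - s) * Ω.indicator f s) x =
      ∫ s, η n (x - s) • Ω.indicator g s := by
    intro n x hx
    refine gradient_mollify hΩ hfg hfloc (hηd n) (hηc n) ?_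
    by_cases hxb : x ∈ Metric.ball x₀ r
    · left
      intro s hs
      have h1 := hts n x s hs
      rw [hηts, Metric.mem_closedBall, dist_eq_norm] at h1
      refine hcone x ⟨hxb, hx⟩ (t n) ⟨ht0 n, htr n⟩ ?_
      rw [Metric.mem_ball, dist_eq_norm, ← norm_neg]
      have e1 : -(s - (x + t n • e)) = x - s - -(t n) • e := by module
      rw [e1]
      have := mul_pos hc (ht0 n)
      linarith
    · right
      intro s _ hs
      have h1 := hηn n _ (hts n x s hs)
      have h2 : s ∉ tsupport χ := by
        intro hs'
        refine hxb (hthick (Metric.mem_thickening_iff.2 ⟨s, hs', ?_⟩))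
        rw [dist_eq_norm]; linarith [htδ n]
      have h3 : χ s = 0 := image_eq_zero_of_notMem_tsupport h2
      have h4 : ∇ χ s = 0 := by
        refine ext_inner_right ℝ fun e => ?_
        rw [inner_gradient_eq_fderiv, fderiv_apply_eq_zero_of_notMem_tsupport h2, inner_zero_left]
      simp [hfdef, hgdef, h3, h4]
  have hη0 : ∀ n x, 0 ≤ η n x := fun n x => (B n).nonneg_normed x
  have hη1 : ∀ n, ∫ x, η n x = 1 := fun n => (B n).integral_normed
  have hηs : ∀ n x, η n x ≠ 0 → ‖x‖ ≤ 2 * t n := fun n x hx => hηn n x (subset_tsupport _ hx)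
  have hlim1 := tendsto_eLpNorm_mollify hp hpt hf (fun n => (hηd n).continuous) hηc hη0 hη1
    htlim hηs
  have hlim2 := tendsto_eLpNorm_mollify hp hpt hg (fun n => (hηd n).continuous) hηc hη0 hη1
    htlim hηs
  refine ⟨fun n x => ∫ s, η n (x - s) * Ω.indicator f s, fun n => ?_, ?_, ?_, ?_⟩
  · simp only [mollify_eq_convolution]
    exact (hηc n).contDiff_convolution_right (n := ⊤) _ hfloc (hηd n)
  · refine tendsto_of_tendsto_of_tendsto_of_le_of_le tendsto_const_nhds hlim1
      (fun _ => zero_le) fun n => ?_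
    refine le_of_eq_of_le (eLpNorm_congr_ae ?_) (eLpNorm_restrict_le _ p volume Ω)
    filter_upwards [ae_restrict_mem hΩ.measurableSet] with x hx
    simp [hx, hfdef]
  · refine tendsto_of_tendsto_of_tendsto_of_le_of_le tendsto_const_nhds hlim2
      (fun _ => zero_le) fun n => ?_
    refine le_of_eq_of_le (eLpNorm_congr_ae ?_) (eLpNorm_restrict_le _ p volume Ω)
    filter_upwards [ae_restrict_mem hΩ.measurableSet] with x hx
    rw [hgrad n x hx]
    simp [hx, hgdef]
  · intro hχ0 hw0 n x
    refine integral_nonpos_of_ae ?_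
    rw [ae_restrict_iff' hΩ.measurableSet] at hw0
    filter_upwards [hw0] with s hs
    by_cases hsΩ : s ∈ Ω
    · simp only [hsΩ, indicator_of_mem, hfdef, Pi.zero_apply]
      exact mul_nonpos_of_nonneg_of_nonpos (hη0 n _)
        (mul_nonpos_of_nonneg_of_nonpos (hχ0 s) (hs hsΩ))
    · simp [hsΩ]

theorem exists_finite_partition {K : Set (Euc d)} (hK : IsCompact K) {R : Euc d → ℝ}
    (hR : ∀ x ∈ K, 0 < R x) : ∃ (t : Finset (Euc d)) (χ : Euc d → Euc d → ℝ),
      (∀ x ∈ t, x ∈ K) ∧ (∀ x, ContDiff ℝ ∞ (χ x)) ∧ (∀ x y, 0 ≤ χ x y) ∧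
      (∀ x ∈ t, tsupport (χ x) ⊆ Metric.ball x (R x)) ∧ ∀ y ∈ K, ∑ x ∈ t, χ x y = 1 := by
  classical
  obtain ⟨t, htK, hcov⟩ := hK.elim_nhds_subcover (fun x => Metric.ball x (R x))
    fun x hx => Metric.ball_mem_nhds x (hR x hx)
  obtain ⟨f, hf⟩ := SmoothPartitionOfUnity.exists_isSubordinate (modelWithCornersSelf ℝ (Euc d))
    hK.isClosed (fun x : t => Metric.ball (x : Euc d) (R x)) (fun _ => Metric.isOpen_ball)
    (by simpa [iUnion_subtype] using hcov)
  refine ⟨t, fun x y => if h : x ∈ t then f ⟨x, h⟩ y else 0, htK, fun x => ?_, fun x y => ?_,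
    fun x hx => ?_, fun y hy => ?_⟩
  · by_cases h : x ∈ t
    · simpa [h] using (f ⟨x, h⟩).contMDiff.contDiff
    · simpa [h] using contDiff_const
  · by_cases h : x ∈ t
    · simpa [h] using f.nonneg ⟨x, h⟩ y
    · simp [h]
  · simpa [hx] using hf ⟨x, hx⟩
  · have h1 := f.sum_eq_one hy
    rw [finsum_eq_sum_of_fintype] at h1
    rw [← h1, Finset.univ_eq_attach, ← Finset.sum_attach t]
    refine Finset.sum_congr rfl fun x _ => ?_
    simp

/-- Density of smooth functions in `W^{1,p}(Ω)`, preserving the sign. -/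
theorem IsC1Domain.exists_smooth_approx (hΩ : IsC1Domain Ω) {p : ℝ≥0∞} (hp : 1 ≤ p)
    (hpt : p ≠ ⊤) {w : Euc d → ℝ} (hw : MemW1 Ω p w) :
    ∃ φ : ℕ → Euc d → ℝ, (∀ n, ContDiff ℝ ∞ (φ n)) ∧
      Tendsto (fun n => eLpNorm (fun x => φ n x - w x) p (volume.restrict Ω)) atTop (𝓝 0) ∧
      Tendsto (fun n => eLpNorm (fun x => ∇ (φ n) x - weakGrad Ω w x) p (volume.restrict Ω))
        atTop (𝓝 0) ∧
      ((∀ᵐ x ∂(volume.restrict Ω), w x ≤ 0) → ∀ n x, φ n x ≤ 0) := by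
  have hwg := hw.hasWeakGradient
  have hvL := hw.memLp_weakGrad hΩ.isOpen
  set v := weakGrad Ω w
  choose! R hR e he c hc hc1 hcone using fun x (hx : x ∈ closure Ω) => hΩ.exists_cone hx
  obtain ⟨t, χ, htK, hχd, hχ0, hχs, hχ1⟩ :=
    exists_finite_partition hΩ.isBounded.isCompact_closure hR
  have hχc : ∀ x ∈ t, HasCompactSupport (χ x) := fun x hx =>
    HasCompactSupport.of_support_subset_isCompact (isCompact_closedBall x (R x))
      (((subset_tsupport _).trans (hχs x hx)).trans Metric.ball_subset_closedBall)
  choose! φ hφd hφ1 hφ2 hφ0 using fun x (hx : x ∈ t) =>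
    exists_local_smooth_approx hΩ.isOpen hp hpt hwg hw.1 hvL (hR x (htK x hx)) (he x (htK x hx))
      (hc x (htK x hx)) (hc1 x (htK x hx)) (hcone x (htK x hx)) (hχd x) (hχc x hx) (hχs x hx)
  have hsumw : ∀ x ∈ Ω, ∑ i ∈ t, χ i x * w x = w x := fun x hx => by
    rw [← Finset.sum_mul, hχ1 x (subset_closure hx), one_mul]
  have hsumg : ∀ x ∈ Ω, ∑ i ∈ t, (χ i x • v x + w x • ∇ (χ i) x) = v x := by
    intro x hx
    rw [Finset.sum_add_distrib, ← Finset.sum_smul, hχ1 x (subset_closure hx), one_smul,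
      ← Finset.smul_sum]
    -- The partition of unity sums to the constant 1 near each point of the open set Ω.
    have : ∑ i ∈ t, ∇ (χ i) x = 0 := by
      refine ext_inner_right ℝ fun e => ?_
      rw [sum_inner, inner_zero_left]
      simp only [inner_gradient_eq_fderiv]
      have h1 : fderiv ℝ (fun y => ∑ i ∈ t, χ i y) x = 0 := by
        have : (fun y => ∑ i ∈ t, χ i y) =ᶠ[𝓝 x] fun _ => (1 : ℝ) := by
          filter_upwards [hΩ.isOpen.mem_nhds hx] with y hy using hχ1 y (subset_closure hy)
        rw [this.fderiv_eq]; simp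
      rw [fderiv_fun_sum fun i _ => (hχd i).differentiable (by simp) x] at h1
      have := congrArg (fun L => L e) h1
      simpa using this
    rw [this, smul_zero, add_zero]
  refine ⟨fun n x => ∑ i ∈ t, φ i n x, fun n => ContDiff.sum fun i hi => hφd i hi n, ?_, ?_, ?_⟩
  · have h0 := tendsto_finsetSum t fun i hi => hφ1 i hi
    rw [Finset.sum_const_zero] at h0
    refine tendsto_of_tendsto_of_tendsto_of_le_of_le tendsto_const_nhds h0
      (fun _ => zero_le) fun n => ?_
    refine le_of_eq_of_le (eLpNorm_congr_ae ?_) (eLpNorm_sum_le (f := fun i x =>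
      φ i n x - χ i x * w x) (s := t) (fun i hi => ?_) hp)
    · filter_upwards [ae_restrict_mem hΩ.isOpen.measurableSet] with x hx
      rw [Finset.sum_apply, Finset.sum_sub_distrib, hsumw x hx]
    · exact (hφd i hi n).continuous.aestronglyMeasurable.sub
        ((hχd i).continuous.aestronglyMeasurable.mul hw.1.1)
  · have h0 := tendsto_finsetSum t fun i hi => hφ2 i hi
    rw [Finset.sum_const_zero] at h0
    refine tendsto_of_tendsto_of_tendsto_of_le_of_le tendsto_const_nhds h0
      (fun _ => zero_le) fun n => ?_
    refine le_of_eq_of_le (eLpNorm_congr_ae ?_) (eLpNorm_sum_le (f := fun i x =>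
      ∇ (φ i n) x - (χ i x • v x + w x • ∇ (χ i) x)) (s := t) (fun i hi => ?_) hp)
    · filter_upwards [ae_restrict_mem hΩ.isOpen.measurableSet] with x hx
      rw [Finset.sum_apply, Finset.sum_sub_distrib, hsumg x hx]
      congr 1
      refine ext_inner_right ℝ fun e => ?_
      rw [sum_inner]
      simp only [inner_gradient_eq_fderiv]
      rw [fderiv_fun_sum fun i hi => (hφd i hi n).differentiable (by simp) x]
      simp
    · exact (continuous_gradient ((hφd i hi n).of_le (by simp))).aestronglyMeasurable.sub
        (((hχd i).continuous.aestronglyMeasurable.smul hvL.1).add (hw.1.1.smul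
          (continuous_gradient ((hχd i).of_le (by simp))).aestronglyMeasurable))
  · intro hw0 n x
    exact Finset.sum_nonpos fun i hi => hφ0 i hi (fun y => hχ0 i y) hw0 n x

end SmoothApproximation

/-! ### The trace inequality -/

section TraceInequality

variable {d : ℕ} {Ω : Set (Euc d)}

theorem enorm_sub_le_lintegral_gradient {φ : Euc d → ℝ} (hφ : ContDiff ℝ 1 φ) (x u : Euc d)
    {L : ℝ} (hL : 0 ≤ L) :
    ‖φ (x + L • u) - φ x‖ₑ ≤ ∫⁻ s in Ioo 0 L, ‖u‖ₑ * ‖∇ φ (x + s • u)‖ₑ := by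
  have hder : ∀ s : ℝ, HasDerivAt (fun s : ℝ => φ (x + s • u)) (inner ℝ (∇ φ (x + s • u)) u) s := by
    intro s
    have h1 : HasDerivAt (fun s : ℝ => x + s • u) u s := by
      simpa using ((hasDerivAt_id s).smul_const u).const_add x
    rw [inner_gradient_eq_fderiv]
    exact ((hφ.differentiable one_ne_zero) (x + s • u)).hasFDerivAt.comp_hasDerivAt s h1
  have hc : Continuous fun s : ℝ => inner ℝ (∇ φ (x + s • u)) u :=
    ((continuous_gradient hφ).comp (by fun_prop)).inner continuous_const
  have h2 := intervalIntegral.integral_eq_sub_of_hasDerivAt (a := 0) (b := L)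
    (fun s _ => hder s) (hc.intervalIntegrable 0 L)
  simp only [zero_smul, add_zero] at h2
  rw [← h2, intervalIntegral.integral_of_le hL, integral_Ioc_eq_integral_Ioo]
  refine (enorm_integral_le_lintegral_enorm _).trans (lintegral_mono fun s => ?_)
  rw [mul_comm]
  rw [← ofReal_norm, ← ofReal_norm, ← ofReal_norm, ← ENNReal.ofReal_mul (norm_nonneg _)]
  exact ENNReal.ofReal_le_ofReal (norm_inner_le_norm _ _)

namespace IsGraphChart

variable {x e : Euc d} {r : ℝ} {g : Euc d → ℝ} {M : NNReal}

theorem sub_smul_mem (h : IsGraphChart Ω x r e g M) (y : Euc d) (t : ℝ) :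
    (y + t • e) - g (y + t • e) • e = y - g y • e := by
  rw [h.add_smul]; module

/-- The surface measure of a piece of the graph is controlled by the volume of the tube above. -/
theorem euclideanHausdorffMeasure_le (h : IsGraphChart Ω x r e g M) {A : Set (Euc d)}
    (hA : MeasurableSet A) (hA0 : ∀ y ∈ A, g y = 0) {δ : ℝ} (hδ : 0 < δ) :
    Measure.euclideanHausdorffMeasure (d - 1) A ≤ ((1 + M : NNReal) : ℝ≥0∞) ^ ((d - 1 : ℕ) : ℝ) *
      (ENNReal.ofReal δ)⁻¹ * volume {y | y - g y • e ∈ A ∧ g y ∈ Ioo 0 δ} := by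
  have he := h.norm_direction
  have he0 : e ≠ 0 := by rintro rfl; simp at he
  let s : Submodule ℝ (Euc d) := Submodule.span ℝ {e}
  -- The graph {g = 0} as a Lipschitz image of the hyperplane orthogonal to e; the Hausdorff measure
  -- grows at most by the power d - 1 of the Lipschitz constant.
  let F : sᗮ → Euc d := fun q => (q : Euc d) - g q • e
  let B : Set sᗮ := F ⁻¹' A
  have hgc : Continuous g := h.lipschitz.continuous
  have hFc : Continuous F := by
    exact continuous_subtype_val.sub ((hgc.comp continuous_subtype_val).smul continuous_const)
  have hB : MeasurableSet B := hFc.measurable hA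
  have hF : LipschitzWith (1 + M) F := by
    refine LipschitzWith.of_dist_le_mul fun q q' => ?_
    rw [dist_eq_norm, Subtype.dist_eq, dist_eq_norm]
    have e1 : F q - F q' = ((q : Euc d) - q') - (g q - g q') • e := by
      simp only [F]; module
    rw [e1]
    refine (norm_sub_le _ _).trans ?_
    rw [norm_smul, he, mul_one, Real.norm_eq_abs]
    have := h.abs_sub_le q q'
    push_cast; linarith
  have hAB : A ⊆ F '' B := by
    intro y hy
    have hmem : y - inner ℝ e y • e ∈ sᗮ := by
      rw [Submodule.mem_orthogonal_singleton_iff_inner_right]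
      rw [inner_sub_right, inner_smul_right, real_inner_self_eq_norm_sq, he]; ring
    have hFq : F ⟨y - inner ℝ e y • e, hmem⟩ = y := by
      have := h.sub_smul_mem y (-inner ℝ e y)
      rw [neg_smul, ← sub_eq_add_neg, hA0 y hy, zero_smul, sub_zero] at this
      exact this
    refine ⟨⟨y - inner ℝ e y • e, hmem⟩, ?_, hFq⟩
    change F _ ∈ A
    rwa [hFq]
  have hrank : Module.finrank ℝ sᗮ = d - 1 := by
    have h1 := s.finrank_add_finrank_orthogonal
    rw [finrank_span_singleton he0, finrank_euclideanSpace_fin] at h1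
    omega
  have hHaus : Measure.euclideanHausdorffMeasure (d - 1) A ≤
      ((1 + M : NNReal) : ℝ≥0∞) ^ ((d - 1 : ℕ) : ℝ) * volume B := by
    have h1 : (volume : Measure sᗮ) = Measure.euclideanHausdorffMeasure (d - 1) := by
      rw [← hrank, InnerProductSpace.euclideanHausdorffMeasure_eq_volume]
    refine (measure_mono hAB).trans ?_
    rw [h1, Measure.euclideanHausdorffMeasure_def, Measure.euclideanHausdorffMeasure_def,
      Measure.smul_apply, Measure.smul_apply, ENNReal.smul_def, ENNReal.smul_def, smul_eq_mul,
      smul_eq_mul, mul_left_comm]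
    gcongr
    exact hF.hausdorffMeasure_image_le (by positivity) B
  -- Fubini in the direction e: above each base point q in B the tube is an interval of length δ.
  have hvol : volume {y | y - g y • e ∈ A ∧ g y ∈ Ioo 0 δ} = ENNReal.ofReal δ * volume B := by
    have hmp := s.measurePreserving_measurableEquivProd (0 : Euc d)
    rw [InnerProductSpace.euclideanHausdorffMeasure_eq_volume] at hmp
    rw [← hmp.symm.measure_preimage_equiv, Measure.volume_eq_prod, Measure.prod_apply_symm]
    · have hslice : ∀ q : sᗮ, volume ((fun t : s => (t, q)) ⁻¹'
          ((s.measurableEquivProd (0 : Euc d)).symm ⁻¹'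
            {y | y - g y • e ∈ A ∧ g y ∈ Ioo 0 δ})) =
          B.indicator (fun _ => ENNReal.ofReal δ) q := by
        intro q
        let Λ := LinearIsometryEquiv.toSpanUnitSingleton (𝕜 := ℝ) e he
        have hΛ : MeasurePreserving Λ volume volume := Λ.measurePreserving
        rw [← hΛ.measure_preimage_equiv (f := Λ.toMeasurableEquiv)]
        have hset : Λ.toMeasurableEquiv ⁻¹' ((fun t : s => (t, q)) ⁻¹'
          ((s.measurableEquivProd (0 : Euc d)).symm ⁻¹'
            {y | y - g y • e ∈ A ∧ g y ∈ Ioo 0 δ})) =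
            {t : ℝ | q ∈ B ∧ t ∈ Ioo (-g q) (δ - g q)} := by
          ext t
          have hq : ((s.measurableEquivProd (0 : Euc d)).symm (Λ t, q)) = (q : Euc d) + t • e := by
            simp [Λ, add_comm]
          have hs := h.sub_smul_mem (q : Euc d) t
          rw [h.add_smul] at hs
          simp only [mem_preimage, mem_ofPred_eq, LinearIsometryEquiv.coe_toMeasurableEquiv, hq,
            hs, h.add_smul, B, F, mem_Ioo]
          constructor
          · rintro ⟨h1, h2, h3⟩; exact ⟨h1, by linarith, by linarith⟩
          · rintro ⟨h1, h2, h3⟩; exact ⟨h1, by linarith, by linarith⟩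
        rw [hset]
        by_cases hq : q ∈ B
        · simp only [hq, true_and, ofPred_mem_eq, indicator_of_mem, Real.volume_Ioo]
          congr 1; ring
        · simp [hq]
      simp only [hslice]
      rw [lintegral_indicator_const hB]
    · refine (s.measurableEquivProd (0 : Euc d)).symm.measurable ?_
      refine MeasurableSet.inter ?_ ?_
      · exact (continuous_id.sub (hgc.smul continuous_const)).measurable hA
      · exact hgc.measurable measurableSet_Ioo
  rw [hvol, mul_assoc, ← mul_assoc (ENNReal.ofReal δ)⁻¹, ENNReal.inv_mul_cancel (by simpa using hδ)
    ENNReal.ofReal_ne_top, one_mul]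
  exact hHaus

end IsGraphChart

end TraceInequality

/-! ### The trace inequality, in a chart and on the whole boundary. -/

section TraceInequality

variable {d : ℕ} {Ω : Set (Euc d)}

namespace IsGraphChart

variable {x e : Euc d} {r : ℝ} {g : Euc d → ℝ} {M : NNReal}

/-- The comparison of sets says that the surface measure on S is dominated by a multiple of the
image of the volume on the tube under projection along e, so it extends to integrals. -/
theorem lintegral_graph_le (h : IsGraphChart Ω x r e g M) {S : Set (Euc d)}
    (hS : MeasurableSet S) (hS0 : ∀ y ∈ S, g y = 0) {δ : ℝ} (hδ : 0 < δ) {F : Euc d → ℝ≥0∞}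
    (hF : Measurable F) :
    ∫⁻ y in S, F y ∂(Measure.euclideanHausdorffMeasure (d - 1)) ≤
      ((1 + M : NNReal) : ℝ≥0∞) ^ ((d - 1 : ℕ) : ℝ) * (ENNReal.ofReal δ)⁻¹ *
        ∫⁻ y in {y | y - g y • e ∈ S ∧ g y ∈ Ioo 0 δ}, F (y - g y • e) := by
  have hgc : Continuous g := h.lipschitz.continuous
  have hπ : Measurable fun y => y - g y • e :=
    (continuous_id.sub (hgc.smul continuous_const)).measurable
  set K := ((1 + M : NNReal) : ℝ≥0∞) ^ ((d - 1 : ℕ) : ℝ) * (ENNReal.ofReal δ)⁻¹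
  set T := {y | y - g y • e ∈ S ∧ g y ∈ Ioo 0 δ} with hT
  have hle : (Measure.euclideanHausdorffMeasure (d - 1)).restrict S ≤
      K • (volume.restrict T).map fun y => y - g y • e := by
    refine Measure.le_intro fun A hA _ => ?_
    rw [Measure.restrict_apply hA, Measure.smul_apply, Measure.map_apply hπ hA,
      Measure.restrict_apply (hπ hA), smul_eq_mul]
    refine (h.euclideanHausdorffMeasure_le (hA.inter hS) (fun y hy => hS0 y hy.2) hδ).trans ?_
    refine mul_le_mul_right (measure_mono ?_) _
    rintro y ⟨⟨h1, h2⟩, h3⟩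
    exact ⟨h1, h2, h3⟩
  refine (lintegral_mono' hle le_rfl).trans (le_of_eq ?_)
  rw [lintegral_smul_measure, lintegral_map hF hπ, smul_eq_mul]

/-- The value at the foot point y - g(y)e differs from φ(y) by an integral of the gradient along the
vertical segment, which stays in the tube. Averaging over the tube and applying Tonelli gives the
bound. -/
theorem lintegral_trace_le (h : IsGraphChart Ω x r e g M) {S : Set (Euc d)}
    (hS : MeasurableSet S) (hS0 : ∀ y ∈ S, g y = 0) {δ : ℝ} (hδ : 0 < δ) {p : ℝ} (hp : 1 ≤ p)
    {φ : Euc d → ℝ} (hφ : ContDiff ℝ 1 φ) :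
    ∫⁻ y in S, ‖φ y‖ₑ ^ p ∂(Measure.euclideanHausdorffMeasure (d - 1)) ≤
      ((1 + M : NNReal) : ℝ≥0∞) ^ ((d - 1 : ℕ) : ℝ) * (ENNReal.ofReal δ)⁻¹ *
        (2 ^ (p - 1) * (1 + ENNReal.ofReal δ ^ p) *
        ((∫⁻ y in {y | y - g y • e ∈ S ∧ g y ∈ Ioo 0 δ}, ‖φ y‖ₑ ^ p) +
          ∫⁻ y in {y | y - g y • e ∈ S ∧ g y ∈ Ioo 0 δ}, ‖∇ φ y‖ₑ ^ p)) := by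
  have hgc : Continuous g := h.lipschitz.continuous
  have hp0 : 0 < p := by linarith
  refine (h.lintegral_graph_le hS hS0 hδ (hφ.continuous.enorm.measurable.pow_const p)).trans ?_
  set T := {y | y - g y • e ∈ S ∧ g y ∈ Ioo 0 δ} with hT
  have hTm : MeasurableSet T := by
    refine MeasurableSet.inter ?_ ?_
    · exact (continuous_id.sub (hgc.smul continuous_const)).measurable hS
    · exact hgc.measurable measurableSet_Ioo
  refine mul_le_mul_right ?_ _
  have hDm : Measurable fun y => ‖∇ φ y‖ₑ := (continuous_gradient hφ).enorm.measurable
  -- Extending the gradient by zero outside the tube allows vertical translation invariance on the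
  -- whole space.
  let D : Euc d → ℝ≥0∞ := T.indicator fun y => ‖∇ φ y‖ₑ
  have hD : Measurable D := hDm.indicator hTm
  let J : Euc d → ℝ≥0∞ := fun y => ∫⁻ s in Ioo 0 δ, D (y - s • e)
  have hpt : ∀ y ∈ T, ‖φ (y - g y • e)‖ₑ ≤ ‖φ y‖ₑ + J y := by
    intro y hy
    have h1 := enorm_sub_le_lintegral_gradient hφ y (-e) hy.2.1.le
    have h2 : y + g y • -e = y - g y • e := by module
    rw [h2] at h1
    have h3 : ‖φ (y - g y • e)‖ₑ ≤ ‖φ y‖ₑ + ‖φ (y - g y • e) - φ y‖ₑ := by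
      have := enorm_add_le (φ y) (φ (y - g y • e) - φ y)
      rwa [add_sub_cancel] at this
    refine h3.trans (add_le_add le_rfl (h1.trans ?_))
    calc ∫⁻ s in Ioo 0 (g y), ‖-e‖ₑ * ‖∇ φ (y + s • -e)‖ₑ
        = ∫⁻ s in Ioo 0 (g y), D (y - s • e) := by
          refine setLIntegral_congr_fun measurableSet_Ioo fun s hs => ?_
          have h4 : y + s • -e = y - s • e := by module
          have h5 : y - s • e ∈ T := by
            have h6 := h.sub_smul_mem y (-s)
            have h7 := h.add_smul y (-s)
            rw [neg_smul, ← sub_eq_add_neg] at h6 h7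
            refine ⟨by rw [h6]; exact hy.1, ?_⟩
            rw [h7]
            exact ⟨by linarith [hs.2], by linarith [hs.1, hy.2.2]⟩
          simp only [D, indicator_of_mem h5, h4]
          rw [enorm_neg, ← ofReal_norm e, h.norm_direction, ENNReal.ofReal_one, one_mul]
      _ ≤ J y := lintegral_mono_set (Ioo_subset_Ioo_right hy.2.2.le)
  have hJp : ∀ y, J y ^ p ≤ ENNReal.ofReal δ ^ (p - 1) * ∫⁻ s in Ioo 0 δ, D (y - s • e) ^ p := by
    intro y
    have := lintegral_rpow_le_rpow_mul_lintegral (ν := volume.restrict (Ioo 0 δ)) hp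
      (f := fun s : ℝ => D (y - s • e)) (hD.comp (by fun_prop)).aemeasurable
    simpa using this
  have hJm : Measurable fun z : Euc d × ℝ => D (z.1 - z.2 • e) ^ p :=
    (hD.comp (by fun_prop)).pow_const p
  have hJ : ∫⁻ y, J y ^ p ≤ ENNReal.ofReal δ ^ p * ∫⁻ y in T, ‖∇ φ y‖ₑ ^ p := by
    have hDp : ∫⁻ y, D y ^ p = ∫⁻ y in T, ‖∇ φ y‖ₑ ^ p := by
      rw [← lintegral_indicator hTm]
      refine lintegral_congr fun y => ?_
      by_cases hy : y ∈ T <;> simp [D, hy, hp0]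
    calc ∫⁻ y, J y ^ p
        ≤ ∫⁻ y, ENNReal.ofReal δ ^ (p - 1) * ∫⁻ s in Ioo 0 δ, D (y - s • e) ^ p :=
          lintegral_mono hJp
      _ = ENNReal.ofReal δ ^ (p - 1) * ∫⁻ y, ∫⁻ s in Ioo 0 δ, D (y - s • e) ^ p :=
          lintegral_const_mul _ hJm.lintegral_prod_right'
      _ = ENNReal.ofReal δ ^ (p - 1) * ∫⁻ s in Ioo 0 δ, ∫⁻ y, D (y - s • e) ^ p := by
          rw [lintegral_lintegral_swap hJm.aemeasurable]
      _ = ENNReal.ofReal δ ^ (p - 1) * (ENNReal.ofReal δ * ∫⁻ y in T, ‖∇ φ y‖ₑ ^ p) := by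
          congr 1
          rw [← hDp]
          have : ∀ s : ℝ, ∫⁻ y, D (y - s • e) ^ p = ∫⁻ y, D y ^ p := fun s =>
            lintegral_sub_right_eq_self (fun y => D y ^ p) (s • e)
          simp only [this]
          simp [mul_comm]
      _ = ENNReal.ofReal δ ^ p * ∫⁻ y in T, ‖∇ φ y‖ₑ ^ p := by
          rw [← mul_assoc]
          congr 1
          have hδ0 : ENNReal.ofReal δ ≠ 0 := by simpa using hδ
          conv_lhs => rw [← ENNReal.rpow_one (ENNReal.ofReal δ), ← ENNReal.rpow_mul, one_mul]
          rw [← ENNReal.rpow_add _ _ hδ0 ENNReal.ofReal_ne_top, sub_add_cancel]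
  calc ∫⁻ y in T, ‖φ (y - g y • e)‖ₑ ^ p
      ≤ ∫⁻ y in T, 2 ^ (p - 1) * (‖φ y‖ₑ ^ p + J y ^ p) := by
        refine setLIntegral_mono' hTm fun y hy => ?_
        exact (ENNReal.rpow_le_rpow (hpt y hy) hp0.le).trans
          (ENNReal.rpow_add_le_mul_rpow_add_rpow _ _ hp)
    _ = 2 ^ (p - 1) * ((∫⁻ y in T, ‖φ y‖ₑ ^ p) + ∫⁻ y in T, J y ^ p) := by
        have hm := hφ.continuous.enorm.measurable.pow_const p
        rw [lintegral_const_mul' _ _ (ENNReal.rpow_ne_top_of_nonneg (by linarith) (by simp)),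
          lintegral_add_left hm]
    _ ≤ 2 ^ (p - 1) * ((∫⁻ y in T, ‖φ y‖ₑ ^ p) +
          ENNReal.ofReal δ ^ p * ∫⁻ y in T, ‖∇ φ y‖ₑ ^ p) := by
        gcongr
        exact (setLIntegral_le_lintegral _ _).trans hJ
    _ ≤ _ := by
        rw [mul_assoc]
        gcongr
        rw [mul_add]
        gcongr
        · exact le_mul_of_one_le_left zero_le (self_le_add_right 1 _)
        · exact self_le_add_left _ _

end IsGraphChart

/-- Compactness of the boundary reduces the estimate to finitely many charts. -/
theorem IsC1Domain.lintegral_trace_le (hΩ : IsC1Domain Ω) {p : ℝ} (hp : 1 ≤ p) :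
    ∃ C : ℝ≥0∞, C ≠ ⊤ ∧ ∀ φ : Euc d → ℝ, ContDiff ℝ 1 φ →
      ∫⁻ y, ‖φ y‖ₑ ^ p ∂(surfaceMeasure (frontier Ω)) ≤
        C * ((∫⁻ y in Ω, ‖φ y‖ₑ ^ p) + ∫⁻ y in Ω, ‖∇ φ y‖ₑ ^ p) := by
  have hK : IsCompact (frontier Ω) :=
    hΩ.isBounded.isCompact_closure.of_isClosed_subset isClosed_frontier frontier_subset_closure
  let σ : Measure (Euc d) := Measure.euclideanHausdorffMeasure (d - 1)
  have key : ∃ C : ℝ≥0∞, C ≠ ⊤ ∧ ∀ φ : Euc d → ℝ, ContDiff ℝ 1 φ →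
      ∫⁻ y in frontier Ω, ‖φ y‖ₑ ^ p ∂(σ.restrict (frontier Ω)) ≤
        C * ((∫⁻ y in Ω, ‖φ y‖ₑ ^ p) + ∫⁻ y in Ω, ‖∇ φ y‖ₑ ^ p) := by
    refine hK.induction_on (p := fun s => ∃ C : ℝ≥0∞, C ≠ ⊤ ∧ ∀ φ : Euc d → ℝ, ContDiff ℝ 1 φ →
      ∫⁻ y in s, ‖φ y‖ₑ ^ p ∂(σ.restrict (frontier Ω)) ≤
        C * ((∫⁻ y in Ω, ‖φ y‖ₑ ^ p) + ∫⁻ y in Ω, ‖∇ φ y‖ₑ ^ p)) ?_ ?_ ?_ ?_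
    · exact ⟨0, by simp, fun φ _ => by simp⟩
    · rintro s t hst ⟨C, hC, h⟩
      exact ⟨C, hC, fun φ hφ => (lintegral_mono_set hst).trans (h φ hφ)⟩
    · rintro s t ⟨C, hC, h⟩ ⟨C', hC', h'⟩
      refine ⟨C + C', by simp [hC, hC'], fun φ hφ => ?_⟩
      rw [add_mul]
      exact (lintegral_union_le _ s t).trans (add_le_add (h φ hφ) (h' φ hφ))
    · intro x hx
      obtain ⟨r, e, g, M, h⟩ := hΩ.exists_isGraphChart hx
      have hr := h.radius_pos
      refine ⟨Metric.ball x (r / 2),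
        mem_nhdsWithin_of_mem_nhds (Metric.ball_mem_nhds x (by positivity)), ?_⟩
      let S := Metric.ball x (r / 2) ∩ frontier Ω
      have hS : MeasurableSet S :=
        Metric.isOpen_ball.measurableSet.inter isClosed_frontier.measurableSet
      have hS0 : ∀ y ∈ S, g y = 0 := fun y hy => h.eq_zero_of_mem_frontier hΩ.isOpen
        (Metric.ball_subset_ball (by linarith) hy.1) hy.2
      -- Foot points within r/2 of x and heights below r/2 stay in the chart ball, where g > 0 means
      -- membership in Ω.
      have hT : {y | y - g y • e ∈ S ∧ g y ∈ Ioo 0 (r / 2)} ⊆ Ω := by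
        rintro y ⟨h1, h2⟩
        refine (h.mem_iff y ?_).2 h2.1
        have h3 := Metric.mem_ball.1 h1.1
        rw [dist_eq_norm] at h3
        rw [Metric.mem_ball, dist_eq_norm]
        have e1 : y - x = (y - g y • e - x) + g y • e := by module
        rw [e1]
        refine (norm_add_le _ _).trans_lt ?_
        rw [norm_smul, h.norm_direction, Real.norm_of_nonneg h2.1.le]
        linarith [h2.2]
      refine ⟨((1 + M : NNReal) : ℝ≥0∞) ^ ((d - 1 : ℕ) : ℝ) * (ENNReal.ofReal (r / 2))⁻¹ *
        (2 ^ (p - 1) * (1 + ENNReal.ofReal (r / 2) ^ p)), ?_, fun φ hφ => ?_⟩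
      · refine ENNReal.mul_ne_top (ENNReal.mul_ne_top ?_ ?_) (ENNReal.mul_ne_top ?_ ?_)
        · exact ENNReal.rpow_ne_top_of_nonneg (by positivity) ENNReal.coe_ne_top
        · simpa using hr
        · exact ENNReal.rpow_ne_top_of_nonneg (by linarith) (by simp)
        · exact ENNReal.add_ne_top.2 ⟨by simp,
            ENNReal.rpow_ne_top_of_nonneg (by linarith) ENNReal.ofReal_ne_top⟩
      · rw [Measure.restrict_restrict Metric.isOpen_ball.measurableSet]
        refine (h.lintegral_trace_le hS hS0 (half_pos hr) hp hφ).trans ?_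
        rw [← mul_assoc]
        gcongr
  obtain ⟨C, hC, h⟩ := key
  refine ⟨C, hC, fun φ hφ => ?_⟩
  have := h φ hφ
  rwa [Measure.restrict_restrict isClosed_frontier.measurableSet, inter_self] at this

/-- The trace inequality for the constant function 1. -/
theorem IsC1Domain.isFiniteMeasure_surfaceMeasure (hΩ : IsC1Domain Ω) :
    IsFiniteMeasure (surfaceMeasure (frontier Ω)) := by
  obtain ⟨C, hC, h⟩ := hΩ.lintegral_trace_le le_rfl
  have h1 := h (fun _ => 1) contDiff_const
  have h2 : volume Ω < ⊤ := hΩ.isBounded.measure_lt_top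
  refine ⟨lt_of_le_of_lt (b := C * volume Ω) ?_ (ENNReal.mul_lt_top hC.lt_top h2)⟩
  simpa using h1

theorem IsC1Domain.eLpNorm_trace_le (hΩ : IsC1Domain Ω) {p : ℝ≥0∞} (hp : 1 ≤ p) (hpt : p ≠ ⊤) :
    ∃ C : ℝ≥0∞, C ≠ ⊤ ∧ ∀ φ : Euc d → ℝ, ContDiff ℝ 1 φ →
      eLpNorm φ p (surfaceMeasure (frontier Ω)) ≤
        C * (eLpNorm φ p (volume.restrict Ω) + eLpNorm (∇ φ) p (volume.restrict Ω)) := by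
  have hp1 : 1 ≤ p.toReal := by simpa using ENNReal.toReal_mono hpt hp
  have hp0 : p ≠ 0 := (zero_lt_one.trans_le hp).ne'
  obtain ⟨C, hC, h⟩ := hΩ.lintegral_trace_le hp1
  refine ⟨C ^ (1 / p.toReal), ENNReal.rpow_ne_top_of_nonneg (by positivity) hC, fun φ hφ => ?_⟩
  simp only [eLpNorm_eq_lintegral_rpow_enorm_toReal hp0 hpt]
  refine (ENNReal.rpow_le_rpow (h φ hφ) (by positivity)).trans ?_
  rw [ENNReal.mul_rpow_of_nonneg _ _ (by positivity)]
  gcongr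
  exact ENNReal.rpow_add_le_add_rpow (p := 1 / p.toReal) _ _ (by positivity)
    (by rw [div_le_one (by linarith)]; exact hp1)

end TraceInequality

/-! ### Traces -/

section Trace

theorem tendsto_eLpNorm_zero_of_le_add {α E F G : Type*} [MeasurableSpace α]
    [NormedAddCommGroup E] [NormedAddCommGroup F] [NormedAddCommGroup G] {μ ν ν' : Measure α}
    {p : ℝ≥0∞} {f : ℕ → α → E} {g : ℕ → α → F} {h : ℕ → α → G}
    (hf : Tendsto (fun n => eLpNorm (f n) p ν) atTop (𝓝 0))
    (hg : Tendsto (fun n => eLpNorm (g n) p ν') atTop (𝓝 0)) {C : ℝ≥0∞} (hC : C ≠ ⊤)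
    (hle : ∀ n, eLpNorm (h n) p μ ≤ C * (eLpNorm (f n) p ν + eLpNorm (g n) p ν')) :
    Tendsto (fun n => eLpNorm (h n) p μ) atTop (𝓝 0) := by
  have h0 := ENNReal.Tendsto.const_mul (hf.add hg) (Or.inr hC)
  rw [add_zero, mul_zero] at h0
  exact tendsto_of_tendsto_of_tendsto_of_le_of_le tendsto_const_nhds h0 (fun _ => zero_le) hle

theorem exists_tendsto_of_cauchy_eLpNorm {α E : Type*} [MeasurableSpace α] [NormedAddCommGroup E]
    [CompleteSpace E] {μ : Measure α} {p : ℝ≥0∞} (hp : 1 ≤ p) {f : ℕ → α → E}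
    (hf : ∀ n, MemLp (f n) p μ)
    (hc : ∀ ε > 0, ∃ N, ∀ n ≥ N, ∀ m ≥ N, eLpNorm (f n - f m) p μ < ε) :
    ∃ g, MemLp g p μ ∧ Tendsto (fun n => eLpNorm (fun x => f n x - g x) p μ) atTop (𝓝 0) := by
  have : Fact (1 ≤ p) := ⟨hp⟩
  have hcau : CauchySeq fun n => (hf n).toLp (f n) := by
    refine EMetric.cauchySeq_iff.2 fun ε hε => ?_
    obtain ⟨N, hN⟩ := hc ε hε
    refine ⟨N, fun n hn m hm => ?_⟩
    rw [Lp.edist_toLp_toLp]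
    exact hN n hn m hm
  obtain ⟨g, hg⟩ := cauchySeq_tendsto_of_complete hcau
  refine ⟨g, Lp.memLp g, ?_⟩
  rw [Lp.tendsto_Lp_iff_tendsto_eLpNorm'] at hg
  refine hg.congr fun n => eLpNorm_congr_ae ?_
  filter_upwards [(hf n).coeFn_toLp] with x hx
  simp [hx]

variable {d : ℕ} {Ω : Set (Euc d)} {p : ℝ≥0∞} {w w' t t' : Euc d → ℝ}

theorem MemW1.weakGrad_add (hΩ : IsOpen Ω) (hw : MemW1 Ω p w) (hw' : MemW1 Ω p w') :
    weakGrad Ω (w + w') =ᵐ[volume.restrict Ω] weakGrad Ω w + weakGrad Ω w' :=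
  (hw.hasWeakGradient.add hw'.hasWeakGradient).weakGrad_ae_eq hΩ

theorem MemW1.weakGrad_const_smul (hΩ : IsOpen Ω) (hw : MemW1 Ω p w) (c : ℝ) :
    weakGrad Ω (c • w) =ᵐ[volume.restrict Ω] c • weakGrad Ω w :=
  (hw.hasWeakGradient.const_smul c).weakGrad_ae_eq hΩ

theorem MemW1.weakGrad_sub (hΩ : IsOpen Ω) (hw : MemW1 Ω p w) (hw' : MemW1 Ω p w') :
    weakGrad Ω (w - w') =ᵐ[volume.restrict Ω] weakGrad Ω w - weakGrad Ω w' := by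
  have h := (hw.hasWeakGradient.add (hw'.hasWeakGradient.const_smul (-1))).weakGrad_ae_eq hΩ
  simpa [← sub_eq_add_neg] using h

theorem contDiff_memLp_surfaceMeasure (hΩ : IsC1Domain Ω) {f : Euc d → ℝ} (hf : Continuous f) :
    MemLp f p (surfaceMeasure (frontier Ω)) := by
  have := hΩ.isFiniteMeasure_surfaceMeasure
  have hK : IsCompact (frontier Ω) :=
    hΩ.isBounded.isCompact_closure.of_isClosed_subset isClosed_frontier frontier_subset_closure
  obtain ⟨C, hC⟩ := hK.exists_bound_of_continuousOn hf.continuousOn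
  exact MemLp.of_bound hf.aestronglyMeasurable C
    (ae_restrict_of_forall_mem isClosed_frontier.measurableSet hC)

theorem gradient_sub_of_contDiff {f g : Euc d → ℝ} (hf : ContDiff ℝ 1 f) (hg : ContDiff ℝ 1 g)
    (x : Euc d) : ∇ (f - g) x = ∇ f x - ∇ g x := by
  refine ext_inner_right ℝ fun e => ?_
  rw [inner_sub_left, inner_gradient_eq_fderiv, inner_gradient_eq_fderiv, inner_gradient_eq_fderiv,
    fderiv_sub (hf.differentiable one_ne_zero x) (hg.differentiable one_ne_zero x)]
  simp

theorem gradient_add_of_contDiff {f g : Euc d → ℝ} (hf : ContDiff ℝ 1 f) (hg : ContDiff ℝ 1 g)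
    (x : Euc d) : ∇ (f + g) x = ∇ f x + ∇ g x := by
  refine ext_inner_right ℝ fun e => ?_
  rw [inner_add_left, inner_gradient_eq_fderiv, inner_gradient_eq_fderiv, inner_gradient_eq_fderiv,
    fderiv_add (hf.differentiable one_ne_zero x) (hg.differentiable one_ne_zero x)]
  simp

theorem gradient_const_smul_of_contDiff {f : Euc d → ℝ} (hf : ContDiff ℝ 1 f) (c : ℝ)
    (x : Euc d) : ∇ (c • f) x = c • ∇ f x := by
  refine ext_inner_right ℝ fun e => ?_
  rw [inner_smul_left, inner_gradient_eq_fderiv, inner_gradient_eq_fderiv,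
    fderiv_const_smul (hf.differentiable one_ne_zero x)]
  simp

theorem IsTrace.add (hΩ : IsOpen Ω) (hp : 1 ≤ p) (hw : MemW1 Ω p w) (hw' : MemW1 Ω p w')
    (h : IsTrace Ω p w t) (h' : IsTrace Ω p w' t') : IsTrace Ω p (w + w') (t + t') := by
  obtain ⟨ht, φ, hφ, h1, h2, h3⟩ := h
  obtain ⟨ht', φ', hφ', h1', h2', h3'⟩ := h'
  have d1 : ∀ n, ContDiff ℝ 1 (φ n) := fun n => (hφ n).of_le (by simp)
  have d1' : ∀ n, ContDiff ℝ 1 (φ' n) := fun n => (hφ' n).of_le (by simp)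
  refine ⟨ht.add ht', fun n => φ n + φ' n, fun n => (hφ n).add (hφ' n), ?_, ?_, ?_⟩
  · refine tendsto_eLpNorm_zero_of_le_add h1 h1' ENNReal.one_ne_top fun n => ?_
    rw [one_mul]
    refine le_of_eq_of_le (congrArg (fun f => eLpNorm f p _) ?_) (eLpNorm_add_le
      ((hφ n).continuous.aestronglyMeasurable.sub hw.1.1)
      ((hφ' n).continuous.aestronglyMeasurable.sub hw'.1.1) hp)
    ext x; simp only [Pi.add_apply]; ring
  · refine tendsto_eLpNorm_zero_of_le_add h2 h2' ENNReal.one_ne_top fun n => ?_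
    rw [one_mul]
    refine le_of_eq_of_le (eLpNorm_congr_ae ?_) (eLpNorm_add_le
      ((continuous_gradient (d1 n)).aestronglyMeasurable.sub (hw.memLp_weakGrad hΩ).1)
      ((continuous_gradient (d1' n)).aestronglyMeasurable.sub (hw'.memLp_weakGrad hΩ).1) hp)
    filter_upwards [hw.weakGrad_add hΩ hw'] with x hx
    rw [hx, gradient_add_of_contDiff (d1 n) (d1' n)]
    simp only [Pi.add_apply]; abel
  · refine tendsto_eLpNorm_zero_of_le_add h3 h3' ENNReal.one_ne_top fun n => ?_
    rw [one_mul]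
    refine le_of_eq_of_le (congrArg (fun f => eLpNorm f p _) ?_) (eLpNorm_add_le
      ((hφ n).continuous.aestronglyMeasurable.sub ht.1)
      ((hφ' n).continuous.aestronglyMeasurable.sub ht'.1) hp)
    ext x; simp only [Pi.add_apply]; ring

theorem IsTrace.const_smul (hΩ : IsOpen Ω) (hw : MemW1 Ω p w) (h : IsTrace Ω p w t) (c : ℝ) :
    IsTrace Ω p (c • w) (c • t) := by
  obtain ⟨ht, φ, hφ, h1, h2, h3⟩ := h
  have d1 : ∀ n, ContDiff ℝ 1 (φ n) := fun n => (hφ n).of_le (by simp)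
  have hc : ‖c‖ₑ ≠ ⊤ := enorm_ne_top
  refine ⟨ht.const_smul c, fun n => c • φ n, fun n => contDiff_const.smul (hφ n), ?_, ?_, ?_⟩
  · have h0 := ENNReal.Tendsto.const_mul h1 (Or.inr hc)
    rw [mul_zero] at h0
    refine h0.congr fun n => ?_
    rw [← eLpNorm_const_smul]
    refine congrArg (fun f => eLpNorm f p _) ?_
    ext x; simp only [Pi.smul_apply, smul_eq_mul]; ring
  · have h0 := ENNReal.Tendsto.const_mul h2 (Or.inr hc)
    rw [mul_zero] at h0
    refine h0.congr fun n => ?_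
    rw [← eLpNorm_const_smul]
    refine eLpNorm_congr_ae ?_
    filter_upwards [hw.weakGrad_const_smul hΩ c] with x hx
    rw [hx, gradient_const_smul_of_contDiff (d1 n)]
    simp only [Pi.smul_apply]; rw [smul_sub]
  · have h0 := ENNReal.Tendsto.const_mul h3 (Or.inr hc)
    rw [mul_zero] at h0
    refine h0.congr fun n => ?_
    rw [← eLpNorm_const_smul]
    refine congrArg (fun f => eLpNorm f p _) ?_
    ext x; simp only [Pi.smul_apply, smul_eq_mul]; ring

theorem IsTrace.const (hΩ : IsC1Domain Ω) (c : ℝ) : IsTrace Ω p (fun _ => c) fun _ => c := by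
  refine ⟨contDiff_memLp_surfaceMeasure hΩ continuous_const, fun _ _ => c,
    fun _ => contDiff_const, by simp, ?_, by simp⟩
  have h := weakGrad_of_contDiff hΩ.isOpen (contDiff_const (c := c) : ContDiff ℝ 1 fun _ : Euc d => c)
  have h0 : eLpNorm (fun x => ∇ (fun _ : Euc d => c) x - weakGrad Ω (fun _ => c) x) p
      (volume.restrict Ω) = 0 := by
    rw [← eLpNorm_zero (ε := Euc d)]
    refine eLpNorm_congr_ae ?_
    filter_upwards [h] with x hx
    rw [hx, sub_self]; rfl
  simp only [h0]
  exact tendsto_const_nhds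

/-- The inequality for smooth functions passes to the limit along the sequence that defines the
trace. -/
theorem IsC1Domain.eLpNorm_isTrace_le (hΩ : IsC1Domain Ω) (hp : 1 ≤ p) (hpt : p ≠ ⊤) :
    ∃ C : ℝ≥0∞, C ≠ ⊤ ∧ ∀ w t : Euc d → ℝ, MemW1 Ω p w → IsTrace Ω p w t →
      eLpNorm t p (surfaceMeasure (frontier Ω)) ≤
        C * (eLpNorm w p (volume.restrict Ω) + eLpNorm (weakGrad Ω w) p (volume.restrict Ω)) := by
  obtain ⟨C, hC, h⟩ := hΩ.eLpNorm_trace_le hp hpt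
  refine ⟨C, hC, fun w t hw ⟨ht, φ, hφ, h1, h2, h3⟩ => ?_⟩
  have d1 : ∀ n, ContDiff ℝ 1 (φ n) := fun n => (hφ n).of_le (by simp)
  have hle : ∀ n, eLpNorm t p (surfaceMeasure (frontier Ω)) ≤
      eLpNorm (fun x => φ n x - t x) p (surfaceMeasure (frontier Ω)) +
      C * ((eLpNorm (fun x => φ n x - w x) p (volume.restrict Ω) +
        eLpNorm w p (volume.restrict Ω)) +
        (eLpNorm (fun x => ∇ (φ n) x - weakGrad Ω w x) p (volume.restrict Ω) +
        eLpNorm (weakGrad Ω w) p (volume.restrict Ω))) := by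
    intro n
    have e1 : t = φ n - fun x => φ n x - t x := by ext x; simp
    have e2 : φ n = (fun x => φ n x - w x) + w := by ext x; simp
    have e3 : ∇ (φ n) = (fun x => ∇ (φ n) x - weakGrad Ω w x) + weakGrad Ω w := by ext1 x; simp
    have l1 : eLpNorm t p (surfaceMeasure (frontier Ω)) ≤
        eLpNorm (φ n) p (surfaceMeasure (frontier Ω)) +
        eLpNorm (fun x => φ n x - t x) p (surfaceMeasure (frontier Ω)) := by
      conv_lhs => rw [e1]
      exact eLpNorm_sub_le (hφ n).continuous.aestronglyMeasurable
        ((hφ n).continuous.aestronglyMeasurable.sub ht.1) hp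
    have l2 : eLpNorm (φ n) p (volume.restrict Ω) ≤
        eLpNorm (fun x => φ n x - w x) p (volume.restrict Ω) + eLpNorm w p (volume.restrict Ω) := by
      conv_lhs => rw [e2]
      exact eLpNorm_add_le ((hφ n).continuous.aestronglyMeasurable.sub hw.1.1) hw.1.1 hp
    have l3 : eLpNorm (∇ (φ n)) p (volume.restrict Ω) ≤
        eLpNorm (fun x => ∇ (φ n) x - weakGrad Ω w x) p (volume.restrict Ω) +
          eLpNorm (weakGrad Ω w) p (volume.restrict Ω) := by
      conv_lhs => rw [e3]
      exact eLpNorm_add_le ((continuous_gradient (d1 n)).aestronglyMeasurable.sub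
        (hw.memLp_weakGrad hΩ.isOpen).1) (hw.memLp_weakGrad hΩ.isOpen).1 hp
    refine l1.trans ?_
    rw [add_comm]
    refine add_le_add le_rfl ((h _ (d1 n)).trans ?_)
    gcongr
  have hlim := h3.add (ENNReal.Tendsto.const_mul ((h1.add (tendsto_const_nhds
    (x := eLpNorm w p (volume.restrict Ω)))).add (h2.add (tendsto_const_nhds
    (x := eLpNorm (weakGrad Ω w) p (volume.restrict Ω))))) (Or.inr hC))
  simp only [zero_add] at hlim
  exact ge_of_tendsto' hlim hle

/-- By the trace inequality the boundary values of smooth approximations form a Cauchy sequence. For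
w ≤ 0 the approximations can be taken non-positive, and an almost everywhere convergent subsequence
carries the sign to the trace. -/
theorem IsC1Domain.exists_isTrace (hΩ : IsC1Domain Ω) (hp : 1 ≤ p) (hpt : p ≠ ⊤)
    (hw : MemW1 Ω p w) : ∃ t, IsTrace Ω p w t ∧
      ((∀ᵐ x ∂(volume.restrict Ω), w x ≤ 0) →
        ∀ᵐ x ∂(surfaceMeasure (frontier Ω)), t x ≤ 0) := by
  obtain ⟨C, hC, h⟩ := hΩ.eLpNorm_trace_le hp hpt
  obtain ⟨φ, hφ, h1, h2, h3⟩ := hΩ.exists_smooth_approx hp hpt hw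
  have hv := hw.memLp_weakGrad hΩ.isOpen
  have d1 : ∀ n, ContDiff ℝ 1 (φ n) := fun n => (hφ n).of_le (by simp)
  obtain ⟨t, ht, hlim⟩ := exists_tendsto_of_cauchy_eLpNorm (f := φ) hp
    (μ := surfaceMeasure (frontier Ω))
    (fun n => contDiff_memLp_surfaceMeasure hΩ (hφ n).continuous) (by
      intro ε hε
      have hs := ENNReal.Tendsto.const_mul (h1.add h2) (Or.inr hC)
      rw [add_zero, mul_zero] at hs
      obtain ⟨N, hN⟩ := eventually_atTop.1 (hs.eventually_lt_const (ENNReal.half_pos hε.ne'))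
      refine ⟨N, fun n hn m hm => ?_⟩
      have l1 : eLpNorm (φ n - φ m) p (volume.restrict Ω) ≤
          eLpNorm (fun x => φ n x - w x) p (volume.restrict Ω) +
          eLpNorm (fun x => φ m x - w x) p (volume.restrict Ω) := by
        refine le_of_eq_of_le (congrArg (fun f => eLpNorm f p _) ?_) (eLpNorm_sub_le
          ((hφ n).continuous.aestronglyMeasurable.sub hw.1.1)
          ((hφ m).continuous.aestronglyMeasurable.sub hw.1.1) hp)
        ext x; simp
      have l2 : eLpNorm (∇ (φ n - φ m)) p (volume.restrict Ω) ≤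
          eLpNorm (fun x => ∇ (φ n) x - weakGrad Ω w x) p (volume.restrict Ω) +
          eLpNorm (fun x => ∇ (φ m) x - weakGrad Ω w x) p (volume.restrict Ω) := by
        refine le_of_eq_of_le (congrArg (fun f => eLpNorm f p _) ?_) (eLpNorm_sub_le
          ((continuous_gradient (d1 n)).aestronglyMeasurable.sub hv.1)
          ((continuous_gradient (d1 m)).aestronglyMeasurable.sub hv.1) hp)
        ext1 x; rw [gradient_sub_of_contDiff (d1 n) (d1 m)]; simp
      calc eLpNorm (φ n - φ m) p (surfaceMeasure (frontier Ω))
          ≤ C * (eLpNorm (φ n - φ m) p (volume.restrict Ω) +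
            eLpNorm (∇ (φ n - φ m)) p (volume.restrict Ω)) := h _ ((d1 n).sub (d1 m))
        _ ≤ C * ((eLpNorm (fun x => φ n x - w x) p (volume.restrict Ω) +
            eLpNorm (fun x => φ m x - w x) p (volume.restrict Ω)) +
            (eLpNorm (fun x => ∇ (φ n) x - weakGrad Ω w x) p (volume.restrict Ω) +
            eLpNorm (fun x => ∇ (φ m) x - weakGrad Ω w x) p (volume.restrict Ω))) := by gcongr
        _ = C * (eLpNorm (fun x => φ n x - w x) p (volume.restrict Ω) +
              eLpNorm (fun x => ∇ (φ n) x - weakGrad Ω w x) p (volume.restrict Ω)) +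
            C * (eLpNorm (fun x => φ m x - w x) p (volume.restrict Ω) +
              eLpNorm (fun x => ∇ (φ m) x - weakGrad Ω w x) p (volume.restrict Ω)) := by ring
        _ < ε / 2 + ε / 2 := ENNReal.add_lt_add (hN n hn) (hN m hm)
        _ = ε := ENNReal.add_halves ε)
  refine ⟨t, ⟨ht, φ, hφ, h1, h2, hlim⟩, fun hw0 => ?_⟩
  have hm := tendstoInMeasure_of_tendsto_eLpNorm (zero_lt_one.trans_le hp).ne'
    (fun n => (hφ n).continuous.aestronglyMeasurable) ht.1 hlim
  obtain ⟨ns, -, hns⟩ := hm.exists_seq_tendsto_ae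
  filter_upwards [hns] with x hx
  exact le_of_tendsto' hx fun i => h3 hw0 _ _

theorem isTrace_boundaryTrace (hΩ : IsC1Domain Ω) (hp : 1 ≤ p) (hpt : p ≠ ⊤)
    (hw : MemW1 Ω p w) : IsTrace Ω p w (boundaryTrace Ω p w) := by
  obtain ⟨t, ht, -⟩ := hΩ.exists_isTrace hp hpt hw
  have hex : ∃ t, IsTrace Ω p w t := ⟨t, ht⟩
  have : boundaryTrace Ω p w = Classical.choose hex := by simp only [boundaryTrace, dif_pos hex]
  rw [this]
  exact Classical.choose_spec hex

/-- By linearity t - t' is a trace of w - w = 0, so the trace inequality makes it vanish. -/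
theorem IsTrace.ae_unique (hΩ : IsC1Domain Ω) (hp : 1 ≤ p) (hpt : p ≠ ⊤) (hw : MemW1 Ω p w)
    (h : IsTrace Ω p w t) (h' : IsTrace Ω p w t') :
    t =ᵐ[surfaceMeasure (frontier Ω)] t' := by
  obtain ⟨C, hC, hle⟩ := hΩ.eLpNorm_isTrace_le hp hpt
  have hw0 := hw.add (hw.const_smul (-1))
  have h1 := h.add hΩ.isOpen hp hw (hw.const_smul (-1)) (h'.const_smul hΩ.isOpen hw (-1))
  have h2 := hle _ _ hw0 h1
  have e1 : eLpNorm (w + (-1 : ℝ) • w) p (volume.restrict Ω) = 0 := by simp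
  have e2 : eLpNorm (weakGrad Ω (w + (-1 : ℝ) • w)) p (volume.restrict Ω) = 0 := by
    rw [← eLpNorm_zero (ε := Euc d)]
    refine eLpNorm_congr_ae ?_
    filter_upwards [hw.weakGrad_add hΩ.isOpen (hw.const_smul (-1)),
      hw.weakGrad_const_smul hΩ.isOpen (-1)] with x hx hx'
    rw [hx, Pi.add_apply, hx']; simp
  rw [e1, e2, add_zero, mul_zero, nonpos_iff_eq_zero,
    eLpNorm_eq_zero_iff (h.1.add (h'.1.const_smul _)).1 (zero_lt_one.trans_le hp).ne'] at h2
  filter_upwards [h2] with x hx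
  simp only [Pi.add_apply, Pi.smul_apply, smul_eq_mul, Pi.zero_apply] at hx
  linarith

theorem boundaryTrace_ae_eq (hΩ : IsC1Domain Ω) (hp : 1 ≤ p) (hpt : p ≠ ⊤) (hw : MemW1 Ω p w)
    (h : IsTrace Ω p w t) : boundaryTrace Ω p w =ᵐ[surfaceMeasure (frontier Ω)] t :=
  (isTrace_boundaryTrace hΩ hp hpt hw).ae_unique hΩ hp hpt hw h

theorem boundaryTrace_add (hΩ : IsC1Domain Ω) (hp : 1 ≤ p) (hpt : p ≠ ⊤) (hw : MemW1 Ω p w)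
    (hw' : MemW1 Ω p w') : boundaryTrace Ω p (w + w') =ᵐ[surfaceMeasure (frontier Ω)]
      boundaryTrace Ω p w + boundaryTrace Ω p w' :=
  boundaryTrace_ae_eq hΩ hp hpt (hw.add hw') ((isTrace_boundaryTrace hΩ hp hpt hw).add hΩ.isOpen hp
    hw hw' (isTrace_boundaryTrace hΩ hp hpt hw'))

theorem boundaryTrace_const_smul (hΩ : IsC1Domain Ω) (hp : 1 ≤ p) (hpt : p ≠ ⊤)
    (hw : MemW1 Ω p w) (c : ℝ) : boundaryTrace Ω p (c • w) =ᵐ[surfaceMeasure (frontier Ω)]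
      c • boundaryTrace Ω p w :=
  boundaryTrace_ae_eq hΩ hp hpt (hw.const_smul c)
    ((isTrace_boundaryTrace hΩ hp hpt hw).const_smul hΩ.isOpen hw c)

theorem boundaryTrace_const (hΩ : IsC1Domain Ω) (hp : 1 ≤ p) (hpt : p ≠ ⊤) (c : ℝ) :
    boundaryTrace Ω p (fun _ => c) =ᵐ[surfaceMeasure (frontier Ω)] fun _ => c :=
  boundaryTrace_ae_eq hΩ hp hpt (MemW1.const hΩ.isBounded c) (IsTrace.const hΩ c)

theorem boundaryTrace_sub (hΩ : IsC1Domain Ω) (hp : 1 ≤ p) (hpt : p ≠ ⊤) (hw : MemW1 Ω p w)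
    (hw' : MemW1 Ω p w') : boundaryTrace Ω p (w - w') =ᵐ[surfaceMeasure (frontier Ω)]
      boundaryTrace Ω p w - boundaryTrace Ω p w' := by
  have h1 := boundaryTrace_add hΩ hp hpt hw (hw'.const_smul (-1))
  have e1 : w + (-1 : ℝ) • w' = w - w' := by ext x; simp [sub_eq_add_neg]
  rw [e1] at h1
  filter_upwards [h1, boundaryTrace_const_smul hΩ hp hpt hw' (-1)] with x hx hx'
  rw [hx, Pi.add_apply, hx']; simp [sub_eq_add_neg]

theorem boundaryTrace_add_const (hΩ : IsC1Domain Ω) (hp : 1 ≤ p) (hpt : p ≠ ⊤) (hw : MemW1 Ω p w)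
    (c : ℝ) : boundaryTrace Ω p (fun x => w x + c) =ᵐ[surfaceMeasure (frontier Ω)]
      fun x => boundaryTrace Ω p w x + c := by
  filter_upwards [boundaryTrace_add hΩ hp hpt hw (MemW1.const hΩ.isBounded c),
    boundaryTrace_const hΩ hp hpt c] with x hx hx'
  rw [Pi.add_apply, hx'] at hx
  exact hx

theorem boundaryTrace_nonpos (hΩ : IsC1Domain Ω) (hp : 1 ≤ p) (hpt : p ≠ ⊤) (hw : MemW1 Ω p w)
    (h : ∀ᵐ x ∂(volume.restrict Ω), w x ≤ 0) :
    ∀ᵐ x ∂(surfaceMeasure (frontier Ω)), boundaryTrace Ω p w x ≤ 0 := by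
  obtain ⟨t, ht, ht0⟩ := hΩ.exists_isTrace hp hpt hw
  filter_upwards [boundaryTrace_ae_eq hΩ hp hpt hw ht, ht0 h] with x hx hx'
  rw [hx]; exact hx'

theorem memLp_boundaryTrace (hΩ : IsC1Domain Ω) (hp : 1 ≤ p) (hpt : p ≠ ⊤) (hw : MemW1 Ω p w) :
    MemLp (boundaryTrace Ω p w) p (surfaceMeasure (frontier Ω)) :=
  (isTrace_boundaryTrace hΩ hp hpt hw).1

theorem IsC1Domain.eLpNorm_boundaryTrace_le (hΩ : IsC1Domain Ω) (hp : 1 ≤ p) (hpt : p ≠ ⊤) :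
    ∃ C : ℝ≥0∞, C ≠ ⊤ ∧ ∀ w : Euc d → ℝ, MemW1 Ω p w →
      eLpNorm (boundaryTrace Ω p w) p (surfaceMeasure (frontier Ω)) ≤
        C * (eLpNorm w p (volume.restrict Ω) + eLpNorm (weakGrad Ω w) p (volume.restrict Ω)) := by
  obtain ⟨C, hC, h⟩ := hΩ.eLpNorm_isTrace_le hp hpt
  exact ⟨C, hC, fun w hw => h w _ hw (isTrace_boundaryTrace hΩ hp hpt hw)⟩

end Trace

/-! ### Poincaré-type inequalities -/

section Poincare

variable {d : ℕ} {Ω : Set (Euc d)}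

/-- For fixed y the map is a dilation by 1 - s ≥ 1/2 followed by a translation, so its Jacobian
costs at most 2^d. This is why segments are only followed up to their midpoint. -/
theorem lintegral_comp_lineMap_le {H : Euc d → ℝ≥0∞} (hH : Measurable H) (y : Euc d) {s : ℝ}
    (hs : s ∈ Icc (0 : ℝ) (1 / 2)) : ∫⁻ x, H (x + s • (y - x)) ≤ 2 ^ d * ∫⁻ x, H x := by
  have ha : (1 / 2 : ℝ) ≤ 1 - s := by linarith [hs.2]
  have ha0 : 1 - s ≠ 0 := by linarith
  have e1 : ∀ x, x + s • (y - x) = (1 - s) • x + s • y := fun x => by module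
  simp only [e1]
  have hmap := Measure.map_addHaar_smul (volume : Measure (Euc d)) ha0
  have h1 : ∫⁻ x, H ((1 - s) • x + s • y) = ENNReal.ofReal |((1 - s) ^ d)⁻¹| * ∫⁻ x, H x := by
    have hm : Measurable fun z => H (z + s • y) := hH.comp (by fun_prop)
    rw [← lintegral_map hm (measurable_const_smul (1 - s)), hmap, lintegral_smul_measure,
      lintegral_add_right_eq_self, finrank_euclideanSpace_fin, smul_eq_mul]
  rw [h1]
  gcongr
  rw [abs_of_nonneg (by positivity), ← inv_pow]
  have h2 : (1 - s)⁻¹ ≤ 2 := by rw [inv_le_comm₀ (by linarith) two_pos]; linarith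
  calc ENNReal.ofReal ((1 - s)⁻¹ ^ d) ≤ ENNReal.ofReal (2 ^ d) :=
        ENNReal.ofReal_le_ofReal (pow_le_pow_left₀ (by positivity) h2 d)
    _ = 2 ^ d := by rw [ENNReal.ofReal_pow two_pos.le]; simp

/-- Integrate the gradient along the segment, extend it by zero off U, and exchange integrals so
that the change of variables is done in x for fixed y and s. The factor ℓ^p is what makes the
estimate useful for short segments. -/
theorem lintegral_lintegral_segment_le {p : ℝ} (hp : 1 ≤ p) {S T U : Set (Euc d)}
    (hS : MeasurableSet S) (hT : MeasurableSet T) (hU : MeasurableSet U) {D ℓ : ℝ}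
    (hseg : ∀ x ∈ S, ∀ y ∈ T, ∀ t ∈ Icc (0 : ℝ) 1, x + t • (y - x) ∈ U)
    (hD : ∀ x ∈ S, ∀ y ∈ T, ‖y - x‖ ≤ D) (hℓ : ℓ ∈ Ioc (0 : ℝ) (1 / 2)) {φ : Euc d → ℝ}
    (hφ : ContDiff ℝ 1 φ) :
    ∫⁻ x in S, ∫⁻ y in T, ‖φ (x + ℓ • (y - x)) - φ x‖ₑ ^ p ≤
      ENNReal.ofReal D ^ p * ENNReal.ofReal ℓ ^ p * 2 ^ d * volume T * ∫⁻ x in U, ‖∇ φ x‖ₑ ^ p := by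
  have hp0 : 0 < p := by linarith
  let H : Euc d → ℝ≥0∞ := U.indicator fun x => ‖∇ φ x‖ₑ
  have hH : Measurable H := (continuous_gradient hφ).enorm.measurable.indicator hU
  have hHp : ∫⁻ x, H x ^ p = ∫⁻ x in U, ‖∇ φ x‖ₑ ^ p := by
    rw [← lintegral_indicator hU]
    refine lintegral_congr fun y => ?_
    by_cases hy : y ∈ U <;> simp [H, hy, hp0]
  set K := ENNReal.ofReal D ^ p * ENNReal.ofReal ℓ ^ (p - 1) with hK
  have hpt : ∀ x ∈ S, ∀ y ∈ T, ‖φ (x + ℓ • (y - x)) - φ x‖ₑ ^ p ≤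
      K * ∫⁻ s in Ioo 0 ℓ, H (x + s • (y - x)) ^ p := by
    intro x hx y hy
    have h1 : ‖φ (x + ℓ • (y - x)) - φ x‖ₑ ≤
        ENNReal.ofReal D * ∫⁻ s in Ioo 0 ℓ, H (x + s • (y - x)) := by
      refine (enorm_sub_le_lintegral_gradient hφ x (y - x) hℓ.1.le).trans ?_
      rw [← lintegral_const_mul' _ _ ENNReal.ofReal_ne_top]
      refine setLIntegral_mono' measurableSet_Ioo fun s hs => ?_
      have hm : x + s • (y - x) ∈ U := hseg x hx y hy s ⟨hs.1.le, by linarith [hs.2, hℓ.2]⟩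
      simp only [H, indicator_of_mem hm]
      gcongr
      rw [← ofReal_norm]
      exact ENNReal.ofReal_le_ofReal (hD x hx y hy)
    have h2 := lintegral_rpow_le_rpow_mul_lintegral (ν := volume.restrict (Ioo 0 ℓ)) hp
      (f := fun s : ℝ => H (x + s • (y - x))) (hH.comp (by fun_prop)).aemeasurable
    refine (ENNReal.rpow_le_rpow h1 hp0.le).trans ?_
    rw [ENNReal.mul_rpow_of_nonneg _ _ hp0.le, hK, mul_assoc]
    gcongr
    simpa using h2
  have hm3 : Measurable fun z : (Euc d × Euc d) × ℝ => H (z.1.1 + z.2 • (z.1.2 - z.1.1)) ^ p :=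
    (hH.comp (by fun_prop)).pow_const p
  have hm2 : Measurable fun z : Euc d × Euc d => ∫⁻ s in Ioo 0 ℓ, H (z.1 + s • (z.2 - z.1)) ^ p :=
    hm3.lintegral_prod_right'
  have hℓ0 : ENNReal.ofReal ℓ ≠ 0 := by simpa using hℓ.1
  calc ∫⁻ x in S, ∫⁻ y in T, ‖φ (x + ℓ • (y - x)) - φ x‖ₑ ^ p
      ≤ ∫⁻ x in S, ∫⁻ y in T, K * ∫⁻ s in Ioo 0 ℓ, H (x + s • (y - x)) ^ p :=
        setLIntegral_mono' hS fun x hx => setLIntegral_mono' hT fun y hy => hpt x hx y hy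
    _ ≤ ∫⁻ x, ∫⁻ y in T, K * ∫⁻ s in Ioo 0 ℓ, H (x + s • (y - x)) ^ p :=
        setLIntegral_le_lintegral _ _
    _ = ∫⁻ y in T, ∫⁻ x, K * ∫⁻ s in Ioo 0 ℓ, H (x + s • (y - x)) ^ p :=
        lintegral_lintegral_swap (hm2.const_mul K).aemeasurable
    _ = ∫⁻ y in T, K * ∫⁻ s in Ioo 0 ℓ, ∫⁻ x, H (x + s • (y - x)) ^ p := by
        refine lintegral_congr fun y => ?_
        have hm4 : Measurable fun z : Euc d × ℝ => H (z.1 + z.2 • (y - z.1)) ^ p :=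
          (hH.comp (by fun_prop)).pow_const p
        rw [lintegral_const_mul _ hm4.lintegral_prod_right', lintegral_lintegral_swap
          hm4.aemeasurable]
    _ ≤ ∫⁻ y in T, K * ∫⁻ s in Ioo 0 ℓ, 2 ^ d * ∫⁻ x, H x ^ p := by
        refine lintegral_mono fun y => ?_
        refine mul_le_mul_right ?_ _
        refine setLIntegral_mono' measurableSet_Ioo fun s hs => ?_
        exact lintegral_comp_lineMap_le (hH.pow_const p) y ⟨hs.1.le, hs.2.le.trans hℓ.2⟩
    _ = ENNReal.ofReal D ^ p * (ENNReal.ofReal ℓ ^ (p - 1) * ENNReal.ofReal ℓ) * 2 ^ d *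
          volume T * ∫⁻ x in U, ‖∇ φ x‖ₑ ^ p := by
        rw [hHp]
        simp only [lintegral_const, Measure.restrict_apply_univ, Real.volume_Ioo, sub_zero, hK]
        ring
    _ = _ := by
        conv_lhs => rw [← ENNReal.rpow_one (ENNReal.ofReal ℓ), ← ENNReal.rpow_mul, one_mul]
        rw [← ENNReal.rpow_add _ _ hℓ0 ENNReal.ofReal_ne_top, sub_add_cancel]

theorem enorm_sub_rpow_le {p : ℝ} (hp : 1 ≤ p) (a b c : ℝ) :
    ‖a - c‖ₑ ^ p ≤ 2 ^ (p - 1) * (‖a - b‖ₑ ^ p + ‖b - c‖ₑ ^ p) := by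
  have h1 : ‖a - c‖ₑ ≤ ‖a - b‖ₑ + ‖b - c‖ₑ := by
    have := enorm_add_le (a - b) (b - c)
    rwa [sub_add_sub_cancel] at this
  exact (ENNReal.rpow_le_rpow h1 (by linarith)).trans (ENNReal.rpow_add_le_mul_rpow_add_rpow _ _ hp)

theorem two_rpow_ne_top {p : ℝ} (hp : 1 ≤ p) : (2 : ℝ≥0∞) ^ (p - 1) ≠ ⊤ :=
  ENNReal.rpow_ne_top_of_nonneg (by linarith) (by simp)

theorem lintegral_lintegral_add_swap {F : Euc d × Euc d → ℝ≥0∞} (hF : Measurable F)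
    (U B : Set (Euc d)) {c : ℝ≥0∞} (hc : c ≠ ⊤) :
    ∫⁻ y in B, ∫⁻ x in U, c * (F (x, y) + F (y, x)) =
      c * ((∫⁻ x in U, ∫⁻ y in B, F (x, y)) + ∫⁻ y in B, ∫⁻ x in U, F (y, x)) := by
  have hs : Measurable fun z : Euc d × Euc d => F (z.2, z.1) := hF.comp measurable_swap
  have h1 : ∀ y, ∫⁻ x in U, c * (F (x, y) + F (y, x)) =
      c * ((∫⁻ x in U, F (x, y)) + ∫⁻ x in U, F (y, x)) := by
    intro y
    rw [lintegral_const_mul' _ _ hc, lintegral_add_left]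
    exact hF.comp (measurable_id.prodMk measurable_const)
  simp only [h1]
  have hm : Measurable fun y => ∫⁻ x in U, F (x, y) :=
    Measurable.lintegral_prod_right' (f := fun z : Euc d × Euc d => F (z.2, z.1)) hs
  rw [lintegral_const_mul' _ _ hc, lintegral_add_left hm]
  congr 2
  exact lintegral_lintegral_swap hs.aemeasurable

/-- Compare φ(x) and φ(y) through the value at the midpoint: each half is covered by the segment
estimate started at its own end. Averaging over y in B then produces the constant. -/
theorem exists_poincare_starShaped {p : ℝ} (hp : 1 ≤ p) {U B : Set (Euc d)} (hU : IsOpen U)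
    (hUb : Bornology.IsBounded U) (hB : IsOpen B) (hBne : B.Nonempty) (hBU : B ⊆ U)
    (hseg : ∀ x ∈ U, ∀ y ∈ B, ∀ t ∈ Icc (0 : ℝ) 1, x + t • (y - x) ∈ U) :
    ∃ C : ℝ≥0∞, C ≠ ⊤ ∧ ∀ φ : Euc d → ℝ, ContDiff ℝ 1 φ → ∃ c : ℝ,
      ∫⁻ x in U, ‖φ x - c‖ₑ ^ p ≤ C * ∫⁻ x in U, ‖∇ φ x‖ₑ ^ p := by
  obtain ⟨D, hD⟩ := Metric.isBounded_iff.1 hUb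
  have hD1 : ∀ x ∈ U, ∀ y ∈ B, ‖y - x‖ ≤ D := fun x hx y hy => by
    rw [← dist_eq_norm]; exact hD (hBU hy) hx
  have hD2 : ∀ x ∈ B, ∀ y ∈ U, ‖y - x‖ ≤ D := fun x hx y hy => by
    rw [← dist_eq_norm]; exact hD hy (hBU hx)
  have hseg2 : ∀ x ∈ B, ∀ y ∈ U, ∀ t ∈ Icc (0 : ℝ) 1, x + t • (y - x) ∈ U := by
    intro x hx y hy t ht
    have := hseg y hy x hx (1 - t) ⟨by linarith [ht.2], by linarith [ht.1]⟩
    have e1 : y + (1 - t) • (x - y) = x + t • (y - x) := by module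
    rwa [e1] at this
  have hvB0 : volume B ≠ 0 := (hB.measure_pos volume hBne).ne'
  have hvUt : volume U ≠ ⊤ := hUb.measure_lt_top.ne
  have hvBt : volume B ≠ ⊤ := ((measure_mono hBU).trans_lt hUb.measure_lt_top).ne
  set K := ENNReal.ofReal D ^ p * ENNReal.ofReal (1 / 2) ^ p * 2 ^ d with hK
  have hKt : K ≠ ⊤ := by
    refine ENNReal.mul_ne_top (ENNReal.mul_ne_top ?_ ?_) (by simp)
    · exact ENNReal.rpow_ne_top_of_nonneg (by linarith) ENNReal.ofReal_ne_top
    · exact ENNReal.rpow_ne_top_of_nonneg (by linarith) ENNReal.ofReal_ne_top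
  refine ⟨2 ^ (p - 1) * (K * volume B + K * volume U) / volume B, ?_, fun φ hφ => ?_⟩
  · refine ENNReal.div_ne_top (ENNReal.mul_ne_top (two_rpow_ne_top hp) ?_) hvB0
    exact ENNReal.add_ne_top.2 ⟨ENNReal.mul_ne_top hKt hvBt, ENNReal.mul_ne_top hKt hvUt⟩
  have hhalf : (1 / 2 : ℝ) ∈ Ioc (0 : ℝ) (1 / 2) := ⟨by norm_num, le_rfl⟩
  have h1 := lintegral_lintegral_segment_le hp hU.measurableSet hB.measurableSet hU.measurableSet
    hseg hD1 hhalf hφ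
  have h2 := lintegral_lintegral_segment_le hp hB.measurableSet hU.measurableSet hU.measurableSet
    hseg2 hD2 hhalf hφ
  have hφc := hφ.continuous
  have hc2 : Measurable fun z : Euc d × Euc d => ‖φ z.1 - φ z.2‖ₑ ^ p := by
    have : Continuous fun z : Euc d × Euc d => φ z.1 - φ z.2 := by fun_prop
    exact this.enorm.measurable.pow_const p
  have hm1 : Measurable fun z : Euc d × Euc d =>
      ‖φ (z.1 + (1 / 2 : ℝ) • (z.2 - z.1)) - φ z.1‖ₑ ^ p := by
    have : Continuous fun z : Euc d × Euc d =>
      φ (z.1 + (1 / 2 : ℝ) • (z.2 - z.1)) - φ z.1 := by fun_prop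
    exact this.enorm.measurable.pow_const p
  have htot : ∫⁻ y in B, ∫⁻ x in U, ‖φ x - φ y‖ₑ ^ p ≤
      2 ^ (p - 1) * (K * volume B + K * volume U) * ∫⁻ x in U, ‖∇ φ x‖ₑ ^ p := by
    calc ∫⁻ y in B, ∫⁻ x in U, ‖φ x - φ y‖ₑ ^ p
        ≤ ∫⁻ y in B, ∫⁻ x in U, 2 ^ (p - 1) *
            (‖φ (x + (1 / 2 : ℝ) • (y - x)) - φ x‖ₑ ^ p +
              ‖φ (y + (1 / 2 : ℝ) • (x - y)) - φ y‖ₑ ^ p) := by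
          refine lintegral_mono fun y => lintegral_mono fun x => ?_
          have e1 : y + (1 / 2 : ℝ) • (x - y) = x + (1 / 2 : ℝ) • (y - x) := by module
          rw [e1]
          refine (enorm_sub_rpow_le hp _ (φ (x + (1 / 2 : ℝ) • (y - x))) _).trans ?_
          rw [← enorm_neg (φ x - _), neg_sub]
      _ = 2 ^ (p - 1) * ((∫⁻ x in U, ∫⁻ y in B, ‖φ (x + (1 / 2 : ℝ) • (y - x)) - φ x‖ₑ ^ p) +
            ∫⁻ y in B, ∫⁻ x in U, ‖φ (y + (1 / 2 : ℝ) • (x - y)) - φ y‖ₑ ^ p) := by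
          exact lintegral_lintegral_add_swap hm1 U B (two_rpow_ne_top hp)
      _ ≤ 2 ^ (p - 1) * (K * volume B * (∫⁻ x in U, ‖∇ φ x‖ₑ ^ p) +
            K * volume U * ∫⁻ x in U, ‖∇ φ x‖ₑ ^ p) := by
          exact mul_le_mul_right (add_le_add h1 h2) _
      _ = _ := by ring
  -- Some y in B does no worse than the average; its value φ(y) is the constant.
  obtain ⟨y, hy, hle⟩ := exists_le_setLAverage (μ := volume) (s := B)
    (f := fun y => ∫⁻ x in U, ‖φ x - φ y‖ₑ ^ p) hvB0 hvBt
    (hc2.comp measurable_swap).lintegral_prod_right'.aemeasurable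
  refine ⟨φ y, hle.trans ?_⟩
  rw [setLAverage_eq, ENNReal.div_eq_inv_mul, ENNReal.div_eq_inv_mul, mul_assoc]
  gcongr

end Poincare

/-! ### Gluing Poincaré inequalities; functions of small support. -/

section Poincare

variable {d : ℕ} {Ω : Set (Euc d)}

/-- The constants a and b belonging to the two sets are both close to φ on the overlap, which has
positive measure, so |b - a| is controlled and a serves for both. `I` is abstract so that all pieces
use the gradient energy of the same large domain. -/
theorem exists_poincare_union {p : ℝ} (hp : 1 ≤ p) {A B : Set (Euc d)} {I : (Euc d → ℝ) → ℝ≥0∞}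
    (hAB : IsOpen (A ∩ B)) (hne : (A ∩ B).Nonempty) (hAb : volume A ≠ ⊤) (hBb : volume B ≠ ⊤)
    (hA : ∃ C : ℝ≥0∞, C ≠ ⊤ ∧ ∀ φ : Euc d → ℝ, ContDiff ℝ 1 φ → ∃ c : ℝ,
      ∫⁻ x in A, ‖φ x - c‖ₑ ^ p ≤ C * I φ)
    (hB : ∃ C : ℝ≥0∞, C ≠ ⊤ ∧ ∀ φ : Euc d → ℝ, ContDiff ℝ 1 φ → ∃ c : ℝ,
      ∫⁻ x in B, ‖φ x - c‖ₑ ^ p ≤ C * I φ) :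
    ∃ C : ℝ≥0∞, C ≠ ⊤ ∧ ∀ φ : Euc d → ℝ, ContDiff ℝ 1 φ → ∃ c : ℝ,
      ∫⁻ x in A ∪ B, ‖φ x - c‖ₑ ^ p ≤ C * I φ := by
  obtain ⟨C₁, hC₁, h₁⟩ := hA
  obtain ⟨C₂, hC₂, h₂⟩ := hB
  have hv0 : volume (A ∩ B) ≠ 0 := (hAB.measure_pos volume hne).ne'
  have hvt : volume (A ∩ B) ≠ ⊤ := ((measure_mono inter_subset_left).trans_lt hAb.lt_top).ne
  set k : ℝ≥0∞ := 2 ^ (p - 1) with hk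
  have hkt : k ≠ ⊤ := two_rpow_ne_top hp
  refine ⟨C₁ + k * (C₂ + k * (C₂ + C₁) * ((volume (A ∩ B))⁻¹ * volume B)), ?_, fun φ hφ => ?_⟩
  · refine ENNReal.add_ne_top.2 ⟨hC₁, ENNReal.mul_ne_top hkt (ENNReal.add_ne_top.2 ⟨hC₂,
      ENNReal.mul_ne_top (ENNReal.mul_ne_top hkt (ENNReal.add_ne_top.2 ⟨hC₂, hC₁⟩))
      (ENNReal.mul_ne_top (ENNReal.inv_ne_top.2 hv0) hBb)⟩)⟩
  obtain ⟨a, ha⟩ := h₁ φ hφ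
  obtain ⟨b, hb⟩ := h₂ φ hφ
  have hm : ∀ c : ℝ, Measurable fun x => ‖φ x - c‖ₑ ^ p := fun c =>
    (hφ.continuous.sub continuous_const).enorm.measurable.pow_const p
  have hba : ‖b - a‖ₑ ^ p * volume (A ∩ B) ≤ k * (C₂ * I φ + C₁ * I φ) := by
    calc ‖b - a‖ₑ ^ p * volume (A ∩ B) = ∫⁻ _ in A ∩ B, ‖b - a‖ₑ ^ p := by simp
      _ ≤ ∫⁻ x in A ∩ B, k * (‖φ x - b‖ₑ ^ p + ‖φ x - a‖ₑ ^ p) := by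
          refine lintegral_mono fun x => (enorm_sub_rpow_le hp b (φ x) a).trans ?_
          rw [← enorm_neg (b - φ x), neg_sub]
      _ = k * ((∫⁻ x in A ∩ B, ‖φ x - b‖ₑ ^ p) + ∫⁻ x in A ∩ B, ‖φ x - a‖ₑ ^ p) := by
          rw [lintegral_const_mul' _ _ hkt, lintegral_add_left (hm b)]
      _ ≤ k * (C₂ * I φ + C₁ * I φ) := by
          gcongr
          · exact (lintegral_mono_set inter_subset_right).trans hb
          · exact (lintegral_mono_set inter_subset_left).trans ha
  have hba' : ‖b - a‖ₑ ^ p ≤ k * (C₂ * I φ + C₁ * I φ) * (volume (A ∩ B))⁻¹ := by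
    rw [← div_eq_mul_inv, ENNReal.le_div_iff_mul_le (Or.inl hv0) (Or.inl hvt)]
    exact hba
  have hBa : ∫⁻ x in B, ‖φ x - a‖ₑ ^ p ≤ k * (C₂ * I φ + ‖b - a‖ₑ ^ p * volume B) := by
    calc ∫⁻ x in B, ‖φ x - a‖ₑ ^ p ≤ ∫⁻ x in B, k * (‖φ x - b‖ₑ ^ p + ‖b - a‖ₑ ^ p) :=
          lintegral_mono fun x => enorm_sub_rpow_le hp _ b _
      _ = k * ((∫⁻ x in B, ‖φ x - b‖ₑ ^ p) + ‖b - a‖ₑ ^ p * volume B) := by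
          rw [lintegral_const_mul' _ _ hkt, lintegral_add_left (hm b)]; simp
      _ ≤ _ := by gcongr
  refine ⟨a, (lintegral_union_le _ A B).trans ((add_le_add ha hBa).trans ?_)⟩
  calc C₁ * I φ + k * (C₂ * I φ + ‖b - a‖ₑ ^ p * volume B)
      ≤ C₁ * I φ + k * (C₂ * I φ +
          k * (C₂ * I φ + C₁ * I φ) * (volume (A ∩ B))⁻¹ * volume B) := by gcongr
    _ = _ := by ring

theorem IsC1Domain.exists_poincare_smooth (hΩ : IsC1Domain Ω) {p : ℝ} (hp : 1 ≤ p) :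
    ∃ C : ℝ≥0∞, C ≠ ⊤ ∧ ∀ φ : Euc d → ℝ, ContDiff ℝ 1 φ → ∃ c : ℝ,
      ∫⁻ x in Ω, ‖φ x - c‖ₑ ^ p ≤ C * ∫⁻ x in Ω, ‖∇ φ x‖ₑ ^ p := by
  choose! N hNo hxN b ρ hρ hb hseg using fun x (hx : x ∈ closure Ω) => hΩ.exists_starShaped hx
  obtain ⟨t, htK, hcov⟩ := hΩ.isBounded.isCompact_closure.elim_nhds_subcover N
    fun x hx => (hNo x hx).mem_nhds (hxN x hx)
  have hvol : ∀ A ⊆ Ω, volume A ≠ ⊤ := fun A hA =>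
    ((measure_mono hA).trans_lt hΩ.isBounded.measure_lt_top).ne
  refine (hΩ.isConnected.induction_finite_cover t (U := fun x => N x ∩ Ω)
    (fun x hx => (hNo x (htK x hx)).inter hΩ.isOpen)
    (fun x hx => ⟨b x, hb x (htK x hx) (Metric.mem_ball_self (hρ x (htK x hx)))⟩)
    (fun x _ => inter_subset_right) ?_ (Q := fun A => A ⊆ Ω ∧ ∃ C : ℝ≥0∞, C ≠ ⊤ ∧
      ∀ φ : Euc d → ℝ, ContDiff ℝ 1 φ → ∃ c : ℝ,
      ∫⁻ x in A, ‖φ x - c‖ₑ ^ p ≤ C * ∫⁻ x in Ω, ‖∇ φ x‖ₑ ^ p) ?_ ?_).2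
  · intro y hy
    obtain ⟨x, hx, hyx⟩ := mem_iUnion₂.1 (hcov (subset_closure hy))
    exact mem_iUnion₂.2 ⟨x, hx, hyx, hy⟩
  · intro x hx
    have hxK := htK x hx
    refine ⟨inter_subset_right, ?_⟩
    obtain ⟨C, hC, h⟩ := exists_poincare_starShaped hp ((hNo x hxK).inter hΩ.isOpen)
      (hΩ.isBounded.subset inter_subset_right) Metric.isOpen_ball
      (Metric.nonempty_ball.2 (hρ x hxK)) (hb x hxK) (hseg x hxK)
    refine ⟨C, hC, fun φ hφ => ?_⟩
    obtain ⟨c, hc⟩ := h φ hφ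
    exact ⟨c, hc.trans (by gcongr; exact inter_subset_right)⟩
  · rintro A B hA hB hne ⟨hAΩ, hA'⟩ ⟨hBΩ, hB'⟩
    exact ⟨union_subset hAΩ hBΩ, exists_poincare_union hp (hA.inter hB) hne (hvol A hAΩ)
      (hvol B hBΩ) hA' hB'⟩

/-- The slack ε allows stopping at one good smooth approximation, so no limit of the constants c is
needed. -/
theorem IsC1Domain.exists_poincare (hΩ : IsC1Domain Ω) {p : ℝ≥0∞} (hp : 1 ≤ p) (hpt : p ≠ ⊤) :
    ∃ C : ℝ≥0∞, C ≠ ⊤ ∧ ∀ w : Euc d → ℝ, MemW1 Ω p w → ∀ ε : ℝ≥0∞, ε ≠ 0 → ∃ c : ℝ,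
      eLpNorm (fun x => w x - c) p (volume.restrict Ω) ≤
        C * (eLpNorm (weakGrad Ω w) p (volume.restrict Ω) + ε) := by
  have hp1 : 1 ≤ p.toReal := by simpa using ENNReal.toReal_mono hpt hp
  have hp0 : p ≠ 0 := (zero_lt_one.trans_le hp).ne'
  obtain ⟨C, hC, h⟩ := hΩ.exists_poincare_smooth hp1
  set C' := C ^ (1 / p.toReal) with hC'
  have hC't : C' ≠ ⊤ := ENNReal.rpow_ne_top_of_nonneg (by positivity) hC
  refine ⟨1 + C', by simp [hC't], fun w hw ε hε => ?_⟩
  obtain ⟨φ, hφ, h1, h2, -⟩ := hΩ.exists_smooth_approx hp hpt hw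
  have d1 : ∀ n, ContDiff ℝ 1 (φ n) := fun n => (hφ n).of_le (by simp)
  have hv := hw.memLp_weakGrad hΩ.isOpen
  obtain ⟨n, hn1, hn2⟩ := ((h1.eventually_lt_const hε.bot_lt).and
    (h2.eventually_lt_const hε.bot_lt)).exists
  obtain ⟨c, hc⟩ := h (φ n) (d1 n)
  refine ⟨c, ?_⟩
  have l1 : eLpNorm (fun x => φ n x - c) p (volume.restrict Ω) ≤
      C' * eLpNorm (∇ (φ n)) p (volume.restrict Ω) := by
    simp only [eLpNorm_eq_lintegral_rpow_enorm_toReal hp0 hpt]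
    refine (ENNReal.rpow_le_rpow hc (by positivity)).trans (le_of_eq ?_)
    rw [ENNReal.mul_rpow_of_nonneg _ _ (by positivity)]
  have l2 : eLpNorm (∇ (φ n)) p (volume.restrict Ω) ≤
      eLpNorm (weakGrad Ω w) p (volume.restrict Ω) + ε := by
    have e3 : ∇ (φ n) = weakGrad Ω w + fun x => ∇ (φ n) x - weakGrad Ω w x := by ext1 x; simp
    conv_lhs => rw [e3]
    refine (eLpNorm_add_le hv.1 ((continuous_gradient (d1 n)).aestronglyMeasurable.sub hv.1)
      hp).trans ?_
    gcongr
    exact hn2.le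
  have l3 : eLpNorm (fun x => w x - c) p (volume.restrict Ω) ≤
      eLpNorm (fun x => φ n x - c) p (volume.restrict Ω) +
      eLpNorm (fun x => φ n x - w x) p (volume.restrict Ω) := by
    refine le_of_eq_of_le (congrArg (fun f => eLpNorm f p _) ?_) (eLpNorm_sub_le
      ((hφ n).continuous.sub continuous_const).aestronglyMeasurable
      ((hφ n).continuous.aestronglyMeasurable.sub hw.1.1) hp)
    ext x; simp
  calc _ ≤ C' * (eLpNorm (weakGrad Ω w) p (volume.restrict Ω) + ε) + ε := by
        refine l3.trans (add_le_add (l1.trans ?_) hn1.le)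
        gcongr
    _ ≤ C' * (eLpNorm (weakGrad Ω w) p (volume.restrict Ω) + ε) +
          1 * (eLpNorm (weakGrad Ω w) p (volume.restrict Ω) + ε) := by
        rw [one_mul]
        gcongr
        exact self_le_add_left _ _
    _ = _ := by ring

/-- A function on a star-shaped set that is small off a set `A` of small measure is controlled by
its gradient, with a small constant. -/
theorem lintegral_le_of_small_support_starShaped {U B : Set (Euc d)} (hU : IsOpen U)
    (hUb : Bornology.IsBounded U) (hB : IsOpen B) (hBne : B.Nonempty) (hBU : B ⊆ U)
    (hseg : ∀ x ∈ U, ∀ y ∈ B, ∀ t ∈ Icc (0 : ℝ) 1, x + t • (y - x) ∈ U) :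
    ∃ C : ℝ≥0∞, C ≠ ⊤ ∧ ∃ κ > (0 : ℝ), ∀ ℓ ∈ Ioc (0 : ℝ) (1 / 2), ∀ A : Set (Euc d),
      MeasurableSet A → volume A ≤ ENNReal.ofReal (κ * ℓ ^ d) → ∀ φ : Euc d → ℝ, ContDiff ℝ 1 φ →
      ∫⁻ x in U, ‖φ x‖ₑ ≤
        C * (ENNReal.ofReal ℓ * (∫⁻ x in U, ‖∇ φ x‖ₑ) + ∫⁻ x in U \ A, ‖φ x‖ₑ) := by
  obtain ⟨D, hD⟩ := Metric.isBounded_iff.1 hUb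
  have hD1 : ∀ x ∈ U, ∀ y ∈ B, ‖y - x‖ ≤ D := fun x hx y hy => by
    rw [← dist_eq_norm]; exact hD (hBU hy) hx
  have hvB0 : volume B ≠ 0 := (hB.measure_pos volume hBne).ne'
  have hvBt : volume B ≠ ⊤ := ((measure_mono hBU).trans_lt hUb.measure_lt_top).ne
  have hβ : 0 < (volume B).toReal := ENNReal.toReal_pos hvB0 hvBt
  refine ⟨2 * 2 ^ d * (ENNReal.ofReal D + 1), ?_, (volume B).toReal / 2, by positivity,
    fun ℓ hℓ A hA hAv φ hφ => ?_⟩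
  · exact ENNReal.mul_ne_top (ENNReal.mul_ne_top (by simp) (by simp)) (by simp)
  have hℓ0 := hℓ.1
  let H : Euc d → ℝ≥0∞ := (U \ A).indicator fun x => ‖φ x‖ₑ
  have hUA : MeasurableSet (U \ A) := hU.measurableSet.diff hA
  have hH : Measurable H := hφ.continuous.enorm.measurable.indicator hUA
  -- For at least half of the y in B the point x + ℓ(y - x) misses A: these points fill a copy of B
  -- scaled by ℓ, and A has at most half its measure. At such points φ counts towards the integral
  -- off A.
  have hpt : ∀ x ∈ U, volume B / 2 * ‖φ x‖ₑ ≤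
      ∫⁻ y in B, (‖φ (x + ℓ • (y - x)) - φ x‖ₑ + H (x + ℓ • (y - x))) := by
    intro x hx
    have hz : Continuous fun y => x + ℓ • (y - x) := by fun_prop
    let Ax := (fun y => x + ℓ • (y - x)) ⁻¹' A
    have hAxm : MeasurableSet Ax := hz.measurable hA
    have hAx : volume Ax ≤ volume B / 2 := by
      have e1 : Ax = (fun y => ℓ • y) ⁻¹' ((fun y => y + (x - ℓ • x)) ⁻¹' A) := by
        ext y
        simp only [Ax, mem_preimage]
        have : x + ℓ • (y - x) = ℓ • y + (x - ℓ • x) := by module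
        rw [this]
      rw [e1, Measure.addHaar_preimage_smul _ hℓ0.ne', measure_preimage_add_right,
        finrank_euclideanSpace_fin, abs_of_pos (by positivity)]
      refine (mul_le_mul_right hAv _).trans (le_of_eq ?_)
      rw [← ENNReal.ofReal_mul (by positivity)]
      have e2 : (ℓ ^ d)⁻¹ * ((volume B).toReal / 2 * ℓ ^ d) = (volume B).toReal / 2 := by
        field_simp
      rw [e2, ENNReal.ofReal_div_of_pos two_pos, ENNReal.ofReal_toReal hvBt]
      simp
    have hdiff : volume B / 2 ≤ volume (B \ Ax) := by
      have h1 : volume B ≤ volume (B \ Ax) + volume B / 2 := by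
        calc volume B ≤ volume (B \ Ax ∪ Ax) := measure_mono (by rw [sdiff_union_self]; exact subset_union_left)
          _ ≤ volume (B \ Ax) + volume Ax := measure_union_le _ _
          _ ≤ _ := by gcongr
      have h2 : volume B - volume B / 2 ≤ volume (B \ Ax) := tsub_le_iff_right.2 h1
      rwa [ENNReal.sub_half hvBt] at h2
    calc volume B / 2 * ‖φ x‖ₑ ≤ volume (B \ Ax) * ‖φ x‖ₑ := by gcongr
      _ = ∫⁻ _ in B \ Ax, ‖φ x‖ₑ := by simp [mul_comm]
      _ ≤ ∫⁻ y in B \ Ax, (‖φ (x + ℓ • (y - x)) - φ x‖ₑ + H (x + ℓ • (y - x))) := by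
          refine setLIntegral_mono' (hB.measurableSet.diff hAxm) fun y hy => ?_
          have hmem : x + ℓ • (y - x) ∈ U \ A :=
            ⟨hseg x hx y hy.1 ℓ ⟨hℓ0.le, by linarith [hℓ.2]⟩, hy.2⟩
          simp only [H, indicator_of_mem hmem]
          have := enorm_sub_le (a := φ (x + ℓ • (y - x))) (b := φ (x + ℓ • (y - x)) - φ x)
          rw [sub_sub_cancel] at this
          rwa [add_comm] at this
      _ ≤ _ := lintegral_mono_set sdiff_subset
  have hseg1 := lintegral_lintegral_segment_le le_rfl hU.measurableSet hB.measurableSet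
    hU.measurableSet hseg hD1 hℓ hφ
  simp only [ENNReal.rpow_one] at hseg1
  have hHx : ∫⁻ x in U, ∫⁻ y in B, H (x + ℓ • (y - x)) ≤
      volume B * (2 ^ d * ∫⁻ x in U \ A, ‖φ x‖ₑ) := by
    have hm : Measurable fun z : Euc d × Euc d => H (z.1 + ℓ • (z.2 - z.1)) :=
      hH.comp (by fun_prop)
    calc ∫⁻ x in U, ∫⁻ y in B, H (x + ℓ • (y - x))
        ≤ ∫⁻ x, ∫⁻ y in B, H (x + ℓ • (y - x)) := setLIntegral_le_lintegral _ _
      _ = ∫⁻ y in B, ∫⁻ x, H (x + ℓ • (y - x)) := lintegral_lintegral_swap hm.aemeasurable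
      _ ≤ ∫⁻ y in B, 2 ^ d * ∫⁻ x, H x := lintegral_mono fun y =>
          lintegral_comp_lineMap_le hH y ⟨hℓ0.le, hℓ.2⟩
      _ = volume B * (2 ^ d * ∫⁻ x in U \ A, ‖φ x‖ₑ) := by
          rw [← lintegral_indicator hUA]; simp [H, mul_comm]
  have hmain : volume B / 2 * ∫⁻ x in U, ‖φ x‖ₑ ≤ volume B / 2 * (2 * 2 ^ d *
      (ENNReal.ofReal D * (ENNReal.ofReal ℓ * ∫⁻ x in U, ‖∇ φ x‖ₑ) + ∫⁻ x in U \ A, ‖φ x‖ₑ)) := by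
    have hm : Measurable fun z : Euc d × Euc d => ‖φ (z.1 + ℓ • (z.2 - z.1)) - φ z.1‖ₑ := by
      have hφc := hφ.continuous
      have : Continuous fun z : Euc d × Euc d => φ (z.1 + ℓ • (z.2 - z.1)) - φ z.1 := by fun_prop
      exact this.enorm.measurable
    calc volume B / 2 * ∫⁻ x in U, ‖φ x‖ₑ = ∫⁻ x in U, volume B / 2 * ‖φ x‖ₑ :=
          (lintegral_const_mul' _ _ (ENNReal.div_ne_top hvBt (by simp))).symm
      _ ≤ ∫⁻ x in U, ∫⁻ y in B, (‖φ (x + ℓ • (y - x)) - φ x‖ₑ + H (x + ℓ • (y - x))) :=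
          setLIntegral_mono' hU.measurableSet hpt
      _ = (∫⁻ x in U, ∫⁻ y in B, ‖φ (x + ℓ • (y - x)) - φ x‖ₑ) +
            ∫⁻ x in U, ∫⁻ y in B, H (x + ℓ • (y - x)) := by
          rw [← lintegral_add_left hm.lintegral_prod_right']
          refine lintegral_congr fun x => ?_
          exact lintegral_add_left (hm.comp (measurable_const.prodMk measurable_id)) _
      _ ≤ _ := add_le_add hseg1 hHx
      _ = (volume B / 2 * 2) * (2 ^ d * (ENNReal.ofReal D *
            (ENNReal.ofReal ℓ * ∫⁻ x in U, ‖∇ φ x‖ₑ) + ∫⁻ x in U \ A, ‖φ x‖ₑ)) := by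
          rw [ENNReal.div_mul_cancel (by simp) (by simp)]; ring
      _ = _ := by ring
  rw [ENNReal.mul_le_mul_iff_right (by simpa using hvB0) (ENNReal.div_ne_top hvBt (by simp))]
    at hmain
  refine hmain.trans ?_
  rw [mul_assoc (2 * 2 ^ d)]
  gcongr
  rw [mul_add, add_mul, add_mul, one_mul, one_mul]
  exact add_le_add le_self_add (self_le_add_left _ _)

theorem IsC1Domain.lintegral_le_of_small_support_smooth (hΩ : IsC1Domain Ω) :
    ∃ C : ℝ≥0∞, C ≠ ⊤ ∧ ∃ κ > (0 : ℝ), ∀ ℓ ∈ Ioc (0 : ℝ) (1 / 2), ∀ A : Set (Euc d),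
      MeasurableSet A → volume A ≤ ENNReal.ofReal (κ * ℓ ^ d) → ∀ φ : Euc d → ℝ, ContDiff ℝ 1 φ →
      ∫⁻ x in Ω, ‖φ x‖ₑ ≤
        C * (ENNReal.ofReal ℓ * (∫⁻ x in Ω, ‖∇ φ x‖ₑ) + ∫⁻ x in Ω \ A, ‖φ x‖ₑ) := by
  have key := hΩ.isBounded.isCompact_closure.induction_on
    (p := fun s => ∃ C : ℝ≥0∞, C ≠ ⊤ ∧ ∃ κ > (0 : ℝ), ∀ ℓ ∈ Ioc (0 : ℝ) (1 / 2),
      ∀ A : Set (Euc d), MeasurableSet A → volume A ≤ ENNReal.ofReal (κ * ℓ ^ d) →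
      ∀ φ : Euc d → ℝ, ContDiff ℝ 1 φ → ∫⁻ x in s ∩ Ω, ‖φ x‖ₑ ≤
        C * (ENNReal.ofReal ℓ * (∫⁻ x in Ω, ‖∇ φ x‖ₑ) + ∫⁻ x in Ω \ A, ‖φ x‖ₑ))
    ?_ ?_ ?_ ?_
  · rwa [inter_eq_right.2 subset_closure] at key
  · exact ⟨0, by simp, 1, one_pos, fun _ _ _ _ _ _ _ => by simp⟩
  · rintro s t hst ⟨C, hC, κ, hκ, h⟩
    exact ⟨C, hC, κ, hκ, fun ℓ hℓ A hA hAv φ hφ =>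
      (lintegral_mono_set (inter_subset_inter_left _ hst)).trans (h ℓ hℓ A hA hAv φ hφ)⟩
  · rintro s t ⟨C, hC, κ, hκ, h⟩ ⟨C', hC', κ', hκ', h'⟩
    refine ⟨C + C', by simp [hC, hC'], min κ κ', lt_min hκ hκ', fun ℓ hℓ A hA hAv φ hφ => ?_⟩
    have hℓd : 0 ≤ ℓ ^ d := pow_nonneg hℓ.1.le d
    rw [union_inter_distrib_right, add_mul]
    refine (lintegral_union_le _ _ _).trans (add_le_add
      (h ℓ hℓ A hA (hAv.trans (ENNReal.ofReal_le_ofReal ?_)) φ hφ)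
      (h' ℓ hℓ A hA (hAv.trans (ENNReal.ofReal_le_ofReal ?_)) φ hφ))
    · exact mul_le_mul_of_nonneg_right (min_le_left _ _) hℓd
    · exact mul_le_mul_of_nonneg_right (min_le_right _ _) hℓd
  · intro x hx
    obtain ⟨N, hNo, hxN, b, ρ, hρ, hb, hseg⟩ := hΩ.exists_starShaped hx
    refine ⟨N, mem_nhdsWithin_of_mem_nhds (hNo.mem_nhds hxN), ?_⟩
    obtain ⟨C, hC, κ, hκ, h⟩ := lintegral_le_of_small_support_starShaped (hNo.inter hΩ.isOpen)
      (hΩ.isBounded.subset inter_subset_right) Metric.isOpen_ball (Metric.nonempty_ball.2 hρ)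
      hb hseg
    refine ⟨C, hC, κ, hκ, fun ℓ hℓ A hA hAv φ hφ => (h ℓ hℓ A hA hAv φ hφ).trans ?_⟩
    gcongr
    · exact inter_subset_right
    · exact inter_subset_right

/-- Smooth approximations of w need not vanish off A; the extra term in the smooth estimate absorbs
this and tends to zero. -/
theorem IsC1Domain.eLpNorm_le_of_small_support (hΩ : IsC1Domain Ω) :
    ∃ C : ℝ≥0∞, C ≠ ⊤ ∧ ∃ κ > (0 : ℝ), ∀ ℓ ∈ Ioc (0 : ℝ) (1 / 2), ∀ A : Set (Euc d),
      MeasurableSet A → volume A ≤ ENNReal.ofReal (κ * ℓ ^ d) → ∀ w : Euc d → ℝ, MemW1 Ω 1 w →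
      (∀ᵐ x ∂(volume.restrict Ω), x ∉ A → w x = 0) →
      eLpNorm w 1 (volume.restrict Ω) ≤
        C * (ENNReal.ofReal ℓ * eLpNorm (weakGrad Ω w) 1 (volume.restrict Ω)) := by
  obtain ⟨C, hC, κ, hκ, h⟩ := hΩ.lintegral_le_of_small_support_smooth
  refine ⟨C, hC, κ, hκ, fun ℓ hℓ A hA hAv w hw hw0 => ?_⟩
  obtain ⟨φ, hφ, h1, h2, -⟩ := hΩ.exists_smooth_approx le_rfl ENNReal.one_ne_top hw
  have d1 : ∀ n, ContDiff ℝ 1 (φ n) := fun n => (hφ n).of_le (by simp)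
  have hv := hw.memLp_weakGrad hΩ.isOpen
  have hle : ∀ n, eLpNorm w 1 (volume.restrict Ω) ≤
      eLpNorm (fun x => φ n x - w x) 1 (volume.restrict Ω) +
      C * (ENNReal.ofReal ℓ * (eLpNorm (fun x => ∇ (φ n) x - weakGrad Ω w x) 1 (volume.restrict Ω) +
        eLpNorm (weakGrad Ω w) 1 (volume.restrict Ω)) +
        eLpNorm (fun x => φ n x - w x) 1 (volume.restrict Ω)) := by
    intro n
    have l1 : eLpNorm w 1 (volume.restrict Ω) ≤ eLpNorm (φ n) 1 (volume.restrict Ω) +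
        eLpNorm (fun x => φ n x - w x) 1 (volume.restrict Ω) := by
      refine le_of_eq_of_le (congrArg (fun f => eLpNorm f 1 _) ?_) (eLpNorm_sub_le
        (hφ n).continuous.aestronglyMeasurable
        ((hφ n).continuous.aestronglyMeasurable.sub hw.1.1) le_rfl)
      ext x; simp
    have l2 : eLpNorm (∇ (φ n)) 1 (volume.restrict Ω) ≤
        eLpNorm (fun x => ∇ (φ n) x - weakGrad Ω w x) 1 (volume.restrict Ω) +
          eLpNorm (weakGrad Ω w) 1 (volume.restrict Ω) := by
      have e3 : ∇ (φ n) = (fun x => ∇ (φ n) x - weakGrad Ω w x) + weakGrad Ω w := by ext1 x; simp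
      conv_lhs => rw [e3]
      exact eLpNorm_add_le ((continuous_gradient (d1 n)).aestronglyMeasurable.sub hv.1) hv.1 le_rfl
    have l3 : ∫⁻ x in Ω \ A, ‖φ n x‖ₑ ≤
        eLpNorm (fun x => φ n x - w x) 1 (volume.restrict Ω) := by
      rw [eLpNorm_one_eq_lintegral_enorm]
      calc ∫⁻ x in Ω \ A, ‖φ n x‖ₑ = ∫⁻ x in Ω \ A, ‖φ n x - w x‖ₑ := by
            refine lintegral_congr_ae ?_
            rw [sdiff_eq, inter_comm, ← Measure.restrict_restrict hA.compl, Filter.EventuallyEq,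
              ae_restrict_iff' hA.compl]
            filter_upwards [hw0] with x hx hxA
            rw [hx hxA, sub_zero]
        _ ≤ _ := lintegral_mono_set sdiff_subset
    have l4 := h ℓ hℓ A hA hAv (φ n) (d1 n)
    rw [← eLpNorm_one_eq_lintegral_enorm, ← eLpNorm_one_eq_lintegral_enorm] at l4
    refine l1.trans ?_
    rw [add_comm]
    gcongr
    refine l4.trans ?_
    gcongr
  have hlim := h1.add (ENNReal.Tendsto.const_mul ((ENNReal.Tendsto.const_mul
    (h2.add (tendsto_const_nhds (x := eLpNorm (weakGrad Ω w) 1 (volume.restrict Ω))))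
    (Or.inr (ENNReal.ofReal_ne_top (r := ℓ)))).add h1) (Or.inr hC))
  simp only [zero_add, add_zero] at hlim
  exact ge_of_tendsto' hlim hle

end Poincare

/-! ### Compositions with `C¹` functions and boundedness -/

section Truncation

variable {d : ℕ} {Ω : Set (Euc d)} {p : ℝ≥0∞} {w : Euc d → ℝ}

theorem gradient_comp_of_contDiff {T : ℝ → ℝ} (hT : ContDiff ℝ 1 T) {f : Euc d → ℝ}
    (hf : ContDiff ℝ 1 f) (x : Euc d) : ∇ (T ∘ f) x = deriv T (f x) • ∇ f x := by
  refine ext_inner_right ℝ fun e => ?_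
  rw [inner_gradient_eq_fderiv, inner_smul_left, inner_gradient_eq_fderiv,
    fderiv_comp x (hT.differentiable one_ne_zero _) (hf.differentiable one_ne_zero _)]
  simp [mul_comm]

theorem exists_smooth_approx_ae (hΩ : IsC1Domain Ω) (hp : 1 ≤ p) (hpt : p ≠ ⊤)
    (hw : MemW1 Ω p w) :
    ∃ φ : ℕ → Euc d → ℝ, (∀ n, ContDiff ℝ 1 (φ n)) ∧
      Tendsto (fun n => eLpNorm (φ n - w) 1 (volume.restrict Ω)) atTop (𝓝 0) ∧
      Tendsto (fun n => eLpNorm (∇ (φ n) - weakGrad Ω w) 1 (volume.restrict Ω)) atTop (𝓝 0) ∧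
      ∀ᵐ x ∂(volume.restrict Ω), Tendsto (fun n => φ n x) atTop (𝓝 (w x)) := by
  have : IsFiniteMeasure (volume.restrict Ω) :=
    isFiniteMeasure_restrict.2 hΩ.isBounded.measure_lt_top.ne
  obtain ⟨φ, hφ, h1, h2, -⟩ := hΩ.exists_smooth_approx hp hpt hw
  have d1 : ∀ n, ContDiff ℝ 1 (φ n) := fun n => (hφ n).of_le (by simp)
  have h1' := tendsto_eLpNorm_one hp
    (fun n => (d1 n).continuous.aestronglyMeasurable.sub hw.1.1) h1
  have h2' := tendsto_eLpNorm_one hp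
    (fun n => (continuous_gradient (d1 n)).aestronglyMeasurable.sub
      (hw.memLp_weakGrad hΩ.isOpen).1) h2
  obtain ⟨ns, hns, hae⟩ := (tendstoInMeasure_of_tendsto_eLpNorm one_ne_zero
    (fun n => (d1 n).continuous.aestronglyMeasurable) hw.1.1 h1').exists_seq_tendsto_ae
  exact ⟨fun n => φ (ns n), fun n => d1 _, h1'.comp hns.tendsto_atTop,
    h2'.comp hns.tendsto_atTop, hae⟩

theorem integrableOn_comp_of_deriv_le (hΩ : IsC1Domain Ω) (hw : IntegrableOn w Ω)
    {T : ℝ → ℝ} (hT : ContDiff ℝ 1 T) {L : ℝ} (hL : ∀ s, |deriv T s| ≤ L) :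
    IntegrableOn (T ∘ w) Ω := by
  have : IsFiniteMeasure (volume.restrict Ω) :=
    isFiniteMeasure_restrict.2 hΩ.isBounded.measure_lt_top.ne
  refine ((hw.norm.const_mul L).add (integrable_const |T 0|)).mono'
    (hT.continuous.comp_aestronglyMeasurable hw.1) (Eventually.of_forall fun x => ?_)
  have h := convex_univ.norm_image_sub_le_of_norm_deriv_le (f := T) (𝕜 := ℝ)
    (fun s _ => hT.differentiable one_ne_zero s) (fun s _ => hL s) (mem_univ 0) (mem_univ (w x))
  simp only [Real.norm_eq_abs, sub_zero, Function.comp_apply, Pi.add_apply] at h ⊢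
  have := abs_sub_abs_le_abs_sub (T (w x)) (T 0)
  linarith

/-- Apply the classical chain rule to smooth approximations and use that weak gradients are closed
in L¹. Only C¹ functions T are treated, which is why truncations are primitives of continuous ramps.
-/
theorem hasWeakGradient_comp (hΩ : IsC1Domain Ω) (hp : 1 ≤ p) (hpt : p ≠ ⊤)
    (hw : MemW1 Ω p w) {T : ℝ → ℝ} (hT : ContDiff ℝ 1 T) {L : ℝ} (hL : ∀ s, |deriv T s| ≤ L) :
    HasWeakGradient Ω (T ∘ w) fun x => deriv T (w x) • weakGrad Ω w x := by
  have : IsFiniteMeasure (volume.restrict Ω) :=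
    isFiniteMeasure_restrict.2 hΩ.isBounded.measure_lt_top.ne
  obtain ⟨φ, hφ, h1, h2, h3⟩ := exists_smooth_approx_ae hΩ hp hpt hw
  have hwI : IntegrableOn w Ω := memLp_one_iff_integrable.1 (hw.1.mono_exponent hp)
  have hvI : IntegrableOn (weakGrad Ω w) Ω :=
    memLp_one_iff_integrable.1 ((hw.memLp_weakGrad hΩ.isOpen).mono_exponent hp)
  have hL0 : 0 ≤ L := (abs_nonneg _).trans (hL 0)
  have hT' : Continuous (deriv T) := hT.continuous_deriv le_rfl
  have hφI : ∀ n, IntegrableOn (φ n) Ω := fun n =>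
    memLp_one_iff_integrable.1 (MemW1.of_contDiff hΩ.isBounded (hφ n)).1
  have hTφ : ∀ n, ContDiff ℝ 1 (T ∘ φ n) := fun n => hT.comp (hφ n)
  have hgI : ∀ n, IntegrableOn (∇ (T ∘ φ n)) Ω := fun n => by
    have h := MemW1.of_contDiff (p := 1) hΩ.isBounded (hTφ n)
    exact (memLp_one_iff_integrable.1 (h.memLp_weakGrad hΩ.isOpen)).congr
      (weakGrad_of_contDiff hΩ.isOpen (hTφ n))
  have hv₀ : AEStronglyMeasurable (fun x => deriv T (w x) • weakGrad Ω w x)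
      (volume.restrict Ω) := (hT'.comp_aestronglyMeasurable hwI.1).smul hvI.1
  have hv₀I : IntegrableOn (fun x => deriv T (w x) • weakGrad Ω w x) Ω := by
    refine (hvI.norm.const_mul L).mono' hv₀ (Eventually.of_forall fun x => ?_)
    rw [norm_smul]
    exact mul_le_mul_of_nonneg_right (hL _) (norm_nonneg _)
  refine HasWeakGradient.of_tendsto (fun n => HasWeakGradient.of_contDiff (hTφ n))
    (fun n => integrableOn_comp_of_deriv_le hΩ (hφI n) hT hL) hgI
    (integrableOn_comp_of_deriv_le hΩ hwI hT hL) hv₀I ?_ ?_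
  · have h0 : Tendsto (fun n => ENNReal.ofReal L * eLpNorm (φ n - w) 1 (volume.restrict Ω))
        atTop (𝓝 0) := by
      simpa using ENNReal.Tendsto.const_mul h1 (Or.inr ENNReal.ofReal_ne_top)
    refine tendsto_of_tendsto_of_tendsto_of_le_of_le tendsto_const_nhds h0 (fun _ => zero_le)
      fun n => eLpNorm_le_mul_eLpNorm_of_ae_le_mul (Eventually.of_forall fun x => ?_) 1
    exact convex_univ.norm_image_sub_le_of_norm_deriv_le (f := T) (𝕜 := ℝ)
      (fun s _ => hT.differentiable one_ne_zero s) (fun s _ => hL s) (mem_univ _) (mem_univ _)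
  -- The gradient error splits into T'(φ) times the error of the gradients, small in L¹, and (T'(φ)
  -- - T'(w))Dw, small by dominated convergence.
  · have h4 : Tendsto (fun n => ∫⁻ x in Ω, ‖(deriv T (φ n x) - deriv T (w x)) • weakGrad Ω w x‖ₑ)
        atTop (𝓝 (∫⁻ _ in Ω, 0)) := by
      refine tendsto_lintegral_of_dominated_convergence'
        (fun x => ENNReal.ofReal (2 * L) * ‖weakGrad Ω w x‖ₑ) (fun n => ?_) (fun n => ?_) ?_ ?_
      · exact (((hT'.comp (hφ n).continuous).aestronglyMeasurable.sub
          (hT'.comp_aestronglyMeasurable hwI.1)).smul hvI.1).enorm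
      · refine Eventually.of_forall fun x => ?_
        simp only [enorm_smul]
        refine mul_le_mul_left ?_ _
        rw [← ofReal_norm]
        refine ENNReal.ofReal_le_ofReal ((norm_sub_le _ _).trans ?_)
        have := hL (φ n x)
        have := hL (w x)
        simp only [Real.norm_eq_abs]
        linarith
      · rw [lintegral_const_mul' _ _ ENNReal.ofReal_ne_top]
        exact ENNReal.mul_ne_top ENNReal.ofReal_ne_top hvI.2.ne
      · filter_upwards [h3] with x hx
        have := ((((hT'.tendsto (w x)).comp hx).sub_const (deriv T (w x))).smul_const
          (weakGrad Ω w x)).enorm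
        simpa using this
    rw [lintegral_zero] at h4
    have h5 : Tendsto (fun n => ENNReal.ofReal L *
        eLpNorm (∇ (φ n) - weakGrad Ω w) 1 (volume.restrict Ω) +
        ∫⁻ x in Ω, ‖(deriv T (φ n x) - deriv T (w x)) • weakGrad Ω w x‖ₑ) atTop (𝓝 0) := by
      simpa using (ENNReal.Tendsto.const_mul h2 (Or.inr ENNReal.ofReal_ne_top)).add h4
    refine tendsto_of_tendsto_of_tendsto_of_le_of_le tendsto_const_nhds h5 (fun _ => zero_le)
      fun n => ?_
    simp only [eLpNorm_one_eq_lintegral_enorm]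
    rw [← lintegral_const_mul' _ _ ENNReal.ofReal_ne_top, ← lintegral_add_left'
      (((continuous_gradient (hφ n)).aestronglyMeasurable.sub hvI.1).enorm.const_mul _)]
    refine lintegral_mono fun x => ?_
    simp only [Pi.sub_apply, gradient_comp_of_contDiff hT (hφ n)]
    have e : deriv T (φ n x) • ∇ (φ n) x - deriv T (w x) • weakGrad Ω w x =
        deriv T (φ n x) • (∇ (φ n) x - weakGrad Ω w x) +
        (deriv T (φ n x) - deriv T (w x)) • weakGrad Ω w x := by
      rw [smul_sub, sub_smul]; abel
    rw [e]
    refine (enorm_add_le _ _).trans (add_le_add ?_ le_rfl)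
    rw [enorm_smul]
    refine mul_le_mul_left ?_ _
    rw [← ofReal_norm]
    exact ENNReal.ofReal_le_ofReal (hL _)

/-- The continuous ramp that increases from `0` to `1` between `k` and `k + ε`. -/
noncomputable def ramp (k ε s : ℝ) : ℝ := max 0 (min 1 ((s - k) / ε))

theorem continuous_ramp (k ε : ℝ) : Continuous (ramp k ε) := by
  unfold ramp; fun_prop

theorem ramp_mem_Icc (k ε s : ℝ) : ramp k ε s ∈ Icc (0 : ℝ) 1 :=
  ⟨le_max_left _ _, max_le zero_le_one (min_le_left _ _)⟩

theorem monotone_ramp (k : ℝ) {ε : ℝ} (hε : 0 < ε) : Monotone (ramp k ε) := fun s t hst => by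
  unfold ramp; gcongr

theorem ramp_of_le {k ε s : ℝ} (hε : 0 < ε) (hs : s ≤ k) : ramp k ε s = 0 :=
  max_eq_left ((min_le_right _ _).trans (div_nonpos_of_nonpos_of_nonneg (by linarith) hε.le))

theorem ramp_of_ge {k ε s : ℝ} (hε : 0 < ε) (hs : k + ε ≤ s) : ramp k ε s = 1 := by
  unfold ramp
  rw [min_eq_left ((one_le_div hε).2 (by linarith))]
  simp

theorem exists_primitive {τ : ℝ → ℝ} (hτ : Continuous τ) (k : ℝ) :
    ContDiff ℝ 1 (fun s => ∫ t in k..s, τ t) ∧ deriv (fun s => ∫ t in k..s, τ t) = τ := by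
  have h : ∀ s, HasDerivAt (fun s => ∫ t in k..s, τ t) (τ s) s := fun s =>
    hτ.integral_hasStrictDerivAt k s |>.hasDerivAt
  have h' : deriv (fun s => ∫ t in k..s, τ t) = τ := funext fun s => (h s).deriv
  refine ⟨contDiff_one_iff_deriv.2 ⟨fun s => (h s).differentiableAt, ?_⟩, h'⟩
  rwa [h']

theorem integral_ramp_of_le {k ε s : ℝ} (hε : 0 < ε) (hs : s ≤ k) :
    ∫ t in k..s, ramp k ε t = 0 := by
  rw [intervalIntegral.integral_congr (g := fun _ => 0)]
  · simp
  · intro t ht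
    rw [uIcc_of_ge hs] at ht
    exact ramp_of_le hε ht.2

theorem le_integral_ramp {k ε s : ℝ} (hε : 0 < ε) (hs : k + 2 * ε ≤ s) :
    ε ≤ ∫ t in k..s, ramp k ε t := by
  have hi : ∀ a b, IntervalIntegrable (ramp k ε) volume a b := fun a b =>
    (continuous_ramp k ε).intervalIntegrable a b
  rw [← intervalIntegral.integral_add_adjacent_intervals (hi k (k + ε)) (hi _ _),
    intervalIntegral.integral_congr (a := k + ε) (g := fun _ => 1)]
  · have : 0 ≤ ∫ t in k..(k + ε), ramp k ε t :=
      intervalIntegral.integral_nonneg (by linarith) fun t _ => (ramp_mem_Icc k ε t).1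
    simp
    linarith
  · intro t ht
    rw [uIcc_of_le (by linarith)] at ht
    exact ramp_of_ge hε ht.1

end Truncation

/-! ### Upper bounds by De Giorgi iteration. -/

section Boundedness

variable {d : ℕ} {Ω : Set (Euc d)} {p : ℝ≥0∞} {w : Euc d → ℝ}

/-- With ε = (h - k)/2 and T the primitive of the ramp from k to k + ε, T(w) is at least ε where w >
h and vanishes where w ≤ k. The small-support inequality bounds its integral by a multiple of ℓ ∫
τ(w)|Dw|, and the hypothesis replaces this by ℓ times the measure of {w > k}. -/
theorem exists_level_estimate (hΩ : IsC1Domain Ω) (hp : 1 ≤ p) (hpt : p ≠ ⊤)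
    (hw : MemW1 Ω p w) {C : ℝ≥0∞} (hC : C ≠ ⊤)
    (h : ∀ τ : ℝ → ℝ, Continuous τ → Monotone τ → (∀ s, τ s ∈ Icc (0 : ℝ) 1) →
      ∫⁻ x in Ω, ENNReal.ofReal (τ (w x)) * ‖weakGrad Ω w x‖ₑ ≤
        C * ∫⁻ x in Ω, ENNReal.ofReal (τ (w x))) :
    ∃ K > (0 : ℝ), ∃ κ > (0 : ℝ), ∀ ℓ ∈ Ioc (0 : ℝ) (1 / 2), ∀ k h : ℝ, k < h →
      (volume.restrict Ω).real {x | k < w x} ≤ κ * ℓ ^ d →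
      (h - k) / 2 * (volume.restrict Ω).real {x | h < w x} ≤
        K * ℓ * (volume.restrict Ω).real {x | k < w x} := by
  have : IsFiniteMeasure (volume.restrict Ω) :=
    isFiniteMeasure_restrict.2 hΩ.isBounded.measure_lt_top.ne
  obtain ⟨C', hC', κ, hκ, hS⟩ := hΩ.eLpNorm_le_of_small_support
  refine ⟨(C' * C).toReal + 1, by positivity, κ, hκ, fun ℓ hℓ k h' hkh hm => ?_⟩
  set ε := (h' - k) / 2 with hε'
  have hε : 0 < ε := by simp only [hε']; linarith
  obtain ⟨hT, hT'⟩ := exists_primitive (continuous_ramp k ε) k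
  set T : ℝ → ℝ := fun s => ∫ t in k..s, ramp k ε t with hTd
  have hL : ∀ s, |deriv T s| ≤ 1 := fun s => by
    rw [hT', abs_le]
    have := ramp_mem_Icc k ε s
    exact ⟨by linarith [this.1], this.2⟩
  have hwg := hasWeakGradient_comp hΩ hp hpt hw hT hL
  have hwI : IntegrableOn w Ω := memLp_one_iff_integrable.1 (hw.1.mono_exponent hp)
  have hvI : IntegrableOn (weakGrad Ω w) Ω :=
    memLp_one_iff_integrable.1 ((hw.memLp_weakGrad hΩ.isOpen).mono_exponent hp)
  have hTI := integrableOn_comp_of_deriv_le hΩ hwI hT hL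
  have hgI : IntegrableOn (fun x => deriv T (w x) • weakGrad Ω w x) Ω := by
    refine hvI.norm.mono' ((hT' ▸ (continuous_ramp k ε) : Continuous (deriv T)).comp_aestronglyMeasurable
      hwI.1 |>.smul hvI.1) (Eventually.of_forall fun x => ?_)
    rw [norm_smul]
    exact mul_le_of_le_one_left (norm_nonneg _) (hL _)
  have hTW : MemW1 Ω 1 (T ∘ w) :=
    hwg.memW1 (memLp_one_iff_integrable.2 hTI) (memLp_one_iff_integrable.2 hgI)
  set w' := hw.1.1.mk w with hw'
  have hww' : w =ᵐ[volume.restrict Ω] w' := hw.1.1.ae_eq_mk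
  have hw'm : Measurable w' := hw.1.1.stronglyMeasurable_mk.measurable
  have hlev : (volume.restrict Ω) {x | k < w x} = volume ({x | k < w' x} ∩ Ω) := by
    rw [← Measure.restrict_apply (measurableSet_lt measurable_const hw'm)]
    refine measure_congr ?_
    filter_upwards [hww'] with x hx
    refine propext ?_
    show k < w x ↔ k < w' x
    rw [hx]
  have hA : volume ({x | k < w' x} ∩ Ω) ≤ ENNReal.ofReal (κ * ℓ ^ d) := by
    rw [← hlev, ← ENNReal.ofReal_toReal (measure_ne_top (volume.restrict Ω) _)]
    exact ENNReal.ofReal_le_ofReal hm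
  have hTnn : ∀ s, k < s → 0 ≤ T s := fun s hs =>
    intervalIntegral.integral_nonneg hs.le fun t _ => (ramp_mem_Icc k ε t).1
  have key := hS ℓ hℓ _ ((measurableSet_lt measurable_const hw'm).inter hΩ.isOpen.measurableSet) hA
    (T ∘ w) hTW (by
      filter_upwards [hww', ae_restrict_mem hΩ.isOpen.measurableSet] with x hx hxΩ hxA
      refine integral_ramp_of_le hε (not_lt.1 fun hlt => hxA ⟨?_, hxΩ⟩)
      show k < w' x
      rwa [← hx])
  have e1 : eLpNorm (weakGrad Ω (T ∘ w)) 1 (volume.restrict Ω) =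
      ∫⁻ x in Ω, ENNReal.ofReal (ramp k ε (w x)) * ‖weakGrad Ω w x‖ₑ := by
    rw [eLpNorm_congr_ae (hwg.weakGrad_ae_eq hΩ.isOpen), eLpNorm_one_eq_lintegral_enorm]
    refine lintegral_congr fun x => ?_
    rw [enorm_smul, hT', Real.enorm_of_nonneg (ramp_mem_Icc k ε _).1]
  have e2 : ∫⁻ x in Ω, ENNReal.ofReal (ramp k ε (w x)) ≤ (volume.restrict Ω) {x | k < w x} := by
    have hnm : NullMeasurableSet {x | k < w x} (volume.restrict Ω) :=
      nullMeasurableSet_lt aemeasurable_const hwI.1.aemeasurable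
    rw [← lintegral_indicator_one₀ hnm]
    refine lintegral_mono fun x => ?_
    by_cases hx : k < w x
    · rw [indicator_of_mem (show x ∈ {x | k < w x} from hx)]
      simpa using (ramp_mem_Icc k ε (w x)).2
    · rw [ramp_of_le hε (not_lt.1 hx)]; simp
  have e3 : ENNReal.ofReal ε * (volume.restrict Ω) {x | h' < w x} ≤
      eLpNorm (T ∘ w) 1 (volume.restrict Ω) := by
    rw [eLpNorm_one_eq_lintegral_enorm]
    refine le_trans (mul_le_mul_right (measure_mono fun x (hx : h' < w x) => ?_) _)
      (mul_meas_ge_le_lintegral₀ hTI.1.enorm _)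
    have hx2 : ε ≤ T (w x) := le_integral_ramp hε (by simp only [hε']; linarith)
    show ENNReal.ofReal ε ≤ ‖T (w x)‖ₑ
    rw [Real.enorm_of_nonneg (hε.le.trans hx2)]
    exact ENNReal.ofReal_le_ofReal hx2
  have e4 : ENNReal.ofReal ε * (volume.restrict Ω) {x | h' < w x} ≤
      C' * (ENNReal.ofReal ℓ * (C * (volume.restrict Ω) {x | k < w x})) := by
    refine e3.trans (key.trans ?_)
    rw [e1]
    gcongr
    exact (h _ (continuous_ramp k ε) (monotone_ramp k hε) (ramp_mem_Icc k ε)).trans (by gcongr)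
  have e5 := ENNReal.toReal_mono (by finiteness) e4
  simp only [ENNReal.toReal_mul, ENNReal.toReal_ofReal hε.le, ENNReal.toReal_ofReal hℓ.1.le] at e5
  refine e5.trans ?_
  rw [ENNReal.toReal_mul]
  have h0 : 0 ≤ ℓ * (volume.restrict Ω).real {x | k < w x} :=
    mul_nonneg hℓ.1.le measureReal_nonneg
  simp only [Measure.real] at h0 ⊢
  nlinarith

/-- Let m(k) be the measure of {w > k}. The length ℓ is halved at each step while m decays by
2^{-(d+1)}, faster than the ℓ^d required; level increments proportional to ℓ are summable, so the
levels stay bounded. -/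
theorem exists_ae_le_of_truncation_bound (hΩ : IsC1Domain Ω) (hp : 1 ≤ p) (hpt : p ≠ ⊤)
    (hw : MemW1 Ω p w) {C : ℝ≥0∞} (hC : C ≠ ⊤)
    (h : ∀ τ : ℝ → ℝ, Continuous τ → Monotone τ → (∀ s, τ s ∈ Icc (0 : ℝ) 1) →
      ∫⁻ x in Ω, ENNReal.ofReal (τ (w x)) * ‖weakGrad Ω w x‖ₑ ≤
        C * ∫⁻ x in Ω, ENNReal.ofReal (τ (w x))) :
    ∃ M : ℝ, ∀ᵐ x ∂(volume.restrict Ω), w x ≤ M := by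
  have : IsFiniteMeasure (volume.restrict Ω) :=
    isFiniteMeasure_restrict.2 hΩ.isBounded.measure_lt_top.ne
  obtain ⟨K, hK, κ, hκ, hle⟩ := exists_level_estimate hΩ hp hpt hw hC h
  set m : ℝ → ℝ := fun k => (volume.restrict Ω).real {x | k < w x} with hm
  have hmono : Antitone m := fun a b hab =>
    measureReal_mono fun x (hx : b < w x) => lt_of_le_of_lt hab hx
  set q : ℝ := (1 / 2) ^ (d + 1) with hq
  have hq0 : 0 < q := by positivity
  obtain ⟨k₀, hk₀⟩ : ∃ k₀, m k₀ ≤ κ * q := by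
    have ht : Tendsto (fun n : ℕ => (volume.restrict Ω) {x | (n : ℝ) < w x}) atTop
        (𝓝 ((volume.restrict Ω) (⋂ n : ℕ, {x | (n : ℝ) < w x}))) :=
      tendsto_measure_iInter_atTop
        (fun n => nullMeasurableSet_lt aemeasurable_const hw.1.1.aemeasurable)
        (fun a b hab x (hx : (b : ℝ) < w x) => lt_of_le_of_lt (Nat.cast_le.2 hab) hx)
        ⟨0, measure_ne_top _ _⟩
    have he : ⋂ n : ℕ, {x | (n : ℝ) < w x} = ∅ := by
      refine eq_empty_of_forall_notMem fun x hx => ?_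
      obtain ⟨n, hn⟩ := exists_nat_gt (w x)
      exact lt_asymm hn (mem_iInter.1 hx n)
    rw [he, measure_empty] at ht
    have hpos : (0 : ℝ≥0∞) < ENNReal.ofReal (κ * q) := ENNReal.ofReal_pos.2 (by positivity)
    obtain ⟨n, hn⟩ := (ht.eventually_lt_const hpos).exists
    exact ⟨n, (ENNReal.toReal_mono ENNReal.ofReal_ne_top hn.le).trans_eq
      (ENNReal.toReal_ofReal (by positivity))⟩
  -- The increments are 2^{d+2}Kℓ with ℓ = 2^{-(n+1)}, so the level estimate yields exactly the
  -- factor 2^{-(d+1)} = q.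
  set k : ℕ → ℝ := fun n => k₀ + 2 ^ (d + 2) * K * (1 - (1 / 2) ^ n) with hk
  have hind : ∀ n, m (k n) ≤ κ * q ^ (n + 1) := by
    intro n
    induction n with
    | zero => simpa [hk] using hk₀
    | succ n ih =>
      set ℓ : ℝ := (1 / 2) ^ (n + 1) with hℓ
      have hℓ0 : 0 < ℓ := by positivity
      have hℓ1 : ℓ ≤ 1 / 2 := by
        rw [hℓ, pow_succ]
        exact mul_le_of_le_one_left (by norm_num) (pow_le_one₀ (by norm_num) (by norm_num))
      have hd : k (n + 1) - k n = 2 ^ (d + 2) * K * ℓ := by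
        simp only [hk, hℓ, pow_succ]; ring
      have h1 := hle ℓ ⟨hℓ0, hℓ1⟩ (k n) (k (n + 1)) (by
        have : 0 < 2 ^ (d + 2) * K * ℓ := by positivity
        linarith) (ih.trans (by
          refine mul_le_mul_of_nonneg_left ?_ hκ.le
          rw [hq, hℓ, ← pow_mul, ← pow_mul]
          exact pow_le_pow_of_le_one (by norm_num) (by norm_num) (by nlinarith)))
      rw [hd] at h1
      have h2 : m (k (n + 1)) ≤ q * m (k n) := by
        have e : 2 ^ (d + 2) * K * ℓ / 2 * m (k (n + 1)) = K * ℓ * (2 ^ (d + 1) * m (k (n + 1))) := by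
          ring
        rw [e] at h1
        have h3 := le_of_mul_le_mul_left h1 (by positivity : 0 < K * ℓ)
        have h4 := mul_le_mul_of_nonneg_left h3 hq0.le
        rwa [← mul_assoc, hq, ← mul_pow, one_div, inv_mul_cancel₀ two_ne_zero, one_pow, one_mul,
          ← one_div, ← hq] at h4
      refine h2.trans ((mul_le_mul_of_nonneg_left ih hq0.le).trans_eq ?_)
      ring
  refine ⟨k₀ + 2 ^ (d + 2) * K, ?_⟩
  -- The limiting level lies above every k n.
  have hle0 : ∀ n : ℕ, m (k₀ + 2 ^ (d + 2) * K) ≤ κ * q ^ (n + 1) := fun n => by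
    refine (hmono ?_).trans (hind n)
    have : 0 < 2 ^ (d + 2) * K * (1 / 2) ^ n := by positivity
    simp only [hk]; linarith
  have hlim : Tendsto (fun n : ℕ => κ * q ^ (n + 1)) atTop (𝓝 0) := by
    have hq1 : q < 1 := pow_lt_one₀ (by norm_num) (by norm_num) (by simp)
    simpa using ((tendsto_pow_atTop_nhds_zero_of_lt_one hq0.le hq1).comp
      (tendsto_add_atTop_nat 1)).const_mul κ
  have hz : m (k₀ + 2 ^ (d + 2) * K) = 0 :=
    le_antisymm (ge_of_tendsto' hlim hle0) measureReal_nonneg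
  rw [measureReal_eq_zero_iff] at hz
  rw [ae_iff]
  simpa using hz

end Boundedness

/-! ### The integrand -/

section Integrand

variable {d : ℕ} {Ω : Set (Euc d)}

theorem MeasureTheory.MemLp.integrable_norm_rpow_ofReal {α E : Type*} [MeasurableSpace α]
    [NormedAddCommGroup E] {μ : Measure α} {p : ℝ} (hp : 1 < p) {f : α → E}
    (hf : MemLp f (ENNReal.ofReal p) μ) : Integrable (fun x => ‖f x‖ ^ p) μ := by
  have hp0 : 0 < p := by linarith
  have := hf.integrable_norm_rpow (by simpa using hp0) ENNReal.ofReal_ne_top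
  rwa [ENNReal.toReal_ofReal hp0.le] at this

/-- An integrand `F x q` that is jointly continuous, convex in `q` and of growth `|q|^p`. -/
structure IsConvexIntegrand (Ω : Set (Euc d)) (p : ℝ) (F : Euc d → Euc d → ℝ) : Prop where
  continuousOn : ContinuousOn (fun z : Euc d × Euc d => F z.1 z.2) (Ω ×ˢ univ)
  convexOn : ∀ x ∈ Ω, ConvexOn ℝ univ (F x)
  le_growth : ∃ C > (0 : ℝ), ∀ x ∈ Ω, ∀ q, F x q ≤ C * (‖q‖ ^ p + 1)
  growth_le : ∃ a > (0 : ℝ), ∃ b > (0 : ℝ), ∀ x ∈ Ω, ∀ q, a * ‖q‖ ^ p - b ≤ F x q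

/-- Monotonicity of G serves three times: for convexity of the composition and to insert the upper
and lower bounds of H. The bounds on G hold only for large arguments, so the constants must push the
argument past z₀. -/
theorem HamiltonianAssumption.isConvexIntegrand {α β : ℝ} {G : ℝ → ℝ} (hG : EnergyAssumption α G)
    {H : Euc d → Euc d → ℝ} (hH : HamiltonianAssumption Ω β H) :
    IsConvexIntegrand Ω (α * β) fun x q => G (H x q) where
  continuousOn := hG.contDiff.continuous.comp_continuousOn
    (hH.contDiffOn.continuousOn.mono (prod_mono subset_closure Subset.rfl))
  convexOn := fun x hx => by
    refine ⟨convex_univ, fun q _ q' _ s t hs ht hst => ?_⟩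
    exact (hG.monotone ((hH.strictConvex x hx).convexOn.2 (mem_univ q) (mem_univ q') hs ht
      hst)).trans (hG.convex.2 (mem_univ _) (mem_univ _) hs ht hst)
  le_growth := by
    have hα := hG.one_lt
    have hβ := hH.one_lt
    obtain ⟨C₁, hC₁, h1⟩ := hG.growth
    obtain ⟨z₀, hz₀⟩ := eventually_atTop.1 h1
    obtain ⟨C, hC, h⟩ := hH.growth
    -- Enlarged so that A(|q|^β + 1) is at least z₀.
    set A := C + |z₀| with hA
    have hA0 : 0 < A := by positivity
    refine ⟨C₁ * (A ^ α * 2 ^ (α - 1) + 1), by positivity, fun x hx q => ?_⟩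
    have hq : 0 ≤ ‖q‖ ^ β := by positivity
    have hz : z₀ ≤ A * (‖q‖ ^ β + 1) := by
      have := le_abs_self z₀
      nlinarith [abs_nonneg z₀]
    have hH' : H x q ≤ A * (‖q‖ ^ β + 1) := by
      refine (h x hx q).2.1.trans (mul_le_mul_of_nonneg_right ?_ (by positivity))
      simp [hA]
    refine (hG.monotone hH').trans ((hz₀ _ hz).2.1.trans ?_)
    rw [mul_assoc C₁]
    refine mul_le_mul_of_nonneg_left ?_ hC₁.le
    rw [abs_of_nonneg (by positivity), Real.mul_rpow hA0.le (by positivity)]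
    have h2 : (‖q‖ ^ β + 1) ^ α ≤ 2 ^ (α - 1) * ((‖q‖ ^ β) ^ α + 1 ^ α) := by
      generalize ‖q‖ ^ β = s at hq
      lift s to NNReal using hq
      exact_mod_cast NNReal.rpow_add_le_mul_rpow_add_rpow s 1 hα.le
    have h3 : (‖q‖ ^ β) ^ α = ‖q‖ ^ (α * β) := by
      rw [← Real.rpow_mul (norm_nonneg _), mul_comm]
    rw [h3, Real.one_rpow] at h2
    have hA' : 0 ≤ A ^ α := by positivity
    have := mul_le_mul_of_nonneg_left h2 hA'
    have : 0 ≤ ‖q‖ ^ (α * β) := by positivity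
    nlinarith
  growth_le := by
    have hα := hG.one_lt
    have hβ := hH.one_lt
    obtain ⟨C₁, hC₁, h1⟩ := hG.growth
    obtain ⟨z₀, hz₀⟩ := eventually_atTop.1 h1
    obtain ⟨C, hC, h⟩ := hH.growth
    obtain ⟨c, hc⟩ := hH.bddBelow
    -- Above this threshold for |q|^β half of the leading term absorbs the constant in the bound for
    -- H, giving H ≥ |q|^β/(2C) ≥ z₀. Below it, H ≥ c and monotonicity suffice.
    set R := 2 * C * (C + |z₀|) with hR
    have hR0 : 0 < R := by positivity
    refine ⟨(1 / (2 * C)) ^ α / C₁, by positivity,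
      C₁ + |G c| + (1 / (2 * C)) ^ α / C₁ * R ^ α, by positivity, fun x hx q => ?_⟩
    have h3 : ‖q‖ ^ (α * β) = (‖q‖ ^ β) ^ α := by
      rw [← Real.rpow_mul (norm_nonneg _), mul_comm]
    rw [h3]
    have hq : 0 ≤ ‖q‖ ^ β := by positivity
    set a := (1 / (2 * C)) ^ α / C₁ with ha
    have ha0 : 0 < a := by positivity
    rcases le_total (‖q‖ ^ β) R with hle | hle
    · have h4 : G c ≤ G (H x q) := hG.monotone (hc x (subset_closure hx) q)
      have h5 : a * (‖q‖ ^ β) ^ α ≤ a * R ^ α := by gcongr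
      linarith [neg_abs_le (G c)]
    · have h6 : C + |z₀| ≤ 1 / (2 * C) * ‖q‖ ^ β := by
        rw [div_mul_eq_mul_div, one_mul, le_div_iff₀ (by positivity)]
        linarith
      have h7 : 1 / (2 * C) * ‖q‖ ^ β ≤ H x q := by
        refine le_trans ?_ (h x hx q).1
        have e : ‖q‖ ^ β / C = 1 / (2 * C) * ‖q‖ ^ β + 1 / (2 * C) * ‖q‖ ^ β := by
          field_simp; norm_num
        rw [e]
        linarith [abs_nonneg z₀]
      have h8 := (hz₀ _ (show z₀ ≤ 1 / (2 * C) * ‖q‖ ^ β by linarith [le_abs_self z₀])).1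
      rw [abs_of_nonneg (by positivity), Real.mul_rpow (by positivity) hq] at h8
      have h9 : a * (‖q‖ ^ β) ^ α = (1 / (2 * C)) ^ α * (‖q‖ ^ β) ^ α / C₁ := by
        rw [ha]; ring
      rw [h9]
      have : 0 ≤ a * R ^ α := by positivity
      linarith [hG.monotone h7, abs_nonneg (G c)]

namespace IsConvexIntegrand

variable {p : ℝ} {F : Euc d → Euc d → ℝ} {v v' : Euc d → Euc d}

theorem aestronglyMeasurable (hF : IsConvexIntegrand Ω p F) (hΩ : IsOpen Ω)
    (hv : AEStronglyMeasurable v (volume.restrict Ω)) :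
    AEStronglyMeasurable (fun x => F x (v x)) (volume.restrict Ω) := by
  classical
  have hm : Measurable ((Ω ×ˢ univ).piecewise (fun z : Euc d × Euc d => F z.1 z.2) 0) :=
    hF.continuousOn.measurable_piecewise continuousOn_const
      (hΩ.measurableSet.prod MeasurableSet.univ)
  have h := (hm.comp_aemeasurable (aemeasurable_id.prodMk hv.aemeasurable)).aestronglyMeasurable
  refine h.congr ?_
  filter_upwards [ae_restrict_mem hΩ.measurableSet] with x hx
  simp [hx]

theorem integrableOn (hF : IsConvexIntegrand Ω p F) (hΩ : IsOpen Ω) (hb : Bornology.IsBounded Ω)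
    (hp : 1 < p) (hv : MemLp v (ENNReal.ofReal p) (volume.restrict Ω)) :
    IntegrableOn (fun x => F x (v x)) Ω := by
  have : IsFiniteMeasure (volume.restrict Ω) := isFiniteMeasure_restrict.2 hb.measure_lt_top.ne
  obtain ⟨C, hC, h1⟩ := hF.le_growth
  obtain ⟨a, ha, b, hb0, h2⟩ := hF.growth_le
  have hi : IntegrableOn (fun x => ‖v x‖ ^ p) Ω := hv.integrable_norm_rpow_ofReal hp
  refine (((hi.add (integrable_const 1)).const_mul C).add (integrable_const b)).mono'
    (hF.aestronglyMeasurable hΩ hv.1) ?_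
  filter_upwards [ae_restrict_mem hΩ.measurableSet] with x hx
  have h0 : 0 ≤ ‖v x‖ ^ p := by positivity
  have := h1 x hx (v x)
  have := h2 x hx (v x)
  have := mul_nonneg ha.le h0
  have := mul_nonneg hC.le h0
  simp only [Pi.add_apply, Real.norm_eq_abs, abs_le]
  constructor <;> linarith

theorem integral_midpoint_le (hF : IsConvexIntegrand Ω p F) (hΩ : IsOpen Ω)
    (hb : Bornology.IsBounded Ω) (hp : 1 < p)
    (hv : MemLp v (ENNReal.ofReal p) (volume.restrict Ω))
    (hv' : MemLp v' (ENNReal.ofReal p) (volume.restrict Ω)) :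
    ∫ x in Ω, F x ((1 / 2 : ℝ) • (v x + v' x)) ≤
      ((∫ x in Ω, F x (v x)) + ∫ x in Ω, F x (v' x)) / 2 := by
  have i1 := hF.integrableOn hΩ hb hp hv
  have i2 := hF.integrableOn hΩ hb hp hv'
  rw [← integral_add i1 i2, ← integral_div]
  refine setIntegral_mono_on (hF.integrableOn hΩ hb hp ((hv.add hv').const_smul (1 / 2 : ℝ)))
    ((i1.add i2).div_const _) hΩ.measurableSet fun x hx => ?_
  have := (hF.convexOn x hx).2 (mem_univ (v x)) (mem_univ (v' x)) (by norm_num : (0 : ℝ) ≤ 1 / 2)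
    (by norm_num : (0 : ℝ) ≤ 1 / 2) (by norm_num)
  rw [← smul_add, ← smul_add, smul_eq_mul] at this
  linarith

/-- Fatou's lemma for F + b ≥ 0 along an almost everywhere convergent subsequence. Strong
convergence makes continuity of F enough; convexity is not needed here. -/
theorem integral_le_of_tendsto (hF : IsConvexIntegrand Ω p F) (hΩ : IsOpen Ω)
    (hb : Bornology.IsBounded Ω) (hp : 1 < p) {v : ℕ → Euc d → Euc d} {v₀ : Euc d → Euc d}
    (hv : ∀ n, MemLp (v n) (ENNReal.ofReal p) (volume.restrict Ω))
    (hv₀ : MemLp v₀ (ENNReal.ofReal p) (volume.restrict Ω))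
    (ht : Tendsto (fun n => eLpNorm (v n - v₀) (ENNReal.ofReal p) (volume.restrict Ω)) atTop (𝓝 0))
    {r : ℝ} (hr : ∀ ε > (0 : ℝ), ∀ᶠ n in atTop, ∫ x in Ω, F x (v n x) ≤ r + ε) :
    ∫ x in Ω, F x (v₀ x) ≤ r := by
  have : IsFiniteMeasure (volume.restrict Ω) := isFiniteMeasure_restrict.2 hb.measure_lt_top.ne
  obtain ⟨a, ha, b, hb0, h2⟩ := hF.growth_le
  have hi : ∀ u, MemLp u (ENNReal.ofReal p) (volume.restrict Ω) →
      IntegrableOn (fun x => F x (u x)) Ω := fun u hu => hF.integrableOn hΩ hb hp hu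
  obtain ⟨ns, hns, hae⟩ := (tendstoInMeasure_of_tendsto_eLpNorm (by simp; linarith)
    (fun n => (hv n).1) hv₀.1 ht).exists_seq_tendsto_ae
  set V := ∫ _ in Ω, b with hV
  have hnn : ∀ x ∈ Ω, ∀ q, 0 ≤ F x q + b := fun x hx q => by
    have := h2 x hx q
    have : 0 ≤ a * ‖q‖ ^ p := by positivity
    linarith
  have hlin : ∀ u, MemLp u (ENNReal.ofReal p) (volume.restrict Ω) →
      ∫⁻ x in Ω, ENNReal.ofReal (F x (u x) + b) = ENNReal.ofReal ((∫ x in Ω, F x (u x)) + V) :=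
    fun u hu => by
      rw [hV, ← integral_add (hi u hu) (integrable_const b)]
      refine (ofReal_integral_eq_lintegral_ofReal ((hi u hu).add (integrable_const b)) ?_).symm
      filter_upwards [ae_restrict_mem hΩ.measurableSet] with x hx
      exact hnn x hx _
  refine le_of_forall_pos_le_add fun ε hε => ?_
  have hfat : ENNReal.ofReal ((∫ x in Ω, F x (v₀ x)) + V) ≤ ENNReal.ofReal (r + ε + V) := by
    rw [← hlin v₀ hv₀]
    calc ∫⁻ x in Ω, ENNReal.ofReal (F x (v₀ x) + b)
        = ∫⁻ x in Ω, liminf (fun n => ENNReal.ofReal (F x (v (ns n) x) + b)) atTop := by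
          refine lintegral_congr_ae ?_
          filter_upwards [hae, ae_restrict_mem hΩ.measurableSet] with x hx hxΩ
          refine (Tendsto.liminf_eq ?_).symm
          refine (ENNReal.continuous_ofReal.tendsto _).comp (Tendsto.add_const b ?_)
          have hc : ContinuousAt (fun z : Euc d × Euc d => F z.1 z.2) (x, v₀ x) :=
            hF.continuousOn.continuousAt ((hΩ.prod isOpen_univ).mem_nhds ⟨hxΩ, mem_univ _⟩)
          exact hc.tendsto.comp (tendsto_const_nhds.prodMk_nhds hx)
      _ ≤ liminf (fun n => ∫⁻ x in Ω, ENNReal.ofReal (F x (v (ns n) x) + b)) atTop :=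
          lintegral_liminf_le' fun n =>
            ((hF.aestronglyMeasurable hΩ (hv _).1).aemeasurable.add_const b).ennreal_ofReal
      _ ≤ ENNReal.ofReal (r + ε + V) := by
          refine liminf_le_of_frequently_le' (Eventually.frequently ?_)
          filter_upwards [hns.tendsto_atTop.eventually (hr ε hε)] with n hn
          rw [hlin _ (hv _)]
          exact ENNReal.ofReal_le_ofReal (by linarith)
  by_contra! hlt
  have h0 : 0 ≤ (∫ x in Ω, F x (v₀ x)) + V := by
    rw [hV, ← integral_add (hi _ hv₀) (integrable_const b)]
    exact setIntegral_nonneg hΩ.measurableSet fun x hx => hnn x hx _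
  -- `ENNReal.ofReal` discards negative values, so if the left side is zero, the non-negativity of r
  -- + ε + V is read off from one of the `v n`.
  rcases h0.eq_or_lt with h0 | h0
  · have hn0 : ∃ n, ∫ x in Ω, F x (v n x) ≤ r + ε := (hr ε hε).exists
    obtain ⟨n, hn⟩ := hn0
    have h1 : 0 ≤ (∫ x in Ω, F x (v n x)) + V := by
      rw [hV, ← integral_add (hi _ (hv n)) (integrable_const b)]
      exact setIntegral_nonneg hΩ.measurableSet fun x hx => hnn x hx _
    linarith
  · exact absurd hfat (not_le.2 ((ENNReal.ofReal_lt_ofReal_iff h0).2 (by linarith)))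

end IsConvexIntegrand

end Integrand

/-! ### The direct method -/

section Minimization

variable {d : ℕ} {Ω : Set (Euc d)}

theorem integral_norm_half_smul_add_rpow_le {α E : Type*} [MeasurableSpace α]
    [NormedAddCommGroup E] [InnerProductSpace ℝ E] {μ : Measure α} {p : ℝ} (hp : 1 < p) {f g : α → E}
    (hf : MemLp f (ENNReal.ofReal p) μ) (hg : MemLp g (ENNReal.ofReal p) μ) :
    ∫ x, ‖(1 / 2 : ℝ) • (f x + g x)‖ ^ p ∂μ ≤ (∫ x, ‖f x‖ ^ p ∂μ + ∫ x, ‖g x‖ ^ p ∂μ) / 2 := by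
  have i1 := hf.integrable_norm_rpow_ofReal hp
  have i2 := hg.integrable_norm_rpow_ofReal hp
  have hm : MemLp (fun x => (1 / 2 : ℝ) • (f x + g x)) (ENNReal.ofReal p) μ :=
    (hf.add hg).const_smul _
  have i3 := hm.integrable_norm_rpow_ofReal hp
  have i4 : Integrable (fun x => (‖f x‖ ^ p + ‖g x‖ ^ p) / 2) μ := (i1.add i2).div_const _
  have h := integral_mono i3 i4 fun x => norm_half_smul_add_rpow_le hp.le (f x) (g x)
  rwa [integral_div, integral_add i1 i2] at h

theorem weakGrad_half_smul_add (hΩ : IsOpen Ω) {p : ℝ≥0∞} {w w' : Euc d → ℝ} (hw : MemW1 Ω p w)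
    (hw' : MemW1 Ω p w') : weakGrad Ω ((1 / 2 : ℝ) • (w + w')) =ᵐ[volume.restrict Ω]
      fun x => (1 / 2 : ℝ) • (weakGrad Ω w x + weakGrad Ω w' x) := by
  filter_upwards [(hw.add hw').weakGrad_const_smul hΩ (1 / 2), hw.weakGrad_add hΩ hw'] with x h1 h2
  rw [h1, Pi.smul_apply, h2, Pi.add_apply]

/-- A minimizing sequence is selected that also almost minimizes Φ, the sum of the p-th powers of
the norms of w and Dw, on each sublevel set. Midpoints stay in the sublevel set, so their Φ cannot
be much smaller; uniform convexity then forces strong convergence. -/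
theorem exists_minimizer (hΩ : IsOpen Ω) (hb : Bornology.IsBounded Ω) {p : ℝ} (hp : 1 < p)
    {D : Set (Euc d → ℝ)} {J : (Euc d → ℝ) → ℝ} (hD : ∀ w ∈ D, MemW1 Ω (ENNReal.ofReal p) w)
    (hne : D.Nonempty)
    (hmid : ∀ w ∈ D, ∀ w' ∈ D, (1 / 2 : ℝ) • (w + w') ∈ D ∧
      J ((1 / 2 : ℝ) • (w + w')) ≤ (J w + J w') / 2)
    (hcl : ∀ w : ℕ → Euc d → ℝ, (∀ n, w n ∈ D) → ∀ w₀, MemW1 Ω (ENNReal.ofReal p) w₀ →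
      Tendsto (fun n => eLpNorm (w n - w₀) (ENNReal.ofReal p) (volume.restrict Ω)) atTop (𝓝 0) →
      Tendsto (fun n => eLpNorm (weakGrad Ω (w n) - weakGrad Ω w₀) (ENNReal.ofReal p)
        (volume.restrict Ω)) atTop (𝓝 0) →
      w₀ ∈ D ∧ ∀ r : ℝ, (∀ ε > 0, ∀ᶠ n in atTop, J (w n) ≤ r + ε) → J w₀ ≤ r)
    (hbd : BddBelow (J '' D))
    (hco : ∀ r : ℝ, ∃ R : ℝ, ∀ w ∈ D, J w ≤ r →
      (∫ x in Ω, ‖w x‖ ^ p) + ∫ x in Ω, ‖weakGrad Ω w x‖ ^ p ≤ R) :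
    ∃ u ∈ D, ∀ w ∈ D, J u ≤ J w := by
  have hp1 : 1 ≤ ENNReal.ofReal p := by simpa using hp.le
  have : IsFiniteMeasure (volume.restrict Ω) := isFiniteMeasure_restrict.2 hb.measure_lt_top.ne
  set m := sInf (J '' D) with hm
  have hmle : ∀ w ∈ D, m ≤ J w := fun w hw => csInf_le hbd (mem_image_of_mem J hw)
  set Φ : (Euc d → ℝ) → ℝ := fun w =>
    (∫ x in Ω, ‖w x‖ ^ p) + ∫ x in Ω, ‖weakGrad Ω w x‖ ^ p with hΦ
  have hΦ0 : ∀ w, 0 ≤ Φ w := fun w => add_nonneg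
    (integral_nonneg fun _ => by positivity) (integral_nonneg fun _ => by positivity)
  set K : ℕ → Set (Euc d → ℝ) := fun n => {w | w ∈ D ∧ J w ≤ m + 1 / (n + 1)} with hK
  have hKne : ∀ n, (K n).Nonempty := fun n => by
    obtain ⟨_, ⟨w, hw, rfl⟩, hlt⟩ := exists_lt_of_csInf_lt (hne.image J)
      (lt_add_of_pos_right m (Nat.one_div_pos_of_nat (α := ℝ) (n := n)))
    exact ⟨w, hw, hlt.le⟩
  have hKanti : ∀ {n k : ℕ}, n ≤ k → K k ⊆ K n := fun hnk w hw =>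
    ⟨hw.1, hw.2.trans (by gcongr)⟩
  have hKmid : ∀ n, ∀ w ∈ K n, ∀ w' ∈ K n, (1 / 2 : ℝ) • (w + w') ∈ K n := fun n w hw w' hw' =>
    ⟨(hmid w hw.1 w' hw'.1).1, (hmid w hw.1 w' hw'.1).2.trans (by linarith [hw.2, hw'.2])⟩
  set s : ℕ → ℝ := fun n => sInf (Φ '' K n) with hs
  have hsbd : ∀ n, BddBelow (Φ '' K n) := fun n => ⟨0, by rintro _ ⟨w, -, rfl⟩; exact hΦ0 w⟩
  have hsle : ∀ n, ∀ w ∈ K n, s n ≤ Φ w := fun n w hw =>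
    csInf_le (hsbd n) (mem_image_of_mem Φ hw)
  have hsm : Monotone s := fun n k hnk =>
    csInf_le_csInf (hsbd n) ((hKne k).image Φ) (image_mono (hKanti hnk))
  obtain ⟨R, hR⟩ := hco (m + 1)
  have hKR : ∀ n, ∀ w ∈ K n, Φ w ≤ R := fun n w hw => hR w hw.1 (hw.2.trans (by
    gcongr
    rw [div_le_one (by positivity)]
    linarith [Nat.cast_nonneg (α := ℝ) n]))
  have hsR : BddAbove (range s) := ⟨R, by
    rintro _ ⟨n, rfl⟩
    obtain ⟨w, hw⟩ := hKne n
    exact (hsle n w hw).trans (hKR n w hw)⟩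
  have hslim := tendsto_atTop_ciSup hsm hsR
  set S := ⨆ n, s n with hS
  have hsS : ∀ n, s n ≤ S := fun n => le_ciSup hsR n
  have hw : ∀ n, ∃ w ∈ K n, Φ w < s n + 1 / (n + 1) := fun n => by
    obtain ⟨_, ⟨w, hw, rfl⟩, hlt⟩ := exists_lt_of_csInf_lt ((hKne n).image Φ)
      (lt_add_of_pos_right (s n) (Nat.one_div_pos_of_nat (α := ℝ) (n := n)))
    exact ⟨w, hw, hlt⟩
  choose w hwK hwΦ using hw
  have hwW : ∀ n, MemW1 Ω (ENNReal.ofReal p) (w n) := fun n => hD _ (hwK n).1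
  have hvW : ∀ n, MemLp (weakGrad Ω (w n)) (ENNReal.ofReal p) (volume.restrict Ω) := fun n =>
    (hwW n).memLp_weakGrad hΩ
  have hdef : ∀ δ > (0 : ℝ), ∃ N, ∀ n ≥ N, ∀ k ≥ N,
      (Φ (w n) + Φ (w k)) / 2 - Φ ((1 / 2 : ℝ) • (w n + w k)) ≤ δ := by
    intro δ hδ
    have h1 : ∀ᶠ n in atTop, S - s n + 1 / ((n : ℝ) + 1) < δ := by
      have := (hslim.const_sub S).add (tendsto_one_div_add_atTop_nhds_zero_nat (𝕜 := ℝ))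
      rw [sub_self, add_zero] at this
      exact this.eventually_lt_const hδ
    obtain ⟨N, hN⟩ := h1.exists
    refine ⟨N, fun n hn k hk => ?_⟩
    -- The midpoint lies in K N, so its Φ is at least s N, while both ends have Φ at most S +
    -- 1/(N+1) and s N → S.
    have a1 := hsle N _ (hKmid N _ (hKanti hn (hwK n)) _ (hKanti hk (hwK k)))
    have a2 : ∀ n ≥ N, Φ (w n) ≤ S + 1 / ((N : ℝ) + 1) := fun n hn =>
      (hwΦ n).le.trans (add_le_add (hsS n) (Nat.one_div_le_one_div hn))
    linarith [a2 n hn, a2 k hk]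
  have hgm : ∀ n k, ∫ x in Ω, ‖weakGrad Ω ((1 / 2 : ℝ) • (w n + w k)) x‖ ^ p =
      ∫ x in Ω, ‖(1 / 2 : ℝ) • (weakGrad Ω (w n) x + weakGrad Ω (w k) x)‖ ^ p := fun n k => by
    refine integral_congr_ae ?_
    filter_upwards [weakGrad_half_smul_add hΩ (hwW n) (hwW k)] with x hx
    rw [hx]
  have hc1 := fun n k => integral_norm_half_smul_add_rpow_le hp (hwW n).1 (hwW k).1
  have hc2 := fun n k => integral_norm_half_smul_add_rpow_le hp (hvW n) (hvW k)
  obtain ⟨w₀, hw₀, ht⟩ := exists_tendsto_of_midpoint_defect hp (fun n => (hwW n).1) (R := R)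
    (fun n => le_trans (le_add_of_nonneg_right (integral_nonneg fun _ => by positivity))
      (hKR n _ (hwK n))) fun δ hδ => by
    obtain ⟨N, hN⟩ := hdef δ hδ
    refine ⟨N, fun n hn k hk => ?_⟩
    have := hN n hn k hk
    -- Both parts of Φ have a non-negative midpoint defect, so each is bounded by the total defect.
    have := hc2 n k
    simp only [hΦ, hgm, Pi.smul_apply, Pi.add_apply] at *
    linarith
  obtain ⟨v₀, hv₀, ht'⟩ := exists_tendsto_of_midpoint_defect hp hvW (R := R)
    (fun n => le_trans (le_add_of_nonneg_left (integral_nonneg fun _ => by positivity))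
      (hKR n _ (hwK n))) fun δ hδ => by
    obtain ⟨N, hN⟩ := hdef δ hδ
    refine ⟨N, fun n hn k hk => ?_⟩
    have := hN n hn k hk
    have := hc1 n k
    simp only [hΦ, hgm, Pi.smul_apply, Pi.add_apply] at *
    linarith
  have hi : ∀ {E : Type} [NormedAddCommGroup E] {f : Euc d → E},
      MemLp f (ENNReal.ofReal p) (volume.restrict Ω) → IntegrableOn f Ω := fun hf =>
    memLp_one_iff_integrable.1 (hf.mono_exponent hp1)
  have hwg : HasWeakGradient Ω w₀ v₀ := HasWeakGradient.of_tendsto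
    (fun n => (hwW n).hasWeakGradient) (fun n => hi (hwW n).1) (fun n => hi (hvW n)) (hi hw₀)
    (hi hv₀) (tendsto_eLpNorm_one hp1 (fun n => (hwW n).1.1.sub hw₀.1) ht)
    (tendsto_eLpNorm_one hp1 (fun n => (hvW n).1.sub hv₀.1) ht')
  have hlim : Tendsto (fun n => eLpNorm (weakGrad Ω (w n) - weakGrad Ω w₀) (ENNReal.ofReal p)
      (volume.restrict Ω)) atTop (𝓝 0) := by
    refine ht'.congr fun n => eLpNorm_congr_ae ?_
    filter_upwards [hwg.weakGrad_ae_eq hΩ] with x hx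
    simp [hx]
  obtain ⟨h1, h2⟩ := hcl w (fun n => (hwK n).1) w₀ (hwg.memW1 hw₀ hv₀) ht hlim
  refine ⟨w₀, h1, fun w' hw' => (h2 m fun ε hε => ?_).trans (hmle w' hw')⟩
  filter_upwards [(tendsto_one_div_add_atTop_nhds_zero_nat (𝕜 := ℝ)).eventually_lt_const hε]
    with n hn
  linarith [(hwK n).2]

end Minimization

/-! ### Coercivity -/

section Coercivity

variable {d : ℕ} {Ω : Set (Euc d)} {p : ℝ}

theorem integral_norm_rpow_eq_lpNorm {α E : Type*} [MeasurableSpace α] [NormedAddCommGroup E]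
    {μ : Measure α} (hp : 1 < p) {f : α → E} (hf : AEStronglyMeasurable f μ) :
    ∫ x, ‖f x‖ ^ p ∂μ = lpNorm f (ENNReal.ofReal p) μ ^ p := by
  have hp0 : 0 < p := by linarith
  rw [lpNorm_eq_integral_norm_rpow_toReal (by simpa using hp0) ENNReal.ofReal_ne_top hf,
    ENNReal.toReal_ofReal hp0.le, Real.rpow_inv_rpow (integral_nonneg fun _ => by positivity)
    hp0.ne']

/-- Hölder's inequality together with the inclusion of L^p in L^q on a finite measure space. It
covers the Neumann term (q = β) and plain integrals (j = 1, q = 1). -/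
theorem exists_integral_mul_le {α : Type*} [MeasurableSpace α] {μ : Measure α} [IsFiniteMeasure μ]
    {p q r : ℝ≥0∞} (hqp : q ≤ p) [ENNReal.HolderTriple r q 1] {j : α → ℝ} (hj : MemLp j r μ) :
    ∃ K : ℝ, 0 ≤ K ∧ ∀ f : α → ℝ, MemLp f p μ → Integrable (fun x => j x * f x) μ ∧
      |∫ x, j x * f x ∂μ| ≤ K * lpNorm f p μ := by
  rcases eq_or_ne q 0 with rfl | hq0
  · have h := ENNReal.HolderTriple.inv_add_inv_eq_inv r 0 1
    simp at h
  have hV : μ univ ^ (1 / q.toReal - 1 / p.toReal) ≠ ⊤ := by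
    refine ENNReal.rpow_ne_top_of_nonneg ?_ (measure_ne_top _ _)
    rcases eq_or_ne p ⊤ with rfl | hp
    · simp
    · have h1 : q.toReal ≤ p.toReal := ENNReal.toReal_mono hp hqp
      have h2 : 0 < q.toReal := ENNReal.toReal_pos hq0 (ne_top_of_le_ne_top hp hqp)
      exact sub_nonneg.2 (one_div_le_one_div_of_le h2 h1)
  refine ⟨(eLpNorm j r μ * μ univ ^ (1 / q.toReal - 1 / p.toReal)).toReal, by positivity,
    fun f hf => ?_⟩
  have hfq : MemLp f q μ := hf.mono_exponent hqp
  have hi : Integrable (fun x => j x * f x) μ := hj.integrable_mul hfq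
  refine ⟨hi, ?_⟩
  have h1 : ‖∫ x, j x * f x ∂μ‖ₑ ≤
      eLpNorm j r μ * μ univ ^ (1 / q.toReal - 1 / p.toReal) * eLpNorm f p μ := by
    refine (enorm_integral_le_lintegral_enorm _).trans ?_
    rw [← eLpNorm_one_eq_lintegral_enorm, mul_assoc, mul_comm _ (eLpNorm f p μ)]
    refine (eLpNorm_smul_le_mul_eLpNorm (p := r) (q := q) (r := 1) hf.1 hj.1).trans ?_
    gcongr
    exact eLpNorm_le_eLpNorm_mul_rpow_measure_univ hqp hf.1
  have h2 := ENNReal.toReal_mono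
    (ENNReal.mul_ne_top (ENNReal.mul_ne_top hj.2.ne hV) hf.2.ne) h1
  rwa [toReal_enorm, ENNReal.toReal_mul, toReal_eLpNorm hf.1] at h2

theorem tendsto_integral_mul_of_bound {α : Type*} [MeasurableSpace α] {μ : Measure α}
    {p : ℝ≥0∞} {j : α → ℝ} {K : ℝ} (h : ∀ f : α → ℝ, MemLp f p μ →
      Integrable (fun x => j x * f x) μ ∧ |∫ x, j x * f x ∂μ| ≤ K * lpNorm f p μ)
    {f : ℕ → α → ℝ} {g : α → ℝ} (hf : ∀ n, MemLp (f n) p μ) (hg : MemLp g p μ)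
    (ht : Tendsto (fun n => eLpNorm (f n - g) p μ) atTop (𝓝 0)) :
    Tendsto (fun n => ∫ x, j x * f n x ∂μ) atTop (𝓝 (∫ x, j x * g x ∂μ)) := by
  have ht' : Tendsto (fun n => K * lpNorm (f n - g) p μ) atTop (𝓝 0) := by
    have := ((ENNReal.tendsto_toReal ENNReal.zero_ne_top).comp ht).const_mul K
    simp only [ENNReal.toReal_zero, mul_zero] at this
    refine this.congr fun n => ?_
    rw [Function.comp_apply, toReal_eLpNorm ((hf n).1.sub hg.1)]
  refine tendsto_iff_norm_sub_tendsto_zero.2 (squeeze_zero (fun _ => norm_nonneg _) (fun n => ?_) ht')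
  rw [← integral_sub (h _ (hf n)).1 (h _ hg).1]
  simpa only [Pi.sub_apply, mul_sub, Real.norm_eq_abs] using (h _ ((hf n).sub hg)).2

/-- Superlinear growth beats any linear term; the spare N on the left later gives the bound on the
norm of the gradient. -/
theorem exists_linear_le_rpow (hp : 1 < p) {a : ℝ} (ha : 0 < a) (K : ℝ) :
    ∃ M : ℝ, ∀ N : ℝ, 0 ≤ N → N + K * (N + 1) ≤ a * N ^ p + M := by
  have h1 := tendsto_rpow_atTop (show 0 < p - 1 by linarith)
  obtain ⟨N₀, hN₀⟩ := eventually_atTop.1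
    ((h1.eventually_ge_atTop ((1 + |K|) / a)).and (eventually_gt_atTop 0))
  set N₁ := max N₀ 0
  refine ⟨N₁ + |K| * (N₁ + 1) , fun N hN => ?_⟩
  have hK : K * (N + 1) ≤ |K| * (N + 1) := by gcongr; exact le_abs_self K
  have hN1 : 0 ≤ N₁ := le_max_right _ _
  rcases le_total N N₁ with h | h
  · have h2 : |K| * (N + 1) ≤ |K| * (N₁ + 1) := by gcongr
    have : 0 ≤ a * N ^ p := by positivity
    linarith
  · obtain ⟨h3, h4⟩ := hN₀ N ((le_max_left _ _).trans h)
    rw [div_le_iff₀' ha] at h3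
    have h5 : N ^ p = N ^ (p - 1) * N := by
      rw [← Real.rpow_add_one h4.ne', sub_add_cancel]
    rw [h5]
    have := mul_le_mul_of_nonneg_right h3 hN
    have : 0 ≤ |K| * N₁ := by positivity
    nlinarith

theorem IsConvexIntegrand.exists_le_integral {F : Euc d → Euc d → ℝ} (hF : IsConvexIntegrand Ω p F)
    (hΩ : IsOpen Ω) (hb : Bornology.IsBounded Ω) (hp : 1 < p) :
    ∃ a > (0 : ℝ), ∃ b : ℝ, ∀ v : Euc d → Euc d,
      MemLp v (ENNReal.ofReal p) (volume.restrict Ω) →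
      a * lpNorm v (ENNReal.ofReal p) (volume.restrict Ω) ^ p - b ≤ ∫ x in Ω, F x (v x) := by
  have : IsFiniteMeasure (volume.restrict Ω) := isFiniteMeasure_restrict.2 hb.measure_lt_top.ne
  obtain ⟨a, ha, b, hb0, h2⟩ := hF.growth_le
  refine ⟨a, ha, ∫ _ in Ω, b, fun v hv => ?_⟩
  have hi := hv.integrable_norm_rpow_ofReal hp
  rw [← integral_norm_rpow_eq_lpNorm hp hv.1, ← integral_const_mul,
    ← integral_sub (hi.const_mul a) (integrable_const b)]
  exact setIntegral_mono_on ((hi.const_mul a).sub (integrable_const b))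
    (hF.integrableOn hΩ hb hp hv) hΩ.measurableSet fun x hx => h2 x hx _

theorem IsC1Domain.exists_poincare_lpNorm (hΩ : IsC1Domain Ω) (hp : 1 < p) :
    ∃ C ≥ (0 : ℝ), ∀ w : Euc d → ℝ, MemW1 Ω (ENNReal.ofReal p) w → ∃ c : ℝ,
      lpNorm (fun x => w x - c) (ENNReal.ofReal p) (volume.restrict Ω) ≤
        C * (lpNorm (weakGrad Ω w) (ENNReal.ofReal p) (volume.restrict Ω) + 1) := by
  have : IsFiniteMeasure (volume.restrict Ω) :=
    isFiniteMeasure_restrict.2 hΩ.isBounded.measure_lt_top.ne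
  obtain ⟨C, hC, h⟩ := hΩ.exists_poincare (p := ENNReal.ofReal p) (by simpa using hp.le)
    ENNReal.ofReal_ne_top
  refine ⟨C.toReal, ENNReal.toReal_nonneg, fun w hw => ?_⟩
  obtain ⟨c, hc⟩ := h w hw 1 one_ne_zero
  have hv := hw.memLp_weakGrad hΩ.isOpen
  have h2 := ENNReal.toReal_mono (ENNReal.mul_ne_top hC (ENNReal.add_ne_top.2
    ⟨hv.2.ne, ENNReal.one_ne_top⟩)) hc
  have hm : AEStronglyMeasurable (fun x => w x - c) (volume.restrict Ω) :=
    hw.1.1.sub aestronglyMeasurable_const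
  rw [ENNReal.toReal_mul, ENNReal.toReal_add hv.2.ne ENNReal.one_ne_top, toReal_eLpNorm hv.1,
    toReal_eLpNorm hm, ENNReal.toReal_one] at h2
  exact ⟨c, h2⟩

theorem lpNorm_le_add_abs_mul {α : Type*} [MeasurableSpace α] {μ : Measure α} [IsFiniteMeasure μ]
    {p : ℝ≥0∞} (hp : 1 ≤ p) {f : α → ℝ} (hf : MemLp f p μ) (c : ℝ) :
    lpNorm f p μ ≤ lpNorm (fun x => f x - c) p μ + |c| * lpNorm (1 : α → ℝ) p μ := by
  have h1 : MemLp (fun _ : α => c) p μ := memLp_const c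
  have h2 := lpNorm_add_le (hf.sub h1) (g := fun _ => c) hp
  have e1 : f - (fun _ => c) + (fun _ => c) = f := by ext; simp
  have e2 : (fun _ : α => c) = c • (1 : α → ℝ) := by ext; simp
  rw [e1] at h2
  refine h2.trans (add_le_add le_rfl ?_)
  rw [e2, lpNorm_const_smul]
  simp

end Coercivity

/-! ### Minimization without boundary conditions -/

section FreeMinimization

variable {d : ℕ} {Ω : Set (Euc d)} {p : ℝ} {F : Euc d → Euc d → ℝ}

theorem MemW1.add_const (hb : Bornology.IsBounded Ω) {p : ℝ≥0∞} {w : Euc d → ℝ} (hw : MemW1 Ω p w)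
    (c : ℝ) : MemW1 Ω p fun x => w x + c := hw.add (MemW1.const hb c)

theorem IsConvexIntegrand.integral_weakGrad_half_smul_add_le (hF : IsConvexIntegrand Ω p F)
    (hΩ : IsOpen Ω) (hb : Bornology.IsBounded Ω) (hp : 1 < p) {w w' : Euc d → ℝ}
    (hw : MemW1 Ω (ENNReal.ofReal p) w) (hw' : MemW1 Ω (ENNReal.ofReal p) w') :
    ∫ x in Ω, F x (weakGrad Ω ((1 / 2 : ℝ) • (w + w')) x) ≤
      ((∫ x in Ω, F x (weakGrad Ω w x)) + ∫ x in Ω, F x (weakGrad Ω w' x)) / 2 := by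
  refine le_of_eq_of_le (integral_congr_ae ?_)
    (hF.integral_midpoint_le hΩ hb hp (hw.memLp_weakGrad hΩ) (hw'.memLp_weakGrad hΩ))
  filter_upwards [weakGrad_half_smul_add hΩ hw hw'] with x hx
  rw [hx]

/-- Subtracting the mean leaves the energy unchanged, so it suffices to minimize over functions of
mean zero, where Poincaré's inequality gives coercivity. -/
theorem IsConvexIntegrand.exists_free_minimizer (hF : IsConvexIntegrand Ω p F)
    (hΩ : IsC1Domain Ω) (hp : 1 < p) :
    ∃ v, MemW1 Ω (ENNReal.ofReal p) v ∧ ∀ w, MemW1 Ω (ENNReal.ofReal p) w →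
      ∫ x in Ω, F x (weakGrad Ω v x) ≤ ∫ x in Ω, F x (weakGrad Ω w x) := by
  have hp1 : 1 ≤ ENNReal.ofReal p := by simpa using hp.le
  have hb := hΩ.isBounded
  have : IsFiniteMeasure (volume.restrict Ω) := isFiniteMeasure_restrict.2 hb.measure_lt_top.ne
  have hV : 0 < (volume.restrict Ω).real univ := by
    rw [measureReal_restrict_apply_univ]
    exact ENNReal.toReal_pos (hΩ.isOpen.measure_pos _ hΩ.isConnected.nonempty).ne'
      hb.measure_lt_top.ne
  have hi : ∀ {w}, MemW1 Ω (ENNReal.ofReal p) w → IntegrableOn w Ω := fun hw =>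
    memLp_one_iff_integrable.1 (hw.1.mono_exponent hp1)
  obtain ⟨K, hK0, hK⟩ := exists_integral_mul_le (μ := volume.restrict Ω) (q := 1) (r := ⊤)
    hp1 (memLp_const (1 : ℝ))
  simp only [one_mul] at hK
  obtain ⟨a, ha, b, hab⟩ := hF.exists_le_integral hΩ.isOpen hb hp
  obtain ⟨C, hC0, hC⟩ := hΩ.exists_poincare_lpNorm hp
  obtain ⟨M, hM⟩ := exists_linear_le_rpow hp ha 0
  suffices h : ∃ v ∈ {w | MemW1 Ω (ENNReal.ofReal p) w ∧ ∫ x in Ω, w x = 0},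
      ∀ w ∈ {w | MemW1 Ω (ENNReal.ofReal p) w ∧ ∫ x in Ω, w x = 0},
      ∫ x in Ω, F x (weakGrad Ω v x) ≤ ∫ x in Ω, F x (weakGrad Ω w x) by
    obtain ⟨v, hv, hmin⟩ := h
    refine ⟨v, hv.1, fun w hw => ?_⟩
    refine (hmin (fun x => w x + -((∫ x in Ω, w x) / (volume.restrict Ω).real univ))
      ⟨hw.add_const hb _, ?_⟩).trans_eq (integral_congr_ae ?_)
    · rw [integral_add (hi hw) (integrable_const _), integral_const, smul_eq_mul]
      field_simp
      simp
    · filter_upwards [weakGrad_add_const hΩ.isOpen hw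
        (-((∫ x in Ω, w x) / (volume.restrict Ω).real univ))] with x hx
      rw [hx]
  refine exists_minimizer hΩ.isOpen hb hp
    (D := {w | MemW1 Ω (ENNReal.ofReal p) w ∧ ∫ x in Ω, w x = 0})
    (J := fun w => ∫ x in Ω, F x (weakGrad Ω w x)) (fun w hw => hw.1)
    ⟨fun _ => 0, MemW1.const hb 0, by simp⟩
    (fun w hw w' hw' => ⟨⟨(hw.1.add hw'.1).const_smul _, by
      simp only [Pi.smul_apply, Pi.add_apply, smul_eq_mul]
      rw [integral_const_mul, integral_add (hi hw.1) (hi hw'.1), hw.2, hw'.2]; simp⟩,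
      hF.integral_weakGrad_half_smul_add_le hΩ.isOpen hb hp hw.1 hw'.1⟩) ?_ ?_ ?_
  · intro w hw w₀ hw₀ ht ht'
    refine ⟨⟨hw₀, ?_⟩, fun r hr => hF.integral_le_of_tendsto hΩ.isOpen hb hp
      (fun n => (hw n).1.memLp_weakGrad hΩ.isOpen) (hw₀.memLp_weakGrad hΩ.isOpen) ht' hr⟩
    have h1 := tendsto_integral_mul_of_bound (μ := volume.restrict Ω) (j := fun _ => 1) (K := K)
      (by simpa only [one_mul] using hK) (fun n => (hw n).1.1) hw₀.1 ht
    simp only [one_mul, fun n => (hw n).2] at h1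
    exact (tendsto_nhds_unique h1 tendsto_const_nhds)
  · refine ⟨-b, ?_⟩
    rintro _ ⟨w, hw, rfl⟩
    have := hab _ (hw.1.memLp_weakGrad hΩ.isOpen)
    have : 0 ≤ a * lpNorm (weakGrad Ω w) (ENNReal.ofReal p) (volume.restrict Ω) ^ p :=
      mul_nonneg ha.le (Real.rpow_nonneg lpNorm_nonneg _)
    show -b ≤ ∫ x in Ω, F x (weakGrad Ω w x)
    linarith
  · intro r
    set N₁ := |r + b + M| with hN₁
    set Q := C * (N₁ + 1) with hQ
    have hQ0 : 0 ≤ Q := mul_nonneg hC0 (by positivity)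
    refine ⟨(Q + K * Q / (volume.restrict Ω).real univ *
      lpNorm (1 : Euc d → ℝ) (ENNReal.ofReal p) (volume.restrict Ω)) ^ p + N₁ ^ p, ?_⟩
    rintro w ⟨hw, hw0⟩ hwr
    have hvm := hw.memLp_weakGrad hΩ.isOpen
    have h1 := hab _ hvm
    have h2 := hM _ (lpNorm_nonneg (f := weakGrad Ω w) (p := ENNReal.ofReal p)
      (μ := volume.restrict Ω))
    have hN : lpNorm (weakGrad Ω w) (ENNReal.ofReal p) (volume.restrict Ω) ≤ N₁ := by
      have := le_abs_self (r + b + M)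
      have hwr' : ∫ x in Ω, F x (weakGrad Ω w x) ≤ r := hwr
      linarith
    obtain ⟨c, hc⟩ := hC w hw
    have hcQ : lpNorm (fun x => w x - c) (ENNReal.ofReal p) (volume.restrict Ω) ≤ Q :=
      hc.trans (mul_le_mul_of_nonneg_left (by linarith) hC0)
    have hcm : MemLp (fun x => w x - c) (ENNReal.ofReal p) (volume.restrict Ω) :=
      hw.1.sub (memLp_const c)
    -- With mean zero the integral of w - c is -c|Ω|, so the Poincaré constant c is controlled by
    -- the norm of w - c.
    have hcV : |c| * (volume.restrict Ω).real univ ≤ K * Q := by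
      have h3 := (hK _ hcm).2
      rw [integral_sub (hi hw) (integrable_const c), hw0, integral_const, smul_eq_mul, zero_sub,
        abs_neg, abs_mul, abs_of_nonneg hV.le, mul_comm] at h3
      exact h3.trans (by gcongr)
    have hwn := lpNorm_le_add_abs_mul hp1 hw.1 c
    rw [integral_norm_rpow_eq_lpNorm hp hw.1.1, integral_norm_rpow_eq_lpNorm hp hvm.1]
    rw [← le_div_iff₀ hV] at hcV
    exact add_le_add (Real.rpow_le_rpow lpNorm_nonneg
      (hwn.trans (add_le_add hcQ (mul_le_mul_of_nonneg_right hcV lpNorm_nonneg))) (by linarith))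
      (Real.rpow_le_rpow lpNorm_nonneg hN (by linarith))

/-- The competitor T(v) with T' = 1 - τ has gradient (1 - τ(v))Dv. Convexity bounds its energy
density by (1 - τ)F(x, Dv) + τF(x, 0), so minimality gives ∫ τ(v)(F(x, Dv) - F(x, 0)) ≤ 0. Growth
turns this into the truncation bound, with no Euler–Lagrange equation. -/
theorem IsConvexIntegrand.exists_ae_le_of_free_minimizer (hF : IsConvexIntegrand Ω p F)
    (hΩ : IsC1Domain Ω) (hp : 1 < p) {v : Euc d → ℝ} (hv : MemW1 Ω (ENNReal.ofReal p) v)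
    (hmin : ∀ w, MemW1 Ω (ENNReal.ofReal p) w →
      ∫ x in Ω, F x (weakGrad Ω v x) ≤ ∫ x in Ω, F x (weakGrad Ω w x)) :
    ∃ M : ℝ, ∀ᵐ x ∂(volume.restrict Ω), v x ≤ M := by
  have hp1 : 1 ≤ ENNReal.ofReal p := by simpa using hp.le
  have hb := hΩ.isBounded
  have : IsFiniteMeasure (volume.restrict Ω) := isFiniteMeasure_restrict.2 hb.measure_lt_top.ne
  obtain ⟨C, hC, h1⟩ := hF.le_growth
  obtain ⟨a, ha, b, hb0, h2⟩ := hF.growth_le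
  have hvm := hv.memLp_weakGrad hΩ.isOpen
  have hvI : IntegrableOn (weakGrad Ω v) Ω := memLp_one_iff_integrable.1 (hvm.mono_exponent hp1)
  refine exists_ae_le_of_truncation_bound hΩ hp1 ENNReal.ofReal_ne_top hv
    (C := ENNReal.ofReal (1 + (b + C) / a)) ENNReal.ofReal_ne_top fun τ hτ _ hτ01 => ?_
  obtain ⟨hT, hT'⟩ := exists_primitive (τ := fun s => 1 - τ s) (by fun_prop) 0
  set T : ℝ → ℝ := fun s => ∫ t in (0 : ℝ)..s, (1 - τ t)
  have hL : ∀ s, |deriv T s| ≤ 1 := fun s => by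
    rw [hT', abs_le]
    constructor <;> linarith [(hτ01 s).1, (hτ01 s).2]
  have hwg := hasWeakGradient_comp hΩ hp1 ENNReal.ofReal_ne_top hv hT hL
  have hτm : AEStronglyMeasurable (fun x => τ (v x)) (volume.restrict Ω) :=
    hτ.comp_aestronglyMeasurable hv.1.1
  have hgm : MemLp (fun x => deriv T (v x) • weakGrad Ω v x) (ENNReal.ofReal p)
      (volume.restrict Ω) := by
    refine hvm.of_le (((hT.continuous_deriv le_rfl).comp_aestronglyMeasurable hv.1.1).smul hvm.1)
      (Eventually.of_forall fun x => ?_)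
    rw [norm_smul]
    exact mul_le_of_le_one_left (norm_nonneg _) (hL _)
  have hTm : MemLp (T ∘ v) (ENNReal.ofReal p) (volume.restrict Ω) := by
    refine hv.1.of_le (hT.continuous.comp_aestronglyMeasurable hv.1.1)
      (Eventually.of_forall fun x => ?_)
    have h := convex_univ.norm_image_sub_le_of_norm_deriv_le (f := T) (𝕜 := ℝ)
      (fun s _ => hT.differentiable one_ne_zero s) (fun s _ => hL s) (mem_univ 0) (mem_univ (v x))
    simpa [T] using h
  have hcomp := hmin _ (hwg.memW1 hTm hgm)
  have hcomp' : ∫ x in Ω, F x (weakGrad Ω v x) ≤ ∫ x in Ω, F x ((1 - τ (v x)) • weakGrad Ω v x) := by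
    refine hcomp.trans_eq (integral_congr_ae ?_)
    filter_upwards [hwg.weakGrad_ae_eq hΩ.isOpen] with x hx
    rw [hx, hT']
  have hτI : IntegrableOn (fun x => τ (v x)) Ω :=
    (integrable_const (1 : ℝ)).mono' hτm (Eventually.of_forall fun x => by
      rw [Real.norm_of_nonneg (hτ01 _).1]; exact (hτ01 _).2)
  have hτgI : IntegrableOn (fun x => τ (v x) * ‖weakGrad Ω v x‖) Ω :=
    hvI.norm.mono' (hτm.mul hvm.1.norm) (Eventually.of_forall fun x => by
      rw [norm_mul, norm_norm, Real.norm_of_nonneg (hτ01 _).1]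
      exact mul_le_of_le_one_left (norm_nonneg _) (hτ01 _).2)
  have hkey : 0 ≤ ∫ x in Ω, ((b + C + a) * τ (v x) - a * (τ (v x) * ‖weakGrad Ω v x‖)) := by
    have i1 := hF.integrableOn hΩ.isOpen hb hp hvm
    have hgm' : MemLp (fun x => (1 - τ (v x)) • weakGrad Ω v x) (ENNReal.ofReal p)
        (volume.restrict Ω) := by simpa only [hT'] using hgm
    have i2 := hF.integrableOn hΩ.isOpen hb hp hgm'
    refine (sub_nonneg.2 hcomp').trans ?_
    rw [← integral_sub i2 i1]
    refine setIntegral_mono_on (i2.sub i1) ((hτI.const_mul _).sub (hτgI.const_mul _))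
      hΩ.isOpen.measurableSet fun x hx => ?_
    have hc := (hF.convexOn x hx).2 (mem_univ (weakGrad Ω v x)) (mem_univ 0)
      (sub_nonneg.2 (hτ01 (v x)).2) (hτ01 (v x)).1 (sub_add_cancel _ _)
    rw [smul_zero, add_zero, smul_eq_mul, smul_eq_mul] at hc
    have e1 := h1 x hx 0
    rw [norm_zero, Real.zero_rpow (by linarith), zero_add, mul_one] at e1
    have e2 := h2 x hx (weakGrad Ω v x)
    have e3 : ‖weakGrad Ω v x‖ ≤ 1 + ‖weakGrad Ω v x‖ ^ p := by
      rcases le_total ‖weakGrad Ω v x‖ 1 with h | h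
      · have : 0 ≤ ‖weakGrad Ω v x‖ ^ p := by positivity
        linarith
      · have := Real.rpow_le_rpow_of_exponent_le h hp.le
        rw [Real.rpow_one] at this
        linarith
    -- Only linear growth in |Dv| is kept, matching the L¹ estimates on level sets.
    have e4 : F x 0 - F x (weakGrad Ω v x) ≤ b + C + a - a * ‖weakGrad Ω v x‖ := by nlinarith
    have := mul_le_mul_of_nonneg_left e4 (hτ01 (v x)).1
    nlinarith
  rw [integral_sub (hτI.const_mul _) (hτgI.const_mul _), integral_const_mul, integral_const_mul]
    at hkey
  have hfin : ∫ x in Ω, τ (v x) * ‖weakGrad Ω v x‖ ≤ (1 + (b + C) / a) * ∫ x in Ω, τ (v x) := by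
    have e : (1 + (b + C) / a) = (b + C + a) / a := by field_simp; ring
    rw [e, div_mul_eq_mul_div, le_div_iff₀ ha]
    linarith
  have hr := ENNReal.ofReal_le_ofReal hfin
  rw [ENNReal.ofReal_mul (by positivity), ofReal_integral_eq_lintegral_ofReal hτI
    (Eventually.of_forall fun x => (hτ01 _).1), ofReal_integral_eq_lintegral_ofReal hτgI
    (Eventually.of_forall fun x => mul_nonneg (hτ01 _).1 (norm_nonneg _))] at hr
  refine le_of_eq_of_le (lintegral_congr fun x => ?_) hr
  rw [ENNReal.ofReal_mul (hτ01 _).1, ofReal_norm]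

end FreeMinimization

/-! ### Minimization with an obstacle on a part of the boundary -/

section Obstacle

variable {d : ℕ} {Ω S ΓD ΓN : Set (Euc d)}

theorem surfaceMeasure_mono {S T : Set (Euc d)} (h : S ⊆ T) :
    surfaceMeasure S ≤ surfaceMeasure T := Measure.restrict_mono h le_rfl

theorem tendsto_eLpNorm_boundaryTrace (hΩ : IsC1Domain Ω) {p : ℝ≥0∞} (hp : 1 ≤ p) (hpt : p ≠ ⊤)
    (hS : S ⊆ frontier Ω) {w : ℕ → Euc d → ℝ} {w₀ : Euc d → ℝ} (hw : ∀ n, MemW1 Ω p (w n))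
    (hw₀ : MemW1 Ω p w₀)
    (ht : Tendsto (fun n => eLpNorm (w n - w₀) p (volume.restrict Ω)) atTop (𝓝 0))
    (ht' : Tendsto (fun n => eLpNorm (weakGrad Ω (w n) - weakGrad Ω w₀) p (volume.restrict Ω))
      atTop (𝓝 0)) :
    Tendsto (fun n => eLpNorm (boundaryTrace Ω p (w n) - boundaryTrace Ω p w₀) p
      (surfaceMeasure S)) atTop (𝓝 0) := by
  obtain ⟨C, hC, h⟩ := hΩ.eLpNorm_boundaryTrace_le hp hpt
  refine tendsto_eLpNorm_zero_of_le_add ht ht' hC fun n => ?_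
  refine (eLpNorm_mono_measure _ (surfaceMeasure_mono hS)).trans ?_
  rw [← eLpNorm_congr_ae (boundaryTrace_sub hΩ hp hpt (hw n) hw₀),
    ← eLpNorm_congr_ae ((hw n).weakGrad_sub hΩ.isOpen hw₀)]
  exact h _ ((hw n).sub hw₀)

theorem IsC1Domain.lpNorm_boundaryTrace_le (hΩ : IsC1Domain Ω) {p : ℝ≥0∞} (hp : 1 ≤ p)
    (hpt : p ≠ ⊤) (hS : S ⊆ frontier Ω) :
    ∃ C ≥ (0 : ℝ), ∀ w : Euc d → ℝ, MemW1 Ω p w →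
      lpNorm (boundaryTrace Ω p w) p (surfaceMeasure S) ≤
        C * (lpNorm w p (volume.restrict Ω) + lpNorm (weakGrad Ω w) p (volume.restrict Ω)) := by
  obtain ⟨C, hC, h⟩ := hΩ.eLpNorm_boundaryTrace_le hp hpt
  refine ⟨C.toReal, ENNReal.toReal_nonneg, fun w hw => ?_⟩
  have ht := (memLp_boundaryTrace hΩ hp hpt hw).mono_measure (surfaceMeasure_mono hS)
  have hv := hw.memLp_weakGrad hΩ.isOpen
  have h1 := ENNReal.toReal_mono (ENNReal.mul_ne_top hC (ENNReal.add_ne_top.2 ⟨hw.1.2.ne, hv.2.ne⟩))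
    ((eLpNorm_mono_measure _ (surfaceMeasure_mono hS)).trans (h w hw))
  rwa [ENNReal.toReal_mul, ENNReal.toReal_add hw.1.2.ne hv.2.ne, toReal_eLpNorm ht.1,
    toReal_eLpNorm hw.1.1, toReal_eLpNorm hv.1] at h1

theorem mem_admissibleSet_half_smul_add (hΩ : IsC1Domain Ω) {p : ℝ≥0∞} (hp : 1 ≤ p) (hpt : p ≠ ⊤)
    (hD : ΓD ⊆ frontier Ω) {ψ w w' : Euc d → ℝ} (hw : w ∈ admissibleSet Ω ΓD p ψ)
    (hw' : w' ∈ admissibleSet Ω ΓD p ψ) : (1 / 2 : ℝ) • (w + w') ∈ admissibleSet Ω ΓD p ψ := by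
  refine ⟨(hw.1.add hw'.1).const_smul _, ?_⟩
  filter_upwards [hw.2, hw'.2, ae_mono (surfaceMeasure_mono hD)
    (boundaryTrace_const_smul hΩ hp hpt (hw.1.add hw'.1) (1 / 2)),
    ae_mono (surfaceMeasure_mono hD) (boundaryTrace_add hΩ hp hpt hw.1 hw'.1)] with x h1 h2 h3 h4
  rw [h3, Pi.smul_apply, h4, Pi.add_apply, smul_eq_mul]
  linarith

/-- Traces converge in L^p(Γ_D), hence almost everywhere along a subsequence, and the inequality
passes to the limit. -/
theorem mem_admissibleSet_of_tendsto (hΩ : IsC1Domain Ω) {p : ℝ≥0∞} (hp : 1 ≤ p) (hpt : p ≠ ⊤)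
    (hD : ΓD ⊆ frontier Ω) {ψ : Euc d → ℝ} {w : ℕ → Euc d → ℝ} {w₀ : Euc d → ℝ}
    (hw : ∀ n, w n ∈ admissibleSet Ω ΓD p ψ) (hw₀ : MemW1 Ω p w₀)
    (ht : Tendsto (fun n => eLpNorm (w n - w₀) p (volume.restrict Ω)) atTop (𝓝 0))
    (ht' : Tendsto (fun n => eLpNorm (weakGrad Ω (w n) - weakGrad Ω w₀) p (volume.restrict Ω))
      atTop (𝓝 0)) : w₀ ∈ admissibleSet Ω ΓD p ψ := by
  have hm : ∀ {w}, MemW1 Ω p w → AEStronglyMeasurable (boundaryTrace Ω p w) (surfaceMeasure ΓD) :=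
    fun hw => ((memLp_boundaryTrace hΩ hp hpt hw).mono_measure (surfaceMeasure_mono hD)).1
  obtain ⟨ns, -, hae⟩ := (tendstoInMeasure_of_tendsto_eLpNorm (zero_lt_one.trans_le hp).ne'
    (fun n => hm (hw n).1) (hm hw₀) (tendsto_eLpNorm_boundaryTrace hΩ hp hpt hD
      (fun n => (hw n).1) hw₀ ht ht')).exists_seq_tendsto_ae
  refine ⟨hw₀, ?_⟩
  filter_upwards [hae, ae_all_iff.2 fun n => (hw n).2] with x hx hx'
  exact le_of_tendsto' hx fun n => hx' _

/-- The constant part of w is held from above by the obstacle and from below by the strictly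
positive total flux ∫ j. -/
theorem IsConvexIntegrand.exists_obstacle_minimizer {p : ℝ} {F : Euc d → Euc d → ℝ}
    (hF : IsConvexIntegrand Ω p F) (hΩ : IsC1Domain Ω) (hp : 1 < p) (hD : ΓD ⊆ frontier Ω)
    (hN : ΓN ⊆ frontier Ω) (hσ : 0 < (surfaceMeasure ΓD).real univ) {q r : ℝ≥0∞}
    [ENNReal.HolderTriple r q 1] (hq : q ≤ ENNReal.ofReal p) {j : Euc d → ℝ}
    (hj : MemLp j r (surfaceMeasure ΓN)) (hj0 : 0 < ∫ s, j s ∂(surfaceMeasure ΓN))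
    {ψ : Euc d → ℝ} (hψ : MemW1 Ω (ENNReal.ofReal p) ψ) :
    ∃ u ∈ admissibleSet Ω ΓD (ENNReal.ofReal p) ψ,
      ∀ w ∈ admissibleSet Ω ΓD (ENNReal.ofReal p) ψ,
        (∫ x in Ω, F x (weakGrad Ω u x)) -
          ∫ s, j s * boundaryTrace Ω (ENNReal.ofReal p) u s ∂(surfaceMeasure ΓN) ≤
        (∫ x in Ω, F x (weakGrad Ω w x)) -
          ∫ s, j s * boundaryTrace Ω (ENNReal.ofReal p) w s ∂(surfaceMeasure ΓN) := by
  have hp1 : 1 ≤ ENNReal.ofReal p := by simpa using hp.le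
  have hpt : ENNReal.ofReal p ≠ ⊤ := ENNReal.ofReal_ne_top
  generalize hP : ENNReal.ofReal p = P at *
  have hb := hΩ.isBounded
  have : IsFiniteMeasure (volume.restrict Ω) := isFiniteMeasure_restrict.2 hb.measure_lt_top.ne
  have hfin := hΩ.isFiniteMeasure_surfaceMeasure
  have hfD : IsFiniteMeasure (surfaceMeasure ΓD) :=
    isFiniteMeasure_of_le _ (surfaceMeasure_mono hD)
  have hfN : IsFiniteMeasure (surfaceMeasure ΓN) :=
    isFiniteMeasure_of_le _ (surfaceMeasure_mono hN)
  have htD : ∀ {w}, MemW1 Ω P w → MemLp (boundaryTrace Ω P w) P (surfaceMeasure ΓD) :=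
    fun hw => (memLp_boundaryTrace hΩ hp1 hpt hw).mono_measure (surfaceMeasure_mono hD)
  have htN : ∀ {w}, MemW1 Ω P w → MemLp (boundaryTrace Ω P w) P (surfaceMeasure ΓN) :=
    fun hw => (memLp_boundaryTrace hΩ hp1 hpt hw).mono_measure (surfaceMeasure_mono hN)
  obtain ⟨K₁, hK₁0, hK₁⟩ := exists_integral_mul_le (μ := surfaceMeasure ΓD) (q := 1) (r := ⊤)
    hp1 (memLp_const (1 : ℝ))
  simp only [one_mul] at hK₁
  obtain ⟨K₂, hK₂0, hK₂⟩ := exists_integral_mul_le hq hj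
  obtain ⟨T₁, hT₁0, hT₁⟩ := hΩ.lpNorm_boundaryTrace_le hp1 hpt hD
  obtain ⟨T₂, hT₂0, hT₂⟩ := hΩ.lpNorm_boundaryTrace_le hp1 hpt hN
  obtain ⟨a, ha, b, hab⟩ := hF.exists_le_integral hΩ.isOpen hb hp
  obtain ⟨C, hC0, hC⟩ := hΩ.exists_poincare_lpNorm hp
  rw [hP] at hab hC
  set 𝒥 := ∫ s, j s ∂(surfaceMeasure ΓN) with h𝒥
  set σ := (surfaceMeasure ΓD).real univ with hσd
  set L : (Euc d → ℝ) → ℝ := fun w => ∫ s, j s * boundaryTrace Ω P w s ∂(surfaceMeasure ΓN) with hL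
  set ν : (Euc d → ℝ) → ℝ := fun w => lpNorm (weakGrad Ω w) P (volume.restrict Ω) with hν
  set A := (|∫ s, boundaryTrace Ω P ψ s ∂(surfaceMeasure ΓD)| + K₁ * (T₁ * (C + 1))) / σ with hA
  set B := K₂ * (T₂ * (C + 1)) with hB
  have hA0 : 0 ≤ A := by positivity
  have hB0 : 0 ≤ B := by positivity
  have hν0 : ∀ w, 0 ≤ ν w := fun w => lpNorm_nonneg
  -- Apply the trace inequality to w - c. Integrating over Γ_D and using w ≤ ψ there bounds c from
  -- above; integrating against j over Γ_N shows that the boundary term is c ∫ j up to a multiple of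
  -- ‖Dw‖ + 1.
  have main : ∀ w ∈ admissibleSet Ω ΓD P ψ, ∃ c : ℝ,
      lpNorm (fun x => w x - c) P (volume.restrict Ω) ≤ C * (ν w + 1) ∧ c ≤ A * (ν w + 1) ∧
      |L w - c * 𝒥| ≤ B * (ν w + 1) := by
    rintro w ⟨hw, hwψ⟩
    obtain ⟨c, hc⟩ := hC w hw
    have hz : MemW1 Ω P (fun x => w x + -c) := hw.add_const hb _
    have hzν : lpNorm (weakGrad Ω fun x => w x + -c) P (volume.restrict Ω) = ν w := by
      simp only [hν]
      rw [← toReal_eLpNorm (hz.memLp_weakGrad hΩ.isOpen).1,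
        eLpNorm_congr_ae (weakGrad_add_const hΩ.isOpen hw (-c)),
        toReal_eLpNorm (hw.memLp_weakGrad hΩ.isOpen).1]
    have htr := boundaryTrace_add_const hΩ hp1 hpt hw (-c)
    have hzs : lpNorm (fun x => w x + -c) P (volume.restrict Ω) + ν w ≤ (C + 1) * (ν w + 1) := by
      simp only [← sub_eq_add_neg]
      linarith [hν0 w]
    have hz1 := hT₁ _ hz
    have hz2 := hT₂ _ hz
    rw [hzν] at hz1 hz2
    refine ⟨c, hc, ?_, ?_⟩
    · have h1 := (hK₁ _ (htD hz)).2
      have h2 : ∫ s, boundaryTrace Ω P (fun x => w x + -c) s ∂(surfaceMeasure ΓD) =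
          (∫ s, boundaryTrace Ω P w s ∂(surfaceMeasure ΓD)) + -c * σ := by
        rw [integral_congr_ae (ae_mono (surfaceMeasure_mono hD) htr),
          integral_add (hK₁ _ (htD hw)).1 (integrable_const _), integral_const, smul_eq_mul,
          mul_comm σ]
      have h3 : ∫ s, boundaryTrace Ω P w s ∂(surfaceMeasure ΓD) ≤
          ∫ s, boundaryTrace Ω P ψ s ∂(surfaceMeasure ΓD) :=
        integral_mono_ae (hK₁ _ (htD hw)).1 (hK₁ _ (htD hψ)).1 hwψ
      rw [h2, abs_le] at h1
      have h4 : K₁ * lpNorm (boundaryTrace Ω P fun x => w x + -c) P (surfaceMeasure ΓD) ≤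
          K₁ * (T₁ * (C + 1)) * (ν w + 1) := by
        rw [mul_assoc, mul_assoc]
        exact mul_le_mul_of_nonneg_left (hz1.trans (mul_le_mul_of_nonneg_left hzs hT₁0)) hK₁0
      rw [hA, div_mul_eq_mul_div, le_div_iff₀ hσ]
      have h5 := le_abs_self (∫ s, boundaryTrace Ω P ψ s ∂(surfaceMeasure ΓD))
      have h6 := mul_nonneg (abs_nonneg (∫ s, boundaryTrace Ω P ψ s ∂(surfaceMeasure ΓD))) (hν0 w)
      linarith [h1.1]
    · have h1 := (hK₂ _ (htN hz)).2
      have h2 : ∫ s, j s * boundaryTrace Ω P (fun x => w x + -c) s ∂(surfaceMeasure ΓN) =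
          L w - c * 𝒥 := by
        have hji : Integrable j (surfaceMeasure ΓN) := by
          simpa using (hK₂ (fun _ => 1) (memLp_const 1)).1
        rw [h𝒥, ← integral_const_mul, ← integral_sub (hK₂ _ (htN hw)).1 (hji.const_mul c)]
        refine integral_congr_ae ?_
        filter_upwards [ae_mono (surfaceMeasure_mono hN) htr] with x hx
        rw [hx]; ring
      rw [h2] at h1
      refine h1.trans ?_
      rw [hB, mul_assoc, mul_assoc]
      exact mul_le_mul_of_nonneg_left (hz2.trans (mul_le_mul_of_nonneg_left hzs hT₂0)) hK₂0
  obtain ⟨M, hM⟩ := exists_linear_le_rpow hp ha (B + A * 𝒥)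
  -- The boundary term grows at most linearly in ‖Dw‖, so the energy absorbs it and leaves one copy
  -- of ‖Dw‖.
  have lower : ∀ w ∈ admissibleSet Ω ΓD P ψ,
      ν w - (b + M) ≤ (∫ x in Ω, F x (weakGrad Ω w x)) - L w := by
    intro w hw
    obtain ⟨c, -, hc1, hc2⟩ := main w hw
    have h1 := hab _ (hw.1.memLp_weakGrad hΩ.isOpen)
    have h2 := hM (ν w) (hν0 w)
    have h3 := mul_le_mul_of_nonneg_right hc1 hj0.le
    have h4 := (abs_le.1 hc2).2
    simp only [hν] at *
    linarith
  rw [← hP]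
  refine exists_minimizer hΩ.isOpen hb hp
    (J := fun w => (∫ x in Ω, F x (weakGrad Ω w x)) -
      ∫ s, j s * boundaryTrace Ω (ENNReal.ofReal p) w s ∂(surfaceMeasure ΓN)) (fun w hw => hw.1)
    ⟨ψ, hP ▸ hψ, Eventually.of_forall fun _ => le_rfl⟩ ?_ ?_ ?_ ?_ <;> rw [hP]
  · intro w hw w' hw'
    refine ⟨mem_admissibleSet_half_smul_add hΩ hp1 hpt hD hw hw', ?_⟩
    have h1 := hF.integral_weakGrad_half_smul_add_le hΩ.isOpen hb hp (hP ▸ hw.1) (hP ▸ hw'.1)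
    have h2 : L ((1 / 2 : ℝ) • (w + w')) = (L w + L w') / 2 := by
      simp only [hL]
      rw [← integral_add (hK₂ _ (htN hw.1)).1 (hK₂ _ (htN hw'.1)).1, ← integral_div]
      refine integral_congr_ae ?_
      filter_upwards [ae_mono (surfaceMeasure_mono hN)
        (boundaryTrace_const_smul hΩ hp1 hpt (hw.1.add hw'.1) (1 / 2)),
        ae_mono (surfaceMeasure_mono hN) (boundaryTrace_add hΩ hp1 hpt hw.1 hw'.1)] with x h3 h4
      rw [h3, Pi.smul_apply, h4, Pi.add_apply, smul_eq_mul]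
      ring
    simp only [hL] at h2
    linarith
  · intro w hw w₀ hw₀ ht ht'
    refine ⟨mem_admissibleSet_of_tendsto hΩ hp1 hpt hD hw hw₀ ht ht', fun r hr => ?_⟩
    have hlim : Tendsto (fun n => L (w n)) atTop (𝓝 (L w₀)) :=
      tendsto_integral_mul_of_bound hK₂ (fun n => htN (hw n).1) (htN hw₀)
        (tendsto_eLpNorm_boundaryTrace hΩ hp1 hpt hN (fun n => (hw n).1) hw₀ ht ht')
    have h1 := hF.integral_le_of_tendsto hΩ.isOpen hb hp (r := r + L w₀)
      (fun n => hP ▸ (hw n).1.memLp_weakGrad hΩ.isOpen) (hP ▸ hw₀.memLp_weakGrad hΩ.isOpen)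
      (hP ▸ ht') fun ε hε => by
        filter_upwards [hr (ε / 2) (by linarith),
          hlim.eventually_lt_const (show L w₀ < L w₀ + ε / 2 by linarith)] with n h1 h2
        simp only [hL] at h1 h2 ⊢
        linarith
    simp only [hL] at h1 ⊢
    linarith
  · refine ⟨-(b + M), ?_⟩
    rintro _ ⟨w, hw, rfl⟩
    have h1 := lower w hw
    have h2 := hν0 w
    simp only [hL] at h1 ⊢
    linarith
  · intro r
    set N₁ := |r + (b + M)| with hN₁
    set Q := C * (N₁ + 1) with hQ
    have hQ0 : 0 ≤ Q := mul_nonneg hC0 (by positivity)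
    refine ⟨(Q + (A * (N₁ + 1) + (|b + r| + B * (N₁ + 1)) / 𝒥) *
      lpNorm (1 : Euc d → ℝ) P (volume.restrict Ω)) ^ p + N₁ ^ p, ?_⟩
    intro w hw hwr
    have hwr' : (∫ x in Ω, F x (weakGrad Ω w x)) - L w ≤ r := hwr
    have hN : ν w ≤ N₁ := by
      have := le_abs_self (r + (b + M))
      have := lower w hw
      linarith
    obtain ⟨c, hc, hc1, hc2⟩ := main w hw
    have hvm := hw.1.memLp_weakGrad hΩ.isOpen
    have h1 := hab _ hvm
    have h2 : 0 ≤ a * ν w ^ p := mul_nonneg ha.le (Real.rpow_nonneg (hν0 w) _)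
    have hcabs : |c| ≤ A * (N₁ + 1) + (|b + r| + B * (N₁ + 1)) / 𝒥 := by
      have e1 : A * (ν w + 1) ≤ A * (N₁ + 1) := mul_le_mul_of_nonneg_left (by linarith) hA0
      have e2 : B * (ν w + 1) ≤ B * (N₁ + 1) := mul_le_mul_of_nonneg_left (by linarith) hB0
      have e3 : 0 ≤ (|b + r| + B * (N₁ + 1)) / 𝒥 := by positivity
      have e4 : 0 ≤ A * (N₁ + 1) := by positivity
      -- On a sublevel set the energy is bounded below by -b, so L w ≥ -(b + r); as L w is close to
      -- c ∫ j and ∫ j > 0, this bounds c from below.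
      have e5 : -c ≤ (|b + r| + B * (N₁ + 1)) / 𝒥 := by
        rw [le_div_iff₀ hj0]
        have := (abs_le.1 hc2).2
        have := le_abs_self (b + r)
        simp only [hν] at *
        linarith
      rw [abs_le]
      constructor <;> linarith
    have hwn := lpNorm_le_add_abs_mul hp1 hw.1.1 c
    have hcQ : lpNorm (fun x => w x - c) P (volume.restrict Ω) ≤ Q :=
      hc.trans (mul_le_mul_of_nonneg_left (by linarith) hC0)
    rw [integral_norm_rpow_eq_lpNorm hp hw.1.1.1, integral_norm_rpow_eq_lpNorm hp hvm.1, hP]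
    exact add_le_add (Real.rpow_le_rpow lpNorm_nonneg
      (hwn.trans (add_le_add hcQ (mul_le_mul_of_nonneg_right hcabs lpNorm_nonneg))) (by linarith))
      (Real.rpow_le_rpow lpNorm_nonneg hN (by linarith))

end Obstacle

/-! ### Shifting below the obstacle, and the main theorem. -/

section Existence

variable {d : ℕ} {Ω ΓD : Set (Euc d)}

/-- A continuous ψ has a minimum m on the compact closure, so v + m - M ≤ ψ almost everywhere in Ω,
and the trace preserves order. -/
theorem exists_sub_const_mem_admissibleSet (hΩ : IsC1Domain Ω) {p : ℝ≥0∞} (hp : 1 ≤ p)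
    (hpt : p ≠ ⊤) (hD : ΓD ⊆ frontier Ω) {v ψ : Euc d → ℝ} (hv : MemW1 Ω p v) (hψ : MemW1 Ω p ψ)
    (hψc : ContinuousOn ψ (closure Ω)) {M : ℝ} (hM : ∀ᵐ x ∂(volume.restrict Ω), v x ≤ M) :
    ∃ c : ℝ, (fun x => v x + c) ∈ admissibleSet Ω ΓD p ψ := by
  obtain ⟨m, hm⟩ := hΩ.isBounded.isCompact_closure.bddBelow_image hψc
  have hvc := hv.add_const hΩ.isBounded (m - M)
  refine ⟨m - M, hvc, ?_⟩
  have h0 : ∀ᵐ x ∂(volume.restrict Ω), ((fun x => v x + (m - M)) - ψ) x ≤ 0 := by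
    filter_upwards [hM, ae_restrict_mem hΩ.isOpen.measurableSet] with x hx hxΩ
    have := hm (mem_image_of_mem ψ (subset_closure hxΩ))
    simp only [Pi.sub_apply]
    linarith
  filter_upwards [ae_mono (surfaceMeasure_mono hD)
    (boundaryTrace_nonpos hΩ hp hpt (hvc.sub hψ) h0),
    ae_mono (surfaceMeasure_mono hD) (boundaryTrace_sub hΩ hp hpt hvc hψ)] with x h1 h2
  rw [h2, Pi.sub_apply] at h1
  linarith

end Existence

theorem theorem1 {d : ℕ} (Ω ΓD ΓN : Set (Euc d)) (hΩ : IsC1Domain Ω)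
    (hΓ : IsBoundaryPartition Ω ΓD ΓN)
    (α β : ℝ) (G : ℝ → ℝ) (hG : EnergyAssumption α G)
    (H : Euc d → Euc d → ℝ) (hH : HamiltonianAssumption Ω β H)
    (j : Euc d → ℝ) (hj : MemLp j (ENNReal.ofReal (Real.conjExponent β)) (surfaceMeasure ΓN))
    (hj0 : ∀ᵐ s ∂(surfaceMeasure ΓN), 0 ≤ j s)
    (γ : ℝ≥0∞) (hγ : γ = ENNReal.ofReal (α * β))
    (ψ : Euc d → ℝ) (hψ : MemW1 Ω γ ψ)
    (hψc : (∀ᵐ s ∂(surfaceMeasure ΓN), j s = 0) → ContinuousOn ψ (closure Ω)) :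
    (∀ w, MemW1 Ω γ w →
      IsTrace Ω γ w (boundaryTrace Ω γ w) ∧
      IntegrableOn (fun x => G (H x (weakGrad Ω w x))) Ω volume ∧
      Integrable (fun s => j s * boundaryTrace Ω γ w s) (surfaceMeasure ΓN)) ∧
    ∃ u ∈ admissibleSet Ω ΓD γ ψ,
      IsGLB (costFunctional Ω ΓN γ G H j '' admissibleSet Ω ΓD γ ψ)
        (costFunctional Ω ΓN γ G H j u) := by
  have hα := hG.one_lt
  have hβ := hH.one_lt
  have hp : 1 < α * β := by nlinarith
  have hp1 : 1 ≤ γ := by rw [hγ]; simpa using hp.le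
  have hpt : γ ≠ ⊤ := by rw [hγ]; exact ENNReal.ofReal_ne_top
  have hF := hH.isConvexIntegrand hG
  have hb := hΩ.isBounded
  have hD : ΓD ⊆ frontier Ω := by
    obtain ⟨U, -, rfl⟩ := hΓ.relOpen_dirichlet
    exact inter_subset_left
  have hN : ΓN ⊆ frontier Ω := by
    obtain ⟨U, -, rfl⟩ := hΓ.relOpen_neumann
    exact inter_subset_left
  have hfin := hΩ.isFiniteMeasure_surfaceMeasure
  have hfD : IsFiniteMeasure (surfaceMeasure ΓD) :=
    isFiniteMeasure_of_le _ (surfaceMeasure_mono hD)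
  have hfN : IsFiniteMeasure (surfaceMeasure ΓN) :=
    isFiniteMeasure_of_le _ (surfaceMeasure_mono hN)
  have hσ : 0 < (surfaceMeasure ΓD).real univ := by
    refine ENNReal.toReal_pos (ne_of_gt ?_) (measure_ne_top _ _)
    refine hΓ.dirichlet_pos.trans_le ?_
    simp only [surfaceMeasure, Measure.restrict_apply_univ]
    exact Measure.restrict_apply_le _ _
  have hconj : ENNReal.HolderTriple (ENNReal.ofReal (Real.conjExponent β)) (ENNReal.ofReal β) 1 :=
    (Real.HolderConjugate.conjExponent hβ).symm.ennrealOfReal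
  -- Traces lie in L^γ, hence in L^β as γ = αβ ≥ β, so they pair with j in the dual exponent.
  have hq : ENNReal.ofReal β ≤ γ := by
    rw [hγ]
    exact ENNReal.ofReal_le_ofReal (by nlinarith)
  obtain ⟨K, -, hK⟩ := exists_integral_mul_le hq hj
  have htN : ∀ {w}, MemW1 Ω γ w → MemLp (boundaryTrace Ω γ w) γ (surfaceMeasure ΓN) :=
    fun hw => (memLp_boundaryTrace hΩ hp1 hpt hw).mono_measure (surfaceMeasure_mono hN)
  refine ⟨fun w hw => ⟨isTrace_boundaryTrace hΩ hp1 hpt hw,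
    hF.integrableOn hΩ.isOpen hb hp (hγ ▸ hw.memLp_weakGrad hΩ.isOpen), (hK _ (htN hw)).1⟩, ?_⟩
  suffices h : ∃ u ∈ admissibleSet Ω ΓD γ ψ, ∀ w ∈ admissibleSet Ω ΓD γ ψ,
      costFunctional Ω ΓN γ G H j u ≤ costFunctional Ω ΓN γ G H j w by
    obtain ⟨u, hu, hmin⟩ := h
    refine ⟨u, hu, IsLeast.isGLB ⟨mem_image_of_mem _ hu, ?_⟩⟩
    rintro _ ⟨w, hw, rfl⟩
    exact hmin w hw
  have hji : Integrable j (surfaceMeasure ΓN) := by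
    simpa using (hK (fun _ => 1) (memLp_const 1)).1
  -- As j ≥ 0, a vanishing integral means j = 0 almost everywhere; only then is continuity of ψ
  -- needed.
  rcases (integral_nonneg_of_ae hj0).eq_or_lt with h0 | hjpos
  · have hjz : ∀ᵐ s ∂(surfaceMeasure ΓN), j s = 0 :=
      (integral_eq_zero_iff_of_nonneg_ae hj0 hji).1 h0.symm
    have hcost : ∀ w, costFunctional Ω ΓN γ G H j w = ∫ x in Ω, G (H x (weakGrad Ω w x)) := by
      intro w
      have : ∫ s, j s * boundaryTrace Ω γ w s ∂(surfaceMeasure ΓN) = 0 := by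
        refine integral_eq_zero_of_ae ?_
        filter_upwards [hjz] with s hs
        simp [hs]
      rw [costFunctional, this, sub_zero]
    obtain ⟨v, hv, hmin⟩ := hF.exists_free_minimizer hΩ hp
    obtain ⟨M, hM⟩ := hF.exists_ae_le_of_free_minimizer hΩ hp hv hmin
    rw [← hγ] at hv hmin
    obtain ⟨c, hc⟩ := exists_sub_const_mem_admissibleSet hΩ hp1 hpt hD hv hψ (hψc hjz) hM
    refine ⟨_, hc, fun w hw => ?_⟩
    rw [hcost, hcost]
    refine le_of_eq_of_le (integral_congr_ae ?_) (hmin w hw.1)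
    filter_upwards [weakGrad_add_const hΩ.isOpen hv c] with x hx
    rw [hx]
  · subst hγ
    exact hF.exists_obstacle_minimizer hΩ hp hD hN hσ hq hj hjpos hψ
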